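/- **Setting.** A *contour* is an oriented simple continuous, piecewise $C^1$ curve in $\mathbb C$ that is either closed or extends to infinity at both ends. Let $\Omega\subset\mathbb C$ be a finite union of pairwise disjoint contours that do not approach each other exponentially fast at infinity, i.e. for every $\eta>0$ there is $\kappa>0$ with $|u-v|\ge \kappa e^{-\eta|u|}$ whenever $u,v$ lie on different contours of $\Omega$ (this holds, for instance, if the contours have positive mutual distance). Let $L^2(\Omega)$, $L^\infty(\Omega)$ be taken with respect to arc length. Fix an integer $m\ge1$, and for $x,y,t\in\mathbb R^m$ and $z\in\mathbb C$ put $$\Delta(z)=\operatorname{diag}\bigl(e^{t_1z^3+y_1z^2+x_1z},\dots,e^{t_mz^3+y_mz^2+x_mz},1\bigr).$$ Let $F,G:\Omega\to\mathbb C^{m+1}$ be constant on each connected component of $\Omega$, independent of $(x,y,t)$, with $F_i(u)G_i(u)=0$ for all $u\in\Omega$ and $1\le i\le m+1$. Let $U\subset\mathbb R^{3m}$ be an open set of parameters $(x,y,t)$, and let $c=c(u\mid x,y,t)$ be a scalar function that does not vanish on $\Omega$ for $(x,y,t)\in U$. Assume that for every $(x,y,t)\in U$ the functions $$f(u)=c(u)\Delta(u)F(u),\qquad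 g(u)=c(u)^{-1}\Delta(u)^{-1}G(u)$$ belong to $L^2(\Omega)\cap L^\infty(\Omega)$, and that the integral operator $(\mathsf H\varphi)(u)=\int_\Omega \mathsf H(u,v)\varphi(v)\,dv$ with kernel $\mathsf H(u,v)=\frac{f(u)^Tg(v)}{u-v}$ for $u\ne v$ and $\mathsf H(u,u)=0$ is a bounded operator on $L^2(\Omega)$ (so $\mathsf H$ is a *strongly cubic integrable operator*) such that $I-\mathsf H$ is invertible. Define the $(m+1)\times(m+1)$ matrix $$Y_1=Y_1(x,y,t)=\int_\Omega\bigl((I-\mathsf H)^{-1}f\bigr)(s)\,g(s)^T\,ds=\begin{pmatrix} q&p\\ r&s\end{pmatrix},$$ with blocks $q,p,r,s$ of sizes $m\times m$, $m\times1$, $1\times m$, $1\times1$. Let $\partial=\sum_{k=1}^m t_k\partial_{x_k}$, $T=\operatorname{diag}(t_1,\dots,t_m)$, $\hat T=\operatorname{diag}(t_1,\dots,t_m,0)$, $\hat Y=\operatorname{diag}(y_1,\dots,y_m,0)$, $\hat X=\operatorname{diag}(x_1,\dots,x_m,0)$, and $[A,B]=AB-BA$. **Theorem.** For all fixed $y,t$,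 the function $x\mapsto Y_1(x,y,t)$ is twice continuously differentiable on $\{x:(x,y,t)\in U\}$, and for all $(x,y,t)\in U$ $$3\,\partial^2Y_1=2[\partial Y_1,\hat Y]+\bigl[[Y_1,\hat T],\;3\,\partial Y_1-2[Y_1,\hat Y]-\hat X\bigr],\qquad\text{and}\qquad \partial s=r\,T\,p .$$ -/

import Mathlib

open MeasureTheory Set Filter Topology

noncomputable section

namespace CubicIIKS

/-! ### Contours -/

/-- An oriented simple contour in `ℂ` without finite end points, given by a continuous, piecewise
`C¹` parametrization `γ`.  Either it is closed (`γ` is `1`-periodic and `[0, 1)` is a fundamental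
domain), or it extends to infinity at both ends (`γ` is a proper map on the whole line). -/
structure Contour where
  /-- the parametrization -/
  γ : ℝ → ℂ
  /-- the set of parameters that runs through the contour once -/
  dom : Set ℝ
  continuous : Continuous γ
  piecewise_C1 : ∃ D : Set ℝ, (∀ R : ℝ, (D ∩ Icc (-R) R).Finite) ∧
    ∀ a b : ℝ, a < b → Disjoint (Ioo a b) D → ContDiffOn ℝ 1 γ (Icc a b)
  closed_or_infinite :
    (dom = Ico 0 1 ∧ Function.Periodic γ 1) ∨
      (dom = univ ∧ Tendsto γ (cocompact ℝ) (cocompact ℂ))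
  simple : InjOn γ dom

/-- The set of points of a contour. -/
def Contour.carrier (C : Contour) : Set ℂ := C.γ '' C.dom

/-- Arc length `|dz|` on a contour, as a measure on `ℂ`. -/
def Contour.arcLength (C : Contour) : Measure ℂ :=
  ((volume.restrict C.dom).withDensity fun s => ‖deriv C.γ s‖ₑ).map C.γ

/-- A finite union of pairwise disjoint simple contours.  The last condition concerns only contours
that approach each other at infinity: they do not do so exponentially fast. -/
structure ContourUnion where
  /-- the number of contours -/
  n : ℕ
  /-- the contours -/
  contour : Fin n → Contour
  disjoint : ∀ k l, k ≠ l → Disjoint (contour k).carrier (contour l).carrier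
  separated : ∀ η : ℝ, 0 < η → ∃ κ : ℝ, 0 < κ ∧ ∀ k l, k ≠ l →
    ∀ u ∈ (contour k).carrier, ∀ v ∈ (contour l).carrier, κ * Real.exp (-η * ‖u‖) ≤ ‖u - v‖

namespace ContourUnion

variable (Ω : ContourUnion)

/-- The set of points of a union of contours. -/
def carrier : Set ℂ := ⋃ k, (Ω.contour k).carrier

/-- Arc length `|dz|` on a union of contours, as a measure on `ℂ`. -/
def arcLength : Measure ℂ := ∑ k, (Ω.contour k).arcLength

/-- The contour integral `∫_Ω h(z) dz`. -/
def contourIntegral (h : ℂ → ℂ) : ℂ :=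
  ∑ k, ∫ s in (Ω.contour k).dom, h ((Ω.contour k).γ s) * deriv (Ω.contour k).γ s

/-- The Hilbert space `L²(Ω)`. -/
abbrev L2 : Type := Lp ℂ 2 Ω.arcLength

/-- The class in `L²(Ω)` of a square integrable function (and `0` for any other function). -/
def toL2 (h : ℂ → ℂ) : Ω.L2 :=
  open Classical in if hh : MemLp h 2 Ω.arcLength then hh.toLp h else 0

/-- The bounded operator `T` on `L²(Ω)` is the integral operator, with respect to `dz`, with
kernel `K`. -/
def IsIntegralOperator (T : Ω.L2 →L[ℂ] Ω.L2) (K : ℂ → ℂ → ℂ) : Prop :=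
  ∀ φ : Ω.L2, (∀ᵐ u ∂Ω.arcLength, Integrable (fun v => K u v * φ v) Ω.arcLength) ∧
    T φ =ᵐ[Ω.arcLength] fun u => Ω.contourIntegral fun v => K u v * φ v

end ContourUnion

/-! ### Parameters, the matrices `Δ`, `T̂`, `Ŷ`, `X̂`, and the operator `∂` -/

/-- The parameters `(x, y, t) ∈ ℝ^m × ℝ^m × ℝ^m`. -/
abbrev Params (m : ℕ) : Type := (Fin m → ℝ) × (Fin m → ℝ) × (Fin m → ℝ)

/-- The index set `{1, …, m} ∪ {m + 1}` of the vectors and matrices of size `m + 1`. -/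
abbrev Idx (m : ℕ) : Type := Fin m ⊕ Fin 1

variable {m : ℕ}

/-- `Δ(z) = diag(e^{t₁z³ + y₁z² + x₁z}, …, e^{t_m z³ + y_m z² + x_m z}, 1)`. -/
def Delta (θ : Params m) (z : ℂ) : Matrix (Idx m) (Idx m) ℂ :=
  Matrix.diagonal (Sum.elim
    (fun j => Complex.exp ((θ.2.2 j : ℂ) * z ^ 3 + (θ.2.1 j : ℂ) * z ^ 2 + (θ.1 j : ℂ) * z))
    (fun _ => 1))

/-- For `a ∈ ℝ^m`, the `(m + 1) × (m + 1)` matrix `diag(a₁, …, a_m, 0)`. -/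
def hatDiag (a : Fin m → ℝ) : Matrix (Idx m) (Idx m) ℂ :=
  Matrix.diagonal (Sum.elim (fun j => (a j : ℂ)) (fun _ => 0))

/-- The entrywise partial derivative `∂M / ∂x_k` of a matrix function of the parameters. -/
def partialX {ι κ : Type*} (k : Fin m) (M : Params m → Matrix ι κ ℂ) (θ : Params m) :
    Matrix ι κ ℂ :=
  Matrix.of fun i j =>
    deriv (fun s : ℝ => M (Function.update θ.1 k s, θ.2.1, θ.2.2) i j) (θ.1 k)

/-- `∂ = ∑ₖ tₖ ∂/∂xₖ`. -/
def del {ι κ : Type*} (M : Params m → Matrix ι κ ℂ) (θ : Params m) : Matrix ι κ ℂ :=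
  ∑ k, (θ.2.2 k : ℂ) • partialX k M θ

/-! ### Cubic integrable operators -/

/-- The kernel `f(u)ᵀ g(v) / (u - v)` for `u ≠ v`, and `0` for `u = v`. -/
def iiksKernel (f g : ℂ → Idx m → ℂ) (u v : ℂ) : ℂ :=
  open Classical in if u = v then 0 else (f u ⬝ᵥ g v) / (u - v)

/-- The vector function `f(u) = c(u) Δ(u) F(u)`. -/
def vecF (F : ℂ → Idx m → ℂ) (c : Params m → ℂ → ℂ) (θ : Params m) (u : ℂ) : Idx m → ℂ :=
  c θ u • (Delta θ u).mulVec (F u)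

/-- The vector function `g(u) = c(u)⁻¹ Δ(u)⁻¹ G(u)`. -/
def vecG (G : ℂ → Idx m → ℂ) (c : Params m → ℂ → ℂ) (θ : Params m) (u : ℂ) : Idx m → ℂ :=
  (c θ u)⁻¹ • (Delta θ u)⁻¹.mulVec (G u)

/-- A cubic integrable operator on `L²(Ω)`, for a union of contours `Ω` and for the parameters
`(x, y, t)` in the set `U`. -/
structure CubicIntegrableOperator (Ω : ContourUnion) (U : Set (Params m)) where
  /-- the vector function `F`, which does not depend on the parameters -/
  F : ℂ → Idx m → ℂ
  /-- the vector function `G`, which does not depend on the parameters -/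
  G : ℂ → Idx m → ℂ
  /-- the scalar function, which may depend on the parameters -/
  c : Params m → ℂ → ℂ
  /-- the bounded operator on `L²(Ω)` -/
  op : Params m → (Ω.L2 →L[ℂ] Ω.L2)
  orthogonal : ∀ u ∈ Ω.carrier, ∀ i, F u ⬝ᵥ (Matrix.single i i (1 : ℂ)).mulVec (G u) = 0
  c_ne_zero : ∀ θ ∈ U, ∀ u ∈ Ω.carrier, c θ u ≠ 0
  memLp_f : ∀ θ ∈ U, MemLp (vecF F c θ) 2 Ω.arcLength ∧ MemLp (vecF F c θ) ⊤ Ω.arcLength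
  memLp_g : ∀ θ ∈ U, MemLp (vecG G c θ) 2 Ω.arcLength ∧ MemLp (vecG G c θ) ⊤ Ω.arcLength
  isIntegralOperator : ∀ θ ∈ U,
    Ω.IsIntegralOperator (op θ) (iiksKernel (vecF F c θ) (vecG G c θ))

namespace CubicIntegrableOperator

variable {Ω : ContourUnion} {U : Set (Params m)}

/-- A cubic integrable operator on a union of contours `Ω` is strongly cubic integrable if `F` and
`G` are constant on each connected component of `Ω`. -/
def IsStrong (H : CubicIntegrableOperator Ω U) : Prop :=
  ∀ u ∈ Ω.carrier, ∀ v ∈ connectedComponentIn Ω.carrier u, H.F v = H.F u ∧ H.G v = H.G u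

/-- The matrix `Y₁ = ∫_Ω ((I - H)⁻¹ f)(s) g(s)ᵀ ds`. -/
def Y₁ (H : CubicIntegrableOperator Ω U) (θ : Params m) : Matrix (Idx m) (Idx m) ℂ :=
  Matrix.of fun i j => Ω.contourIntegral fun s =>
    Ring.inverse (1 - H.op θ) (Ω.toL2 fun u => vecF H.F H.c θ u i) s * vecG H.G H.c θ s j

end CubicIntegrableOperator

end CubicIIKS

end

open CubicIIKS

/-! Three mechanisms carry the proof.

Regularity. `F` and `G` are constant on each contour and `F_i G_i = 0`, so for each `i` the contours
carrying `F_i` and those carrying `G_i` are different, and the kernel `∑ f_k(u) g_k(v) / (u - v)`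
has no diagonal singularity (`IsStrong.separated`). Because `U` is open, `x_k` and `y_k` may be
moved slightly both ways. This multiplies suitable products `f_i g_j` by `e^{±σu}` and `e^{±σu²}`,
and since `|Re u|` and `|Re u²|` cannot both be small compared with `|u|`, all products `f_i g_j`
decay exponentially (`exists_exp_decay`). The vectors `f`, `g` themselves need not decay, as `c` is
arbitrary. Rescaling by `√(|g|/|f|)` distributes the decay evenly and yields data `a`, `b`
(`exists_isData`). This conjugation is possibly unbounded, but it preserves invertibility of `I - H`
and the matrix `Y₁` (`Good.isUnit_and_moment_eq`). The new operator is Hilbert-Schmidt, and the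
subexponential separation of the contours leaves room for its kernel to depend analytically on `x`.

Deformation. Write `Y_n` for `moment n`, that is `∫ ((I - H)⁻¹ a) sⁿ bᵀ`, so that `Y_0` here is the
matrix `Y₁` of the theorem. Differentiation in `x_k` multiplies the `k`-th kernel summand by `u -
v`, which leaves the rank one kernel `a_k(u) b_k(v)`. Together with the commutator of the resolvent
with multiplication by `u`, this gives `∂_k Y_n = Y_0 E_k Y_n + E_k (Y_{n+1} - Y_0 Y_n) - Y_{n+1}
E_k`, where `E_k` is the `k`-th diagonal matrix unit (`Good.hasDerivAt_moment`). Hence `∂` and `∂²`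
of `Y_0` are polynomials in `Y_0, Y_1, Y_2` and `T̂`.

Integration by parts. Differentiating `(I - H)⁻¹ a` along the contours, with boundary terms removed
by the decay, gives an integral equation with explicit right side (`IsData.exists_deriv`). Pairing
its solution with `b_j` in two ways yields an algebraic relation between `Y_0, Y_1, Y_2`
(`IsData.moment_relation`).

The commutator of this relation with `T̂` is the matrix equation (`lax_identity`). The scalar
equation is the lower right block of the formula for `∂Y_0`: the last row and column of `T̂` vanish,
so only `Y_0 T̂ Y_0` contributes. -/

noncomputable section

namespace CubicIIKS

/-! ### Contour integrals -/

namespace Contour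

variable (C : Contour)

theorem measurableSet_dom : MeasurableSet C.dom := by
  rcases C.closed_or_infinite with ⟨h, -⟩ | ⟨h, -⟩ <;> rw [h]
  exacts [measurableSet_Ico, MeasurableSet.univ]

theorem isPreconnected_carrier : IsPreconnected C.carrier := by
  refine IsPreconnected.image ?_ _ C.continuous.continuousOn
  rcases C.closed_or_infinite with ⟨h, -⟩ | ⟨h, -⟩ <;> rw [h]
  exacts [isPreconnected_Ico, isPreconnected_univ]

theorem measurableSet_carrier : MeasurableSet C.carrier :=
  C.measurableSet_dom.image_of_continuousOn_injOn C.continuous.continuousOn C.simple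

theorem mem_carrier (s : ℝ) : C.γ s ∈ C.carrier := by
  rcases C.closed_or_infinite with ⟨h, hp⟩ | ⟨h, -⟩
  · refine ⟨Int.fract s, ?_, ?_⟩
    · rw [h]; exact ⟨Int.fract_nonneg s, Int.fract_lt_one s⟩
    · have := hp.sub_int_mul_eq (x := s) ⌊s⌋
      rwa [mul_one] at this
  · exact ⟨s, by rw [h]; trivial, rfl⟩

/-- The unit tangent vector of a contour, as a measurable function on `ℂ`. -/
theorem exists_tangent : ∃ τ : ℂ → ℂ, Measurable τ ∧ (∀ u, ‖τ u‖ ≤ 1) ∧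
    ∀ s ∈ C.dom, τ (C.γ s) * ‖deriv C.γ s‖ = deriv C.γ s := by
  have he := ContinuousOn.measurableEmbedding C.measurableSet_dom C.continuous.continuousOn C.simple
  -- Where the derivative vanishes the quotient is `0` by convention, which is consistent with the
  -- required identity.
  have hg : Measurable fun s : C.dom => deriv C.γ s / (‖deriv C.γ s‖ : ℂ) := by
    have := measurable_deriv C.γ
    fun_prop
  obtain ⟨g, hgm, hgc⟩ := he.exists_measurable_extend hg fun _ => ⟨0⟩
  refine ⟨C.carrier.indicator g, hgm.indicator C.measurableSet_carrier, fun u => ?_, fun s hs => ?_⟩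
  · by_cases hu : u ∈ C.carrier
    · rw [indicator_of_mem hu]
      obtain ⟨s, hs, rfl⟩ := hu
      have := congrFun hgc ⟨s, hs⟩
      simp only [Function.comp_apply, domRestrict_apply] at this
      rw [this, norm_div, Complex.norm_real, norm_norm]
      exact div_self_le_one _
    · rw [indicator_of_notMem hu]; simp
  · rw [indicator_of_mem (C.mem_carrier s)]
    have := congrFun hgc ⟨s, hs⟩
    simp only [Function.comp_apply, domRestrict_apply] at this
    rw [this]
    by_cases h0 : deriv C.γ s = 0
    · simp [h0]
    · exact div_mul_cancel₀ _ (by simpa using h0)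

/-- Arc length is the image of a measure with density `|γ'|`, so it gives no information at
parameters where `γ' = 0`. -/
theorem ae_of_ae_arcLength {P : ℂ → Prop} (h : ∀ᵐ u ∂C.arcLength, P u) :
    ∀ᵐ s ∂volume.restrict C.dom, deriv C.γ s ≠ 0 → P (C.γ s) := by
  have h1 := ae_of_ae_map C.continuous.measurable.aemeasurable h
  rw [ae_withDensity_iff (measurable_deriv C.γ).enorm] at h1
  filter_upwards [h1] with s hs h0
  exact hs (by simpa using h0)

theorem ae_mem_carrier : ∀ᵐ u ∂C.arcLength, u ∈ C.carrier := by
  unfold arcLength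
  exact (ae_map_iff (p := fun u => u ∈ C.carrier) C.continuous.measurable.aemeasurable
    C.measurableSet_carrier).2 (Eventually.of_forall C.mem_carrier)

theorem integral_arcLength {h : ℂ → ℂ} (hh : AEStronglyMeasurable h C.arcLength) :
    ∫ u, h u ∂C.arcLength = ∫ s in C.dom, (‖deriv C.γ s‖ : ℂ) * h (C.γ s) := by
  unfold arcLength at hh ⊢
  rw [integral_map C.continuous.measurable.aemeasurable hh,
    integral_withDensity_eq_integral_toReal_smul (measurable_deriv C.γ).enorm (by simp)]
  simp

theorem integrable_arcLength {h : ℂ → ℂ} (hh : Integrable h C.arcLength) :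
    IntegrableOn (fun s => (‖deriv C.γ s‖ : ℂ) * h (C.γ s)) C.dom := by
  unfold arcLength at hh
  rw [integrable_map_measure hh.1 C.continuous.measurable.aemeasurable,
    integrable_withDensity_iff_integrable_smul' (measurable_deriv C.γ).enorm (by simp)] at hh
  simpa [IntegrableOn] using hh

theorem exists_Ioo_disjoint {D : Set ℝ} (hD : ∀ R : ℝ, (D ∩ Icc (-R) R).Finite) (s : ℝ) :
    ∃ δ > 0, Disjoint (Ioo s (s + δ)) D ∧ (s ∉ D → Disjoint (Ioo (s - δ) (s + δ)) D) := by
  have hfin := (hD (|s| + 1)).subset (sdiff_subset (t := {s}))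
  have hopen : ((D ∩ Icc (-(|s| + 1)) (|s| + 1)) \ {s})ᶜ ∈ 𝓝 s :=
    hfin.isClosed.isOpen_compl.mem_nhds (by simp)
  obtain ⟨δ, hδ, hb⟩ := Metric.mem_nhds_iff.1 hopen
  have key : ∀ r, |r - s| < min δ 1 → r ∈ D → r = s := by
    intro r hr hrD
    by_contra hne
    refine hb (show r ∈ Metric.ball s δ from ?_) ⟨⟨hrD, ?_⟩, hne⟩
    · rw [Metric.mem_ball, Real.dist_eq]; exact hr.trans_le (min_le_left _ _)
    · have h1 := hr.trans_le (min_le_right _ _)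
      rw [abs_lt] at h1
      constructor <;> linarith [neg_abs_le s, le_abs_self s]
  refine ⟨min δ 1, by positivity, ?_, fun hs => ?_⟩
  · rw [Set.disjoint_left]
    intro r hr hrD
    have := key r (by rw [abs_lt]; constructor <;> linarith [hr.1, hr.2]) hrD
    exact hr.1.ne' this
  · rw [Set.disjoint_left]
    intro r hr hrD
    have := key r (by rw [abs_lt]; constructor <;> linarith [hr.1, hr.2]) hrD
    exact hs (this ▸ hrD)

/-- A contour is differentiable outside a countable set of parameters. -/
theorem exists_countable_differentiableAt :
    ∃ D : Set ℝ, D.Countable ∧ ∀ s ∉ D, DifferentiableAt ℝ C.γ s := by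
  obtain ⟨D, hD, hC⟩ := C.piecewise_C1
  refine ⟨D, ?_, fun s hs => ?_⟩
  · have : D ⊆ ⋃ n : ℕ, D ∩ Icc (-(n : ℝ)) n := by
      intro s hs
      obtain ⟨n, hn⟩ := exists_nat_ge |s|
      exact mem_iUnion.2 ⟨n, hs, abs_le.1 hn⟩
    exact (countable_iUnion fun n : ℕ => (hD n).countable).mono this
  · obtain ⟨δ, hδ, -, h2⟩ := exists_Ioo_disjoint hD s
    exact ((hC (s - δ) (s + δ) (by linarith) (h2 hs)).contDiffAt
      (Icc_mem_nhds (by linarith) (by linarith))).differentiableAt (by norm_num)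

/-- An inequality that holds almost everywhere on an infinite contour holds everywhere on it. -/
theorem le_of_ae_le (hdom : C.dom = univ) {N : ℂ → ℝ} (hN : Continuous N) {B : ℝ}
    (h : ∀ᵐ u ∂C.arcLength, N u ≤ B) (s : ℝ) : N (C.γ s) ≤ B := by
  by_contra hlt
  rw [not_le] at hlt
  have hae := C.ae_of_ae_arcLength h
  rw [hdom, Measure.restrict_univ] at hae
  obtain ⟨D, hD, hC⟩ := C.piecewise_C1
  obtain ⟨δ, hδ, hdis, -⟩ := exists_Ioo_disjoint hD s
  have hopen : IsOpen {r | B < N (C.γ r)} := isOpen_lt continuous_const (hN.comp C.continuous)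
  obtain ⟨ρ, hρ, hball⟩ := Metric.isOpen_iff.1 hopen s hlt
  obtain ⟨η, hη, hηδ, hηρ⟩ : ∃ η : ℝ, 0 < η ∧ η ≤ δ ∧ η < ρ :=
    ⟨min δ (ρ / 2), by positivity, min_le_left _ _, (min_le_right _ _).trans_lt (by linarith)⟩
  have hlt' : s < s + η := by linarith
  have hC1 := hC s (s + η) hlt' (hdis.mono_left (Ioo_subset_Ioo_right (by linarith)))
  -- The inequality fails on the whole interval, which therefore has no arc length. Then `γ' = 0`
  -- almost everywhere on it, so `γ` takes the same value at both ends, against injectivity.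
  have hzero : ∀ᵐ r, r ∈ Ioo s (s + η) → deriv C.γ r = 0 := by
    filter_upwards [hae] with r hr hrI
    by_contra h0
    have : r ∈ Metric.ball s ρ := by
      rw [Metric.mem_ball, Real.dist_eq, abs_lt]
      constructor <;> linarith [hrI.1, hrI.2]
    exact absurd (hr h0) (not_le.2 (hball this))
  have hftc : ∫ r in s..(s + η), (0 : ℂ) = C.γ (s + η) - C.γ s := by
    have hi : IntervalIntegrable (derivWithin C.γ (Icc s (s + η))) volume s (s + η) :=
      ContinuousOn.intervalIntegrable_of_Icc hlt'.le
        (hC1.continuousOn_derivWithin (uniqueDiffOn_Icc hlt') le_rfl)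
    have hI := intervalIntegral.integral_eq_sub_of_hasDeriv_right_of_le hlt'.le
      C.continuous.continuousOn (f' := derivWithin C.γ (Icc s (s + η))) (fun r hr => ?_) hi
    · rw [← hI]
      refine intervalIntegral.integral_congr_ae ?_
      have hne : ∀ᵐ r : ℝ, r ≠ s + η := by simp [ae_iff, measure_singleton]
      filter_upwards [hzero, hne] with r hr hr' hrI
      rw [uIoc_of_le hlt'.le] at hrI
      have hrI' : r ∈ Ioo s (s + η) := ⟨hrI.1, lt_of_le_of_ne hrI.2 hr'⟩
      rw [derivWithin_of_mem_nhds (Icc_mem_nhds hrI'.1 hrI'.2), hr hrI']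
    · have hd : DifferentiableWithinAt ℝ C.γ (Icc s (s + η)) r :=
        (hC1 r (Ioo_subset_Icc_self hr)).differentiableWithinAt (by norm_num)
      exact (hd.hasDerivWithinAt.hasDerivAt (Icc_mem_nhds hr.1 hr.2)).hasDerivWithinAt
  rw [intervalIntegral.integral_zero, eq_comm, sub_eq_zero] at hftc
  have := C.simple (by rw [hdom]; trivial) (by rw [hdom]; trivial) hftc
  linarith

/-- The contour integral of the derivative of a function that is differentiable near the contour
and vanishes at infinity is zero. -/
theorem integral_deriv_eq_zero {Φ Φ' : ℂ → ℂ} (hd : ∀ u ∈ C.carrier, HasDerivAt Φ (Φ' u) u)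
    (hint : IntegrableOn (fun s => Φ' (C.γ s) * deriv C.γ s) C.dom)
    (hlim : C.dom = univ → Tendsto (fun s => Φ (C.γ s)) (cocompact ℝ) (𝓝 0)) :
    ∫ s in C.dom, Φ' (C.γ s) * deriv C.γ s = 0 := by
  obtain ⟨D, hD, hdiff⟩ := C.exists_countable_differentiableAt
  have hcont : Continuous fun s => Φ (C.γ s) := continuous_iff_continuousAt.2 fun s =>
    (hd _ (C.mem_carrier s)).continuousAt.comp C.continuous.continuousAt
  have hder : ∀ s ∉ D, HasDerivAt (fun s => Φ (C.γ s)) (Φ' (C.γ s) * deriv C.γ s) s := by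
    intro s hs
    have := (hd _ (C.mem_carrier s)).scomp s (hdiff s hs).hasDerivAt
    simpa [mul_comm] using! this
  rcases C.closed_or_infinite with ⟨h, hp⟩ | ⟨h, -⟩
  · rw [h] at hint ⊢
    rw [integral_Ico_eq_integral_Ioc, ← intervalIntegral.integral_of_le zero_le_one,
      MeasureTheory.integral_eq_of_hasDerivAt_off_countable (fun s => Φ (C.γ s)) _ hD
        hcont.continuousOn (fun s hs => hder s hs.2)]
    · have := hp 0
      rw [zero_add] at this
      simp [this]
    · rw [intervalIntegrable_iff_integrableOn_Ico_of_le zero_le_one]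
      exact hint
  · have hl := hlim h
    rw [h] at hint ⊢
    rw [cocompact_eq_atBot_atTop, tendsto_sup] at hl
    rw [Measure.restrict_univ]
    have hint' : Integrable fun s => Φ' (C.γ s) * deriv C.γ s := by
      rwa [integrableOn_univ] at hint
    have h1 := intervalIntegral_tendsto_integral hint' tendsto_neg_atTop_atBot tendsto_id
    have h2 : Tendsto (fun R : ℝ => Φ (C.γ R) - Φ (C.γ (-R))) atTop (𝓝 (0 - 0)) :=
      hl.2.sub (hl.1.comp tendsto_neg_atTop_atBot)
    rw [sub_zero] at h2
    refine tendsto_nhds_unique h1 (h2.congr fun R => ?_)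
    rw [MeasureTheory.integral_eq_of_hasDerivAt_off_countable (fun s => Φ (C.γ s)) _ hD
        hcont.continuousOn (fun s hs => hder s hs.2) hint'.intervalIntegrable]
    rfl

end Contour

/-! ### Contour integrals as weighted arc length integrals -/

namespace ContourUnion

variable (Ω : ContourUnion)

instance : SFinite Ω.arcLength := by
  unfold arcLength Contour.arcLength
  rw [← Measure.sum_fintype]
  infer_instance

theorem contour_arcLength_le (k : Fin Ω.n) : (Ω.contour k).arcLength ≤ Ω.arcLength :=
  Finset.single_le_sum (f := fun k => (Ω.contour k).arcLength) (fun _ _ => Measure.zero_le _)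
    (Finset.mem_univ k)

theorem ae_iff_contour {P : ℂ → Prop} :
    (∀ᵐ u ∂Ω.arcLength, P u) ↔ ∀ k, ∀ᵐ u ∂(Ω.contour k).arcLength, P u := by
  simp only [ae_iff, arcLength, Measure.coe_finsetSum, Finset.sum_apply, Finset.sum_eq_zero_iff,
    Finset.mem_univ, true_imp_iff]

theorem ae_mem_carrier : ∀ᵐ u ∂Ω.arcLength, u ∈ Ω.carrier :=
  Ω.ae_iff_contour.2 fun k => (Ω.contour k).ae_mem_carrier.mono fun _ hu => mem_iUnion.2 ⟨k, hu⟩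

/-- The unit tangent vector of a union of contours. -/
theorem exists_tangent : ∃ τ : ℂ → ℂ, Measurable τ ∧ (∀ u, ‖τ u‖ ≤ 1) ∧
    ∀ k, ∀ s ∈ (Ω.contour k).dom,
      τ ((Ω.contour k).γ s) * ‖deriv (Ω.contour k).γ s‖ = deriv (Ω.contour k).γ s := by
  choose τ hm hle heq using fun k => (Ω.contour k).exists_tangent
  have hval : ∀ k, ∀ u ∈ (Ω.contour k).carrier,
      ∑ l, (Ω.contour l).carrier.indicator (τ l) u = τ k u := by
    intro k u hu
    rw [Finset.sum_eq_single k, indicator_of_mem hu]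
    · intro l _ hl
      exact indicator_of_notMem (Set.disjoint_left.1 (Ω.disjoint k l hl.symm) hu) _
    · simp
  refine ⟨fun u => ∑ l, (Ω.contour l).carrier.indicator (τ l) u, ?_, fun u => ?_, fun k s hs => ?_⟩
  · exact Finset.measurable_fun_sum _ fun l _ =>
      (hm l).indicator (Ω.contour l).measurableSet_carrier
  · by_cases h : ∃ k, u ∈ (Ω.contour k).carrier
    · obtain ⟨k, hk⟩ := h
      simpa only [hval k u hk] using hle k u
    · push Not at h
      simp [indicator_of_notMem (h _)]
  · simp only [hval k _ ((Ω.contour k).mem_carrier s), heq k s hs]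

/-- A unit tangent vector of `Ω`, where it exists. -/
def tangent : ℂ → ℂ := Ω.exists_tangent.choose

theorem measurable_tangent : Measurable Ω.tangent := Ω.exists_tangent.choose_spec.1

theorem norm_tangent_le (u : ℂ) : ‖Ω.tangent u‖ ≤ 1 := Ω.exists_tangent.choose_spec.2.1 u

theorem tangent_mul_norm_deriv (k : Fin Ω.n) {s : ℝ} (hs : s ∈ (Ω.contour k).dom) :
    Ω.tangent ((Ω.contour k).γ s) * ‖deriv (Ω.contour k).γ s‖ = deriv (Ω.contour k).γ s :=
  Ω.exists_tangent.choose_spec.2.2 k s hs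

theorem integrable_mul_tangent {h : ℂ → ℂ} {μ : Measure ℂ} (hh : Integrable h μ) :
    Integrable (fun u => h u * Ω.tangent u) μ :=
  hh.mul_bdd (c := 1) Ω.measurable_tangent.aestronglyMeasurable
    (Eventually.of_forall Ω.norm_tangent_le)

theorem integrableOn_contour {h : ℂ → ℂ} (hh : Integrable (fun u => h u * Ω.tangent u) Ω.arcLength)
    (k : Fin Ω.n) :
    IntegrableOn (fun s => h ((Ω.contour k).γ s) * deriv (Ω.contour k).γ s) (Ω.contour k).dom := by
  refine ((Ω.contour k).integrable_arcLength
    (hh.mono_measure (Ω.contour_arcLength_le k))).congr ?_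
  filter_upwards [ae_restrict_mem (Ω.contour k).measurableSet_dom] with s hs
  rw [mul_left_comm, mul_comm (‖deriv (Ω.contour k).γ s‖ : ℂ), Ω.tangent_mul_norm_deriv k hs]

/-- The space `L²(Ω)` refers to `|dz|` while the operator integrates against `dz`; the unit tangent
is the density between the two, and is later absorbed into the right-hand data. -/
theorem contourIntegral_eq_integral {h : ℂ → ℂ}
    (hh : Integrable (fun u => h u * Ω.tangent u) Ω.arcLength) :
    Ω.contourIntegral h = ∫ u, h u * Ω.tangent u ∂Ω.arcLength := by
  have hi := fun k => hh.mono_measure (Ω.contour_arcLength_le k)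
  rw [arcLength, integral_finsetSum_measure fun k _ => hi k, contourIntegral]
  refine Finset.sum_congr rfl fun k _ => ?_
  rw [(Ω.contour k).integral_arcLength (hi k).1]
  refine setIntegral_congr_fun (Ω.contour k).measurableSet_dom fun s hs => ?_
  rw [mul_left_comm, mul_comm (‖deriv (Ω.contour k).γ s‖ : ℂ), Ω.tangent_mul_norm_deriv k hs]

end ContourUnion

end CubicIIKS

end

noncomputable section

namespace CubicIIKS

/-! ### Square integrable functions and Hilbert-Schmidt operators -/

section HilbertSchmidt

variable {X : Type*} [MeasurableSpace X]

/-- The class in `L²(μ)` of a square integrable function (and `0` for any other function). -/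
def lp (μ : Measure X) (h : X → ℂ) : Lp ℂ 2 μ :=
  open Classical in if hh : MemLp h 2 μ then hh.toLp h else 0

variable {μ : Measure X}

theorem coeFn_lp {h : X → ℂ} (hh : MemLp h 2 μ) : lp μ h =ᵐ[μ] h := by
  rw [lp, dif_pos hh]; exact hh.coeFn_toLp

theorem lp_congr {h h' : X → ℂ} (hh : h =ᵐ[μ] h') : lp μ h = lp μ h' := by
  by_cases h1 : MemLp h 2 μ
  · have h2 := (memLp_congr_ae hh).1 h1
    rw [lp, lp, dif_pos h1, dif_pos h2]
    exact (MemLp.toLp_eq_toLp_iff h1 h2).2 hh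
  · rw [lp, lp, dif_neg h1, dif_neg fun h2 => h1 ((memLp_congr_ae hh).2 h2)]

theorem lp_coe (φ : Lp ℂ 2 μ) : lp μ φ = φ := by
  rw [lp, dif_pos (Lp.memLp φ), Lp.toLp_coeFn]

theorem eq_lp {φ : Lp ℂ 2 μ} {h : X → ℂ} (hh : φ =ᵐ[μ] h) : φ = lp μ h := by
  rw [← lp_congr hh, lp_coe]

theorem eLpNorm_two_sq (f : X → ℂ) : eLpNorm f 2 μ ^ 2 = ∫⁻ x, ‖f x‖ₑ ^ 2 ∂μ := by
  have := eLpNorm_nnreal_pow_eq_lintegral (f := f) (μ := μ) (p := 2) (by norm_num)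
  simpa only [ENNReal.coe_ofNat, NNReal.coe_ofNat, ENNReal.rpow_ofNat] using this

theorem memLp_mul_prod {f g : X → ℂ} (hf : MemLp f 2 μ) (hg : MemLp g 2 μ) :
    MemLp (fun z : X × X => f z.1 * g z.2) 2 (μ.prod μ) := by
  have hm := hf.1.comp_fst.mul hg.1.comp_snd (μ := μ.prod μ)
  refine (memLp_two_iff_integrable_sq_norm hm).2 ?_
  simpa [mul_pow] using! ((memLp_two_iff_integrable_sq_norm hf.1).1 hf).mul_prod
    ((memLp_two_iff_integrable_sq_norm hg.1).1 hg)

variable [SFinite μ]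

theorem integrable_kernel_mul {K : X × X → ℂ} (hK : MemLp K 2 (μ.prod μ)) {φ : X → ℂ}
    (hφ : MemLp φ 2 μ) : ∀ᵐ u ∂μ, Integrable (fun v => K (u, v) * φ v) μ := by
  have h1 : ∫⁻ u, ∫⁻ v, ‖K (u, v)‖ₑ ^ 2 ∂μ ∂μ = eLpNorm K 2 (μ.prod μ) ^ 2 := by
    rw [eLpNorm_two_sq, lintegral_prod]
    exact hK.1.enorm.pow_const 2
  have h2 : ∀ᵐ u ∂μ, ∫⁻ v, ‖K (u, v)‖ₑ ^ 2 ∂μ < ⊤ := by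
    refine ae_lt_top' ?_ (by rw [h1]; exact (ENNReal.pow_lt_top hK.2).ne)
    exact (hK.1.enorm.pow_const 2).lintegral_prod_right'
  filter_upwards [h2, hK.1.prodMk_left] with u hu hm
  have : MemLp (fun v => K (u, v)) 2 μ := by
    refine ⟨hm, ?_⟩
    rw [← eLpNorm_two_sq] at hu
    simpa using hu
  exact this.integrable_mul hφ

/-- Cauchy-Schwarz in `v` for almost every `u`, followed by Tonelli. -/
theorem memLp_kernel_integral {K : X × X → ℂ} (hK : MemLp K 2 (μ.prod μ)) {φ : X → ℂ}
    (hφ : MemLp φ 2 μ) : MemLp (fun u => ∫ v, K (u, v) * φ v ∂μ) 2 μ ∧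
      eLpNorm (fun u => ∫ v, K (u, v) * φ v ∂μ) 2 μ ≤ eLpNorm K 2 (μ.prod μ) * eLpNorm φ 2 μ := by
  have hb : eLpNorm (fun u => ∫ v, K (u, v) * φ v ∂μ) 2 μ ≤
      eLpNorm K 2 (μ.prod μ) * eLpNorm φ 2 μ := by
    rw [← ENNReal.pow_le_pow_left_iff two_ne_zero, mul_pow, eLpNorm_two_sq, eLpNorm_two_sq,
      lintegral_prod _ (hK.1.enorm.pow_const 2), ← lintegral_mul_const'']
    · refine lintegral_mono_ae ?_
      filter_upwards [hK.1.prodMk_left] with u hm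
      rw [← eLpNorm_two_sq, ← mul_pow]
      gcongr
      calc ‖∫ v, K (u, v) * φ v ∂μ‖ₑ ≤ ∫⁻ v, ‖K (u, v) * φ v‖ₑ ∂μ :=
          enorm_integral_le_lintegral_enorm _
        _ = eLpNorm ((fun v => K (u, v)) • φ) 1 μ := by
          rw [eLpNorm_one_eq_lintegral_enorm]; rfl
        _ ≤ _ := eLpNorm_smul_le_mul_eLpNorm hφ.1 hm
    · exact (hK.1.enorm.pow_const 2).lintegral_prod_right'
  refine ⟨⟨?_, hb.trans_lt (ENNReal.mul_lt_top hK.2 hφ.2)⟩, hb⟩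
  exact (hK.1.mul hφ.1.comp_snd).integral_prod_right'

/-- The Hilbert-Schmidt operator with a given kernel, as a function of the kernel. -/
def hsOp (μ : Measure X) [SFinite μ] :
    Lp ℂ 2 (μ.prod μ) →L[ℂ] Lp ℂ 2 μ →L[ℂ] Lp ℂ 2 μ :=
  LinearMap.mkContinuous₂ (LinearMap.mk₂ ℂ
    (fun K φ => (memLp_kernel_integral (Lp.memLp K) (Lp.memLp φ)).1.toLp _)
    (fun K K' φ => by
      rw [← MemLp.toLp_add, MemLp.toLp_eq_toLp_iff]
      filter_upwards [Measure.ae_ae_of_ae_prod (Lp.coeFn_add K K'),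
        integrable_kernel_mul (Lp.memLp K) (Lp.memLp φ),
        integrable_kernel_mul (Lp.memLp K') (Lp.memLp φ)] with u hu h1 h2
      rw [Pi.add_apply, ← integral_add h1 h2]
      refine integral_congr_ae ?_
      filter_upwards [hu] with v hv
      rw [hv, Pi.add_apply, add_mul])
    (fun c K φ => by
      rw [← MemLp.toLp_const_smul, MemLp.toLp_eq_toLp_iff]
      filter_upwards [Measure.ae_ae_of_ae_prod (Lp.coeFn_smul c K)] with u hu
      rw [Pi.smul_apply, ← integral_smul]
      refine integral_congr_ae ?_
      filter_upwards [hu] with v hv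
      rw [hv, Pi.smul_apply, smul_mul_assoc])
    (fun K φ φ' => by
      rw [← MemLp.toLp_add, MemLp.toLp_eq_toLp_iff]
      filter_upwards [integrable_kernel_mul (Lp.memLp K) (Lp.memLp φ),
        integrable_kernel_mul (Lp.memLp K) (Lp.memLp φ')] with u h1 h2
      rw [Pi.add_apply, ← integral_add h1 h2]
      refine integral_congr_ae ?_
      filter_upwards [Lp.coeFn_add φ φ'] with v hv
      rw [hv, Pi.add_apply, mul_add])
    (fun c K φ => by
      rw [← MemLp.toLp_const_smul, MemLp.toLp_eq_toLp_iff]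
      refine Eventually.of_forall fun u => ?_
      rw [Pi.smul_apply, ← integral_smul]
      refine integral_congr_ae ?_
      filter_upwards [Lp.coeFn_smul c φ] with v hv
      rw [hv, Pi.smul_apply, mul_smul_comm])) 1
    (fun K φ => by
      rw [one_mul, LinearMap.mk₂_apply, Lp.norm_toLp, Lp.norm_def, Lp.norm_def,
          ← ENNReal.toReal_mul]
      exact ENNReal.toReal_mono
        (ENNReal.mul_ne_top (Lp.memLp K).2.ne (Lp.memLp φ).2.ne)
        (memLp_kernel_integral (Lp.memLp K) (Lp.memLp φ)).2)

theorem hsOp_apply {K : X × X → ℂ} (hK : MemLp K 2 (μ.prod μ)) (φ : Lp ℂ 2 μ) :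
    hsOp μ (lp (μ.prod μ) K) φ =ᵐ[μ] fun u => ∫ v, K (u, v) * φ v ∂μ := by
  refine (MemLp.coeFn_toLp (memLp_kernel_integral (Lp.memLp _) (Lp.memLp φ)).1).trans ?_
  filter_upwards [Measure.ae_ae_of_ae_prod (coeFn_lp hK)] with u hu
  refine integral_congr_ae ?_
  filter_upwards [hu] with v hv
  rw [hv]

end HilbertSchmidt

/-! ### Exponential families in `L²` -/

section Exponential

theorem exists_pow_le_exp {δ : ℝ} (hδ : 0 < δ) (n : ℕ) :
    ∃ B : ℝ, 0 ≤ B ∧ ∀ r : ℝ, 0 ≤ r → r ^ n ≤ B * Real.exp (δ * r) := by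
  refine ⟨n.factorial / δ ^ n, by positivity, fun r hr => ?_⟩
  have := Real.pow_div_factorial_le_exp (δ * r) (by positivity) n
  rw [mul_pow, div_le_iff₀ (by positivity)] at this
  rw [div_mul_eq_mul_div, le_div_iff₀ (by positivity)]
  linarith

variable {X : Type*} [MeasurableSpace X] {μ : Measure X} {w α : X → ℂ} {ε : ℝ}

/-- A function is square integrable with weight `e^{ε|w|}`. -/
def ExpMemLp (μ : Measure X) (w : X → ℂ) (ε : ℝ) (α : X → ℂ) : Prop :=
  MemLp (fun x => (Real.exp (ε * ‖w x‖) : ℂ) * α x) 2 μ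

theorem ExpMemLp.aestronglyMeasurable (hw : Measurable w) (hα : ExpMemLp μ w ε α) :
    AEStronglyMeasurable α μ := by
  have h1 : AEStronglyMeasurable (fun x => (Real.exp (-(ε * ‖w x‖)) : ℂ)) μ :=
    Measurable.aestronglyMeasurable (by fun_prop)
  refine (h1.mul hα.1).congr (Eventually.of_forall fun x => ?_)
  simp only [Pi.mul_apply]
  rw [← mul_assoc, ← Complex.ofReal_mul, ← Real.exp_add]
  simp

theorem ExpMemLp.of_le {ε' : ℝ} (hw : Measurable w) (hα : ExpMemLp μ w ε α) {B : ℝ} {β : X → ℂ}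
    (hβ : AEStronglyMeasurable β μ)
    (h : ∀ x, ‖β x‖ ≤ B * Real.exp ((ε - ε') * ‖w x‖) * ‖α x‖) : ExpMemLp μ w ε' β := by
  refine MemLp.of_le_mul (c := B) hα (AEStronglyMeasurable.mul (Measurable.aestronglyMeasurable
    (by fun_prop)) hβ) (Eventually.of_forall fun x => ?_)
  simp only [norm_mul, Complex.norm_real, Real.norm_eq_abs, Real.abs_exp]
  calc Real.exp (ε' * ‖w x‖) * ‖β x‖
      ≤ Real.exp (ε' * ‖w x‖) * (B * Real.exp ((ε - ε') * ‖w x‖) * ‖α x‖) := by gcongr; exact h x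
    _ = B * ((Real.exp (ε' * ‖w x‖) * Real.exp ((ε - ε') * ‖w x‖)) * ‖α x‖) := by ring
    _ = _ := by rw [← Real.exp_add]; ring_nf

theorem ExpMemLp.memLp_of_le (hw : Measurable w) (hα : ExpMemLp μ w ε α) {B : ℝ} {β : X → ℂ}
    (hβ : AEStronglyMeasurable β μ)
    (h : ∀ x, ‖β x‖ ≤ B * Real.exp (ε * ‖w x‖) * ‖α x‖) : MemLp β 2 μ := by
  have := hα.of_le (ε' := 0) (B := B) hw hβ (by simpa using h)
  simpa [ExpMemLp] using this

theorem ExpMemLp.memLp (hw : Measurable w) (hε : 0 ≤ ε) (hα : ExpMemLp μ w ε α) : MemLp α 2 μ := by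
  refine hα.memLp_of_le (B := 1) hw (hα.aestronglyMeasurable hw) fun x => ?_
  rw [one_mul]
  exact le_mul_of_one_le_left (norm_nonneg _) (Real.one_le_exp (by positivity))

theorem ExpMemLp.pow_mul {ε' : ℝ} (hw : Measurable w) (hα : ExpMemLp μ w ε α) (h : ε' < ε) (n : ℕ) :
    ExpMemLp μ w ε' (fun x => w x ^ n * α x) := by
  obtain ⟨B, -, hB⟩ := exists_pow_le_exp (sub_pos.2 h) n
  refine hα.of_le (B := B) hw (AEStronglyMeasurable.mul
    (hw.pow_const n).aestronglyMeasurable (hα.aestronglyMeasurable hw)) fun x => ?_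
  rw [norm_mul, norm_pow]
  gcongr
  exact hB _ (norm_nonneg _)

theorem norm_exp_mul_le (s z : ℂ) : ‖Complex.exp (s * z)‖ ≤ Real.exp (‖s‖ * ‖z‖) := by
  rw [← norm_mul]; exact Complex.norm_exp_le_exp_norm _

theorem ExpMemLp.exp_mul (hw : Measurable w) (hα : ExpMemLp μ w ε α) (s : ℂ) :
    ExpMemLp μ w (ε - ‖s‖) (fun x => Complex.exp (s * w x) * α x) := by
  refine hα.of_le (B := 1) hw (AEStronglyMeasurable.mul
    (Measurable.aestronglyMeasurable (by fun_prop)) (hα.aestronglyMeasurable hw)) fun x => ?_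
  rw [norm_mul, one_mul, sub_sub_cancel]
  gcongr
  exact norm_exp_mul_le _ _

/-- The Taylor remainder of `e^{hw}` is at most `|hw|² e^{|hw|}`, and the exponential weight turns
this pointwise bound into an `O(|h|²)` bound in `L²`. -/
theorem hasDerivAt_lp_exp (hw : Measurable w) (hα : ExpMemLp μ w ε α) {s : ℂ} (hs : ‖s‖ < ε) :
    HasDerivAt (fun s => lp μ fun x => Complex.exp (s * w x) * α x)
      (lp μ fun x => w x * (Complex.exp (s * w x) * α x)) s := by
  -- Half the gap: one factor `e^{δ|w|}` pays for `e^{|h||w|}`, a second one for `|w|²`, and `‖s‖ +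
  -- 2δ = ε`.
  set δ := (ε - ‖s‖) / 2 with hδ
  have hδ0 : 0 < δ := by rw [hδ]; linarith
  have hε0 : 0 ≤ ε := (norm_nonneg s).trans hs.le
  obtain ⟨B, hB0, hB⟩ := exists_pow_le_exp hδ0 2
  have hmem : ∀ r : ℂ, ‖r‖ < ε → MemLp (fun x => Complex.exp (r * w x) * α x) 2 μ := fun r hr =>
    (hα.exp_mul hw r).memLp hw (by linarith)
  have hmem' : MemLp (fun x => w x * (Complex.exp (s * w x) * α x)) 2 μ := by
    simpa [ExpMemLp] using (hα.exp_mul hw s).pow_mul hw (ε' := 0) (by linarith) 1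
  rw [hasDerivAt_iff_isLittleO_nhds_zero]
  refine Asymptotics.IsBigO.trans_isLittleO ?_ (Asymptotics.isLittleO_pow_id one_lt_two)
  refine Asymptotics.IsBigO.of_bound (B * ‖lp μ fun x => (Real.exp (ε * ‖w x‖) : ℂ) * α x‖) ?_
  filter_upwards [Metric.ball_mem_nhds (0 : ℂ) hδ0] with h hh
  rw [mem_ball_zero_iff] at hh
  have hsh : ‖s + h‖ < ε := (norm_add_le _ _).trans_lt (by rw [hδ] at hh; linarith)
  rw [norm_pow, mul_assoc, mul_comm ‖_‖ (‖h‖ ^ 2), ← mul_assoc]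
  refine Lp.norm_le_mul_norm_of_ae_le_mul ?_
  filter_upwards [Lp.coeFn_sub ((lp μ fun x => Complex.exp ((s + h) * w x) * α x) -
      lp μ fun x => Complex.exp (s * w x) * α x)
        (h • lp μ fun x => w x * (Complex.exp (s * w x) * α x)),
    Lp.coeFn_sub (lp μ fun x => Complex.exp ((s + h) * w x) * α x)
      (lp μ fun x => Complex.exp (s * w x) * α x),
    Lp.coeFn_smul h (lp μ fun x => w x * (Complex.exp (s * w x) * α x)),
    coeFn_lp (hmem _ hsh), coeFn_lp (hmem _ hs), coeFn_lp hmem', coeFn_lp hα]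
    with x h1 h2 h3 h4 h5 h6 h7
  rw [h1, Pi.sub_apply, h2, Pi.sub_apply, h3, Pi.smul_apply, h4, h5, h6, h7]
  have e1 : Complex.exp ((s + h) * w x) * α x - Complex.exp (s * w x) * α x -
      h • (w x * (Complex.exp (s * w x) * α x)) =
      Complex.exp (s * w x) * (Complex.exp (h * w x) - 1 - h * w x) * α x := by
    rw [add_mul, Complex.exp_add, smul_eq_mul]; ring
  have e2 : ‖Complex.exp (h * w x) - 1 - h * w x‖ ≤ (‖h‖ * ‖w x‖) ^ 2 * Real.exp (‖h‖ * ‖w x‖) := by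
    have := Complex.norm_exp_sub_sum_le_norm_mul_exp (h * w x) 2
    simpa [Finset.sum_range_succ, norm_mul, sub_sub] using this
  rw [e1, norm_mul, norm_mul, norm_mul, Complex.norm_real, Real.norm_eq_abs, Real.abs_exp]
  refine (mul_le_mul_of_nonneg_right (?_ : _ ≤ B * ‖h‖ ^ 2 * Real.exp (ε * ‖w x‖))
    (norm_nonneg _)).trans_eq (by ring)
  calc _ ≤ Real.exp (‖s‖ * ‖w x‖) * ((‖h‖ * ‖w x‖) ^ 2 * Real.exp (δ * ‖w x‖)) := by
        gcongr
        · exact norm_exp_mul_le _ _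
        · refine e2.trans ?_
          gcongr
    _ = ‖h‖ ^ 2 * ‖w x‖ ^ 2 * (Real.exp (‖s‖ * ‖w x‖) * Real.exp (δ * ‖w x‖)) := by ring
    _ ≤ ‖h‖ ^ 2 * (B * Real.exp (δ * ‖w x‖)) *
          (Real.exp (‖s‖ * ‖w x‖) * Real.exp (δ * ‖w x‖)) := by
        gcongr
        exact hB _ (norm_nonneg _)
    _ = B * ‖h‖ ^ 2 * (Real.exp (δ * ‖w x‖) * Real.exp (‖s‖ * ‖w x‖) *
          Real.exp (δ * ‖w x‖)) := by ring
    _ = B * ‖h‖ ^ 2 * Real.exp (ε * ‖w x‖) := by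
        rw [← Real.exp_add, ← Real.exp_add]
        congr 2
        rw [hδ]; ring

end Exponential

end CubicIIKS

end

noncomputable section

namespace CubicIIKS

/-! ### Integrable operators with exponentially decaying data -/

section Cauchy

variable {ι : Type*}

/-- The supports of `a k` and `b k` do not approach each other exponentially fast. -/
def Separated (a b : ι → ℂ → ℂ) : Prop :=
  ∀ η : ℝ, 0 < η → ∃ κ : ℝ, 0 < κ ∧ ∀ k u v, a k u ≠ 0 → b k v ≠ 0 →
    κ * Real.exp (-η * ‖u‖) ≤ ‖u - v‖ ∧ κ * Real.exp (-η * ‖v‖) ≤ ‖u - v‖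

theorem Separated.mono {a b f g : ι → ℂ → ℂ} (h : Separated f g)
    (ha : ∀ k u, a k u ≠ 0 → f k u ≠ 0) (hb : ∀ k u, b k u ≠ 0 → g k u ≠ 0) : Separated a b := by
  intro η hη
  obtain ⟨κ, hκ, H⟩ := h η hη
  exact ⟨κ, hκ, fun k u v h1 h2 => H k u v (ha k u h1) (hb k v h2)⟩

theorem Separated.mul_eq_zero {a b : ι → ℂ → ℂ} (h : Separated a b) (k : ι) (u : ℂ) :
    a k u * b k u = 0 := by
  by_contra hne
  obtain ⟨κ, hκ, H⟩ := h 1 one_pos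
  have := (H k u u (left_ne_zero_of_mul hne) (right_ne_zero_of_mul hne)).1
  rw [sub_self, norm_zero] at this
  exact absurd this (not_le.2 (by positivity))

/-- The Cauchy integral of `b φ` with respect to `μ`. -/
def cauchy (μ : Measure ℂ) (b : ℂ → ℂ) (φ : ℂ → ℂ) (u : ℂ) : ℂ := ∫ v, b v * φ v / (u - v) ∂μ

variable {μ : Measure ℂ}

theorem cauchy_congr {b b' φ φ' : ℂ → ℂ} (h : ∀ᵐ v ∂μ, b v * φ v = b' v * φ' v) (u : ℂ) :
    cauchy μ b φ u = cauchy μ b' φ' u := by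
  refine integral_congr_ae ?_
  filter_upwards [h] with v hv
  rw [hv]

theorem aestronglyMeasurable_cauchy [SFinite μ] {b φ : ℂ → ℂ} (hb : AEStronglyMeasurable b μ)
    (hφ : AEStronglyMeasurable φ μ) : AEStronglyMeasurable (cauchy μ b φ) μ := by
  have h1 : AEStronglyMeasurable (fun z : ℂ × ℂ => z.1 - z.2) (μ.prod μ) :=
    Measurable.aestronglyMeasurable (by fun_prop)
  exact ((hb.comp_snd.mul hφ.comp_snd).div₀ h1).integral_prod_right'

theorem norm_inv_pow_le {κ η r : ℝ} (hκ : 0 < κ) {z : ℂ} (h : κ * Real.exp (-η * r) ≤ ‖z‖) (p : ℕ) :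
    ‖(z ^ p)⁻¹‖ ≤ (κ ^ p)⁻¹ * Real.exp (p * η * r) := by
  rw [norm_inv, norm_pow, show p * η * r = -(p * (-η * r)) by ring, Real.exp_neg, Real.exp_nat_mul,
    ← mul_inv, ← mul_pow]
  gcongr

theorem ExpMemLp.integrable_exp_mul {ε : ℝ} {b φ : ℂ → ℂ} (hb : ExpMemLp μ id ε b)
    (hφ : MemLp φ 2 μ) : Integrable (fun v => Real.exp (ε * ‖v‖) * ‖b v * φ v‖) μ := by
  refine (MemLp.integrable_mul hb hφ).norm.congr (Eventually.of_forall fun v => ?_)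
  simp only [Pi.mul_apply, norm_mul, Complex.norm_real, Real.norm_eq_abs, Real.abs_exp, id,
    mul_assoc]

/-- Cauchy integrals are bounded on the opposite support if the data decay exponentially. -/
theorem Separated.exists_bound_of_exp {a b : ι → ℂ → ℂ} (h : Separated a b) {ε : ℝ} (hε : 0 < ε)
    (hb : ∀ k, ExpMemLp μ id ε (b k)) [Finite ι] {φ : ℂ → ℂ} (hφ : MemLp φ 2 μ) (p : ℕ) :
    ∃ B : ℝ, ∀ k u, a k u ≠ 0 → Integrable (fun v => b k v * φ v / (u - v) ^ p) μ ∧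
      ‖∫ v, b k v * φ v / (u - v) ^ p ∂μ‖ ≤ B := by
  -- The `p`-th power of the separation bound costs `e^{pη|v|}`, so `pη ≤ ε` is needed; `p + 1` also
  -- admits `p = 0`.
  obtain ⟨κ, hκ, H⟩ := h (ε / (p + 1)) (by positivity)
  have := Fintype.ofFinite ι
  have hle : ∀ k u, a k u ≠ 0 → ∀ v, ‖b k v * φ v / (u - v) ^ p‖ ≤
      (κ ^ p)⁻¹ * (Real.exp (ε * ‖v‖) * ‖b k v * φ v‖) := by
    intro k u hu v
    by_cases hv : b k v = 0
    · simp [hv]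
    · have h1 := norm_inv_pow_le hκ (H k u v hu hv).2 p
      rw [div_eq_mul_inv, norm_mul, mul_comm, ← mul_assoc]
      gcongr
      refine h1.trans ?_
      gcongr
      rw [mul_div_assoc', div_le_iff₀ (by positivity)]
      nlinarith
  refine ⟨∑ k, (κ ^ p)⁻¹ * ∫ v, Real.exp (ε * ‖v‖) * ‖b k v * φ v‖ ∂μ, fun k u hu => ?_⟩
  have hi := ((hb k).integrable_exp_mul hφ).const_mul (κ ^ p)⁻¹
  have hm : AEStronglyMeasurable (fun v => b k v * φ v / (u - v) ^ p) μ :=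
    ((hb k).aestronglyMeasurable measurable_id |>.mul hφ.1).div₀
      (Measurable.aestronglyMeasurable (by fun_prop))
  have hI := hi.mono' hm (Eventually.of_forall (hle k u hu))
  refine ⟨hI, ?_⟩
  calc _ ≤ ∫ v, (κ ^ p)⁻¹ * (Real.exp (ε * ‖v‖) * ‖b k v * φ v‖) ∂μ :=
        norm_integral_le_of_norm_le hi (Eventually.of_forall (hle k u hu))
    _ = (κ ^ p)⁻¹ * ∫ v, Real.exp (ε * ‖v‖) * ‖b k v * φ v‖ ∂μ := integral_const_mul _ _
    _ ≤ _ := Finset.single_le_sum (f := fun k => (κ ^ p)⁻¹ *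
        ∫ v, Real.exp (ε * ‖v‖) * ‖b k v * φ v‖ ∂μ) (fun k _ => by positivity) (Finset.mem_univ k)

/-- Cauchy integrals do not grow exponentially on the opposite support. -/
theorem Separated.exists_bound {a g : ι → ℂ → ℂ} (h : Separated a g)
    (hg : ∀ k, MemLp (g k) 2 μ) [Finite ι] {φ : ℂ → ℂ} (hφ : MemLp φ 2 μ) {η : ℝ} (hη : 0 < η) :
    ∃ B : ℝ, ∀ k u, a k u ≠ 0 → Integrable (fun v => g k v * φ v / (u - v)) μ ∧
      ‖cauchy μ (g k) φ u‖ ≤ B * Real.exp (η * ‖u‖) := by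
  obtain ⟨κ, hκ, H⟩ := h η hη
  have := Fintype.ofFinite ι
  have hle : ∀ k u, a k u ≠ 0 → ∀ v, ‖g k v * φ v / (u - v)‖ ≤
      κ⁻¹ * Real.exp (η * ‖u‖) * ‖g k v * φ v‖ := by
    intro k u hu v
    by_cases hv : g k v = 0
    · simp [hv]
    · have h1 := norm_inv_pow_le hκ (H k u v hu hv).1 1
      rw [div_eq_mul_inv, norm_mul, mul_comm]
      gcongr
      simpa using h1
  refine ⟨∑ k, κ⁻¹ * ∫ v, ‖g k v * φ v‖ ∂μ, fun k u hu => ?_⟩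
  have hi := ((hg k).integrable_mul hφ).norm.const_mul (κ⁻¹ * Real.exp (η * ‖u‖))
  have hm : AEStronglyMeasurable (fun v => g k v * φ v / (u - v)) μ :=
    ((hg k).1.mul hφ.1).div₀ (Measurable.aestronglyMeasurable (by fun_prop))
  have hI := hi.mono' hm (Eventually.of_forall (hle k u hu))
  refine ⟨hI, ?_⟩
  calc _ ≤ ∫ v, κ⁻¹ * Real.exp (η * ‖u‖) * ‖g k v * φ v‖ ∂μ :=
        norm_integral_le_of_norm_le hi (Eventually.of_forall (hle k u hu))
    _ = κ⁻¹ * (∫ v, ‖g k v * φ v‖ ∂μ) * Real.exp (η * ‖u‖) := by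
        rw [integral_const_mul]; ring
    _ ≤ _ := by
        gcongr
        exact Finset.single_le_sum (f := fun k => κ⁻¹ * ∫ v, ‖g k v * φ v‖ ∂μ)
          (fun k _ => by positivity) (Finset.mem_univ k)

end Cauchy

section Good

variable {ι : Type*}

/-- Data `a`, `b` of an integrable operator that decay exponentially. -/
structure Good (μ : Measure ℂ) (ε : ℝ) (a b : ι → ℂ → ℂ) : Prop where
  pos : 0 < ε
  left : ∀ i, ExpMemLp μ id ε (a i)
  right : ∀ i, ExpMemLp μ id ε (b i)
  separated : Separated a b

variable {μ : Measure ℂ} {ε : ℝ} {a b : ι → ℂ → ℂ}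

theorem Good.memLp_left (h : Good μ ε a b) (n : ℕ) (i : ι) :
    MemLp (fun u => u ^ n * a i u) 2 μ := by
  simpa [ExpMemLp] using (h.left i).pow_mul measurable_id h.pos n

theorem Good.memLp_right (h : Good μ ε a b) (n : ℕ) (i : ι) :
    MemLp (fun u => u ^ n * b i u) 2 μ := by
  simpa [ExpMemLp] using (h.right i).pow_mul measurable_id h.pos n

theorem Good.memLp_left' (h : Good μ ε a b) (i : ι) : MemLp (a i) 2 μ := by
  simpa using h.memLp_left 0 i

theorem Good.memLp_right' (h : Good μ ε a b) (i : ι) : MemLp (b i) 2 μ := by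
  simpa using h.memLp_right 0 i

/-- The `k`-th summand of the kernel of an integrable operator. -/
def kern (a b : ι → ℂ → ℂ) (k : ι) (z : ℂ × ℂ) : ℂ := a k z.1 * b k z.2 / (z.1 - z.2)

/-- The weight is in `u - v` because a shift of `x_k` multiplies the kernel by an exponential of `u
- v`. Half of the decay rate of `b` pays for the denominator and the rest pays for the weight. -/
theorem Good.exp_kern (h : Good μ ε a b) (k : ι) :
    ExpMemLp (μ.prod μ) (fun z => z.1 - z.2) (ε / 2) (kern a b k) := by
  have h2 : (0 : ℝ) < ε / 2 := half_pos h.pos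
  obtain ⟨κ, hκ, H⟩ := h.separated (ε / 2) h2
  have hm : AEStronglyMeasurable (kern a b k) (μ.prod μ) :=
    ((h.memLp_left' k).1.comp_fst.mul (h.memLp_right' k).1.comp_snd).div₀
      (Measurable.aestronglyMeasurable (by fun_prop))
  refine MemLp.of_le_mul (c := κ⁻¹) (memLp_mul_prod (h.left k) (h.right k))
    (AEStronglyMeasurable.mul (Measurable.aestronglyMeasurable (by fun_prop)) hm)
    (Eventually.of_forall fun z => ?_)
  simp only [norm_mul, Complex.norm_real, Real.norm_eq_abs, Real.abs_exp, kern, id]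
  by_cases h0 : a k z.1 = 0 ∨ b k z.2 = 0
  · rcases h0 with h0 | h0 <;> simp [h0]
  push Not at h0
  have h1 := norm_inv_pow_le hκ (H k z.1 z.2 h0.1 h0.2).2 1
  rw [div_eq_mul_inv (a k z.1 * b k z.2), norm_mul, norm_mul]
  rw [pow_one, pow_one, Nat.cast_one, one_mul] at h1
  have h3 : Real.exp (ε / 2 * ‖z.1 - z.2‖) ≤ Real.exp (ε * ‖z.1‖) * Real.exp (ε / 2 * ‖z.2‖) := by
    rw [← Real.exp_add]
    gcongr
    nlinarith [norm_sub_le z.1 z.2, norm_nonneg z.1]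
  have h4 : Real.exp (ε * ‖z.2‖) = Real.exp (ε / 2 * ‖z.2‖) * Real.exp (ε / 2 * ‖z.2‖) := by
    rw [← Real.exp_add]; ring_nf
  rw [h4]
  calc _ ≤ Real.exp (ε * ‖z.1‖) * Real.exp (ε / 2 * ‖z.2‖) *
        (‖a k z.1‖ * ‖b k z.2‖ * (κ⁻¹ * Real.exp (ε / 2 * ‖z.2‖))) := by gcongr
    _ = _ := by ring

theorem Good.memLp_kern (h : Good μ ε a b) (k : ι) : MemLp (kern a b k) 2 (μ.prod μ) :=
  (h.exp_kern k).memLp (by fun_prop) (half_pos h.pos).le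

variable [Fintype ι]

/-- The integrable operator with data `a`, `b`. -/
def intOp (μ : Measure ℂ) [SFinite μ] (a b : ι → ℂ → ℂ) : Lp ℂ 2 μ →L[ℂ] Lp ℂ 2 μ :=
  ∑ k, hsOp μ (lp (μ.prod μ) (kern a b k))

theorem Good.cauchy_bound (h : Good μ ε a b) {φ : ℂ → ℂ} (hφ : MemLp φ 2 μ) :
    ∃ B : ℝ, ∀ k u, a k u ≠ 0 → Integrable (fun v => b k v * φ v / (u - v)) μ ∧
      ‖cauchy μ (b k) φ u‖ ≤ B := by
  simpa using! h.separated.exists_bound_of_exp h.pos h.right hφ 1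

variable [SFinite μ]

theorem Good.intOp_apply (h : Good μ ε a b) (φ : Lp ℂ 2 μ) :
    intOp μ a b φ =ᵐ[μ] fun u => ∑ k, a k u * cauchy μ (b k) φ u := by
  have h1 : ∀ k, hsOp μ (lp (μ.prod μ) (kern a b k)) φ =ᵐ[μ]
      fun u => a k u * cauchy μ (b k) φ u := by
    intro k
    refine (hsOp_apply (h.memLp_kern k) φ).trans (Eventually.of_forall fun u => ?_)
    simp only [cauchy, kern]
    rw [← integral_const_mul]
    congr 1; ext v; ring
  rw [intOp, sum_apply]
  refine (Lp.coeFn_finsetSum _ _).trans ?_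
  filter_upwards [eventually_all.2 h1] with u hu
  simp only [Finset.sum_apply, hu]

/-- Multiplication by a Cauchy integral preserves exponential decay. -/
theorem memLp_mul_cauchy {f g : ι → ℂ → ℂ} (hs : Separated f g) (hf : ∀ k, ExpMemLp μ id ε (f k))
    (hε : 0 < ε) (hg : ∀ k, MemLp (g k) 2 μ) {φ : ℂ → ℂ} (hφ : MemLp φ 2 μ) (k : ι) :
    MemLp (fun u => f k u * cauchy μ (g k) φ u) 2 μ := by
  obtain ⟨B, hB⟩ := hs.exists_bound hg hφ hε
  refine (hf k).memLp_of_le (B := B) measurable_id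
    (((hf k).aestronglyMeasurable measurable_id).mul
      (aestronglyMeasurable_cauchy (hg k).1 hφ.1)) fun u => ?_
  by_cases hu : f k u = 0
  · simp [hu]
  · rw [norm_mul, mul_comm]
    gcongr
    exact (hB k u hu).2

/-- The counterpart of `memLp_mul_cauchy` with the decay on the other side: here `b` decays, so the
Cauchy integral is bounded on the support of `f`, which need only be square integrable. -/
theorem Good.memLp_mul_cauchy' (h : Good μ ε a b) {f : ι → ℂ → ℂ} (hs : Separated f b)
    {k : ι} (hf : MemLp (f k) 2 μ) {φ : ℂ → ℂ} (hφ : MemLp φ 2 μ) :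
    MemLp (fun u => f k u * cauchy μ (b k) φ u) 2 μ := by
  obtain ⟨B, hB⟩ := hs.exists_bound_of_exp h.pos h.right hφ 1
  refine MemLp.of_le_mul (c := B) hf (hf.1.mul
      (aestronglyMeasurable_cauchy (h.memLp_right' k).1 hφ.1)) (Eventually.of_forall fun u => ?_)
  by_cases hu : f k u = 0
  · simp [hu]
  · rw [norm_mul, mul_comm]
    gcongr
    simpa using! (hB k u hu).2

end Good

end CubicIIKS

end

noncomputable section

namespace CubicIIKS

/-! ### Resolvent, moments, and conjugation by scalar functions -/

section Resolvent

variable {ι : Type*} [Fintype ι] {μ : Measure ℂ} [SFinite μ] {ε : ℝ} {a b : ι → ℂ → ℂ}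

/-- The bilinear pairing `∫ φ ψ dμ` on `L²(μ)`. -/
def pairing (μ : Measure ℂ) : Lp ℂ 2 μ →L[ℂ] Lp ℂ 2 μ →L[ℂ] ℂ :=
  (ContinuousLinearMap.mul ℂ ℂ).lpPairing μ 2 2

omit [SFinite μ] in
theorem pairing_apply (φ ψ : Lp ℂ 2 μ) : pairing μ φ ψ = ∫ u, φ u * ψ u ∂μ := by
  rw [pairing, ContinuousLinearMap.lpPairing_eq_integral]
  rfl

omit [SFinite μ] in
theorem pairing_lp (φ : Lp ℂ 2 μ) {ψ : ℂ → ℂ} (hψ : MemLp ψ 2 μ) :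
    pairing μ φ (lp μ ψ) = ∫ u, φ u * ψ u ∂μ := by
  rw [pairing_apply]
  refine integral_congr_ae ?_
  filter_upwards [coeFn_lp hψ] with u hu
  rw [hu]

/-- The resolvent `(I - H)⁻¹`. -/
def resolvent (μ : Measure ℂ) [SFinite μ] (a b : ι → ℂ → ℂ) : Lp ℂ 2 μ →L[ℂ] Lp ℂ 2 μ :=
  Ring.inverse (1 - intOp μ a b)

/-- The moments `∫ ((I - H)⁻¹ aᵢ)(u) uⁿ bⱼ(u) dμ(u)`. -/
def moment (μ : Measure ℂ) [SFinite μ] (a b : ι → ℂ → ℂ) (n : ℕ) : Matrix ι ι ℂ :=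
  Matrix.of fun i j => pairing μ (resolvent μ a b (lp μ (a i))) (lp μ fun u => u ^ n * b j u)

theorem sub_intOp_resolvent (hu : IsUnit (1 - intOp μ a b)) (ψ : Lp ℂ 2 μ) :
    resolvent μ a b ψ - intOp μ a b (resolvent μ a b ψ) = ψ :=
  DFunLike.congr_fun (Ring.mul_inverse_cancel _ hu) ψ

theorem eq_resolvent (hu : IsUnit (1 - intOp μ a b)) {φ ψ : Lp ℂ 2 μ}
    (h : φ - intOp μ a b φ = ψ) : φ = resolvent μ a b ψ := by
  rw [← h]
  exact (DFunLike.congr_fun (Ring.inverse_mul_cancel _ hu) φ).symm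

theorem Good.eq_of_sub_intOp (h : Good μ ε a b) {φ : Lp ℂ 2 μ} {ψ : ℂ → ℂ} (hψ : MemLp ψ 2 μ)
    (heq : φ - intOp μ a b φ = lp μ ψ) :
    φ =ᵐ[μ] fun u => ψ u + ∑ k, a k u * cauchy μ (b k) φ u := by
  rw [sub_eq_iff_eq_add] at heq
  have h1 := Lp.coeFn_add (lp μ ψ) (intOp μ a b φ)
  rw [← heq] at h1
  filter_upwards [h1, coeFn_lp hψ, h.intOp_apply φ] with u h1 h2 h3
  rw [h1, Pi.add_apply, h2, h3]

/-- Conversely, a solution of the integral equation. -/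
theorem Good.sub_intOp_eq (h : Good μ ε a b) {φ ψ : ℂ → ℂ} (hφ : MemLp φ 2 μ) (hψ : MemLp ψ 2 μ)
    (heq : ∀ᵐ u ∂μ, φ u = ψ u + ∑ k, a k u * cauchy μ (b k) φ u) :
    lp μ φ - intOp μ a b (lp μ φ) = lp μ ψ := by
  refine Lp.ext ?_
  have hc : ∀ k u, cauchy μ (b k) (lp μ φ) u = cauchy μ (b k) φ u := fun k u =>
    cauchy_congr (by filter_upwards [coeFn_lp hφ] with v hv; rw [hv]) u
  filter_upwards [Lp.coeFn_sub (lp μ φ) (intOp μ a b (lp μ φ)), coeFn_lp hφ, coeFn_lp hψ,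
    h.intOp_apply (lp μ φ), heq] with u h1 h2 h3 h4 h5
  simp only [hc] at h4
  rw [h1, Pi.sub_apply, h2, h3, h4, h5, add_sub_cancel_right]

/-- Conjugation of an integrable operator by a scalar function, which may be unbounded, does not
change its invertibility nor its moments. -/
theorem Good.isUnit_and_moment_eq (h : Good μ ε a b) {f g : ι → ℂ → ℂ}
    (hf : ∀ k, MemLp (f k) 2 μ) (hg : ∀ k, MemLp (g k) 2 μ) (hs : Separated f g)
    (ha : ∀ k u, a k u ≠ 0 → f k u ≠ 0) (hb : ∀ k u, b k u ≠ 0 → g k u ≠ 0)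
    (hfg : ∀ j k u, f j u * g k u = a j u * b k u) {T : Lp ℂ 2 μ →L[ℂ] Lp ℂ 2 μ}
    (hT : ∀ φ, T φ =ᵐ[μ] fun u => ∑ k, f k u * cauchy μ (g k) φ u) (hu : IsUnit (1 - T)) :
    IsUnit (1 - intOp μ a b) ∧ ∀ i j, moment μ a b 0 i j =
      ∫ u, Ring.inverse (1 - T) (lp μ (f i)) u * g j u ∂μ := by
  have hinj : ∀ φ, φ - T φ = 0 → φ = 0 := fun φ hφ =>
    (ContinuousLinearMap.isUnit_iff_bijective.1 hu).1 (by simpa using hφ)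
  have hfb := hs.mono (fun _ _ h => h) hb
  have hag := hs.mono ha (fun _ _ h => h)
  have hmf : ∀ {φ : ℂ → ℂ}, MemLp φ 2 μ → MemLp (fun u => ∑ k, f k u * cauchy μ (b k) φ u) 2 μ :=
    fun hφ => memLp_finsetSum _ fun k _ => h.memLp_mul_cauchy' hfb (hf k) hφ
  -- transport of a function of the form `∑ aₖ wₖ`
  have hgb : ∀ (w : ι → ℂ → ℂ) (k : ι) (u : ℂ),
      g k u * ∑ j, f j u * w j u = b k u * ∑ j, a j u * w j u := by
    intro w k u
    rw [Finset.mul_sum, Finset.mul_sum]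
    refine Finset.sum_congr rfl fun j _ => ?_
    have := hfg j k u
    linear_combination w j u * this
  -- Multiplication by the conjugating scalar need not be defined on `L²`. Instead, functions of the
  -- form `∑ a_k w_k` are sent to `∑ f_k w_k` and back, and `hgb` shows that the Cauchy integrals
  -- agree.
  have hunit : IsUnit (1 - intOp μ a b) := by
    rw [ContinuousLinearMap.isUnit_iff_bijective]
    constructor
    · refine (injective_iff_map_eq_zero _).2 fun φ hφ => ?_
      have hφ' : φ - intOp μ a b φ = lp μ (fun _ => 0) := by
        have h0 : lp μ (fun _ => (0 : ℂ)) = 0 := (eq_lp (Lp.coeFn_zero ℂ 2 μ)).symm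
        rw [h0]
        exact hφ
      have hφe := h.eq_of_sub_intOp MemLp.zero' hφ'
      simp only [zero_add] at hφe
      -- A null vector `φ` transports to a fixed point `c` of `T`, so `c = 0`; then `b_k φ = g_k c =
      -- 0`, and the equation for `φ` gives `φ = 0`.
      set c : ℂ → ℂ := fun u => ∑ k, f k u * cauchy μ (b k) φ u with hc
      have hcm : MemLp c 2 μ := hmf (Lp.memLp φ)
      have hgc : ∀ k, ∀ᵐ u ∂μ, g k u * lp μ c u = b k u * φ u := by
        intro k
        filter_upwards [coeFn_lp hcm, hφe] with u h1 h2
        rw [h1, h2]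
        exact hgb _ k u
      have h0 : lp μ c = 0 := by
        refine hinj _ (Lp.ext ?_)
        filter_upwards [Lp.coeFn_sub (lp μ c) (T (lp μ c)), hT (lp μ c), coeFn_lp hcm,
          Lp.coeFn_zero ℂ 2 μ] with u h1 h2 h3 h4
        rw [h1, Pi.sub_apply, h2, h3, h4, Pi.zero_apply, sub_eq_zero]
        exact Finset.sum_congr rfl fun k _ => by rw [cauchy_congr (hgc k)]
      refine Lp.ext ?_
      have hz : ∀ k u, cauchy μ (b k) φ u = 0 := by
        intro k u
        have : ∀ᵐ v ∂μ, b k v * φ v = 0 := by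
          filter_upwards [hgc k, Lp.coeFn_zero ℂ 2 μ] with v hv h0'
          rw [← hv, h0, h0', Pi.zero_apply, mul_zero]
        rw [cauchy, integral_eq_zero_of_ae]
        filter_upwards [this] with v hv
        rw [hv, zero_div, Pi.zero_apply]
      filter_upwards [hφe, Lp.coeFn_zero ℂ 2 μ] with u h1 h2
      rw [h1, h2]
      simp [hz]
    · intro ψ
      have hm1 := hmf (Lp.memLp ψ)
      -- A general `ψ` cannot be transported, but its image under `intOp` can. With `η` the solution
      -- on the `T` side and `χ` its transport back, `χ - intOp χ = intOp ψ`, so `ψ + χ` is a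
      -- preimage of `ψ`.
      obtain ⟨η, hη⟩ := (ContinuousLinearMap.isUnit_iff_bijective.1 hu).2
        (lp μ fun u => ∑ k, f k u * cauchy μ (b k) ψ u)
      have hη' : η =ᵐ[μ] fun u => ∑ k, f k u * (cauchy μ (b k) ψ u + cauchy μ (g k) η u) := by
        have h1 : η = (lp μ fun u => ∑ k, f k u * cauchy μ (b k) ψ u) + T η := by
          rw [← hη]; simp
        have h2 := Lp.coeFn_add (lp μ fun u => ∑ k, f k u * cauchy μ (b k) ψ u) (T η)
        rw [← h1] at h2
        filter_upwards [h2, coeFn_lp hm1, hT η] with u h2 h3 h4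
        rw [h2, Pi.add_apply, h3, h4]
        simp only [mul_add, Finset.sum_add_distrib]
      set χ : ℂ → ℂ := fun u => ∑ k, a k u * (cauchy μ (b k) ψ u + cauchy μ (g k) η u) with hχ
      have hχm : MemLp χ 2 μ := by
        refine memLp_finsetSum _ fun k _ => ?_
        simp only [mul_add]
        exact (h.memLp_mul_cauchy' h.separated (h.memLp_left' k) (Lp.memLp ψ)).add
          (memLp_mul_cauchy hag h.left h.pos hg (Lp.memLp η) k)
      have hgχ : ∀ k, ∀ᵐ u ∂μ, b k u * χ u = g k u * η u := by
        intro k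
        filter_upwards [hη'] with u h2
        rw [h2]
        exact (hgb (fun k u => cauchy μ (b k) ψ u + cauchy μ (g k) η u) k u).symm
      refine ⟨ψ + lp μ χ, ?_⟩
      have h3 : lp μ χ - intOp μ a b (lp μ χ) = intOp μ a b ψ := by
        have hK : MemLp (fun u => ∑ k, a k u * cauchy μ (b k) ψ u) 2 μ :=
          memLp_finsetSum _ fun k _ =>
            h.memLp_mul_cauchy' h.separated (h.memLp_left' k) (Lp.memLp ψ)
        rw [h.sub_intOp_eq hχm hK, ← eq_lp (h.intOp_apply ψ)]
        refine Eventually.of_forall fun u => ?_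
        rw [← Finset.sum_add_distrib]
        refine Finset.sum_congr rfl fun k _ => ?_
        rw [cauchy_congr (hgχ k), mul_add]
      change ψ + lp μ χ - intOp μ a b (ψ + lp μ χ) = ψ
      rw [map_add, ← h3]
      abel
  refine ⟨hunit, fun i j => ?_⟩
  set φ := resolvent μ a b (lp μ (a i)) with hφ
  have hφe := h.eq_of_sub_intOp (h.memLp_left' i) (sub_intOp_resolvent hunit (lp μ (a i)))
  rw [← hφ] at hφe
  classical
  set w : ι → ℂ → ℂ := fun k u => (if k = i then 1 else 0) + cauchy μ (b k) φ u with hw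
  have hφw : φ =ᵐ[μ] fun u => ∑ k, a k u * w k u := by
    filter_upwards [hφe] with u h1
    rw [h1]
    simp [hw, mul_add, Finset.sum_add_distrib]
  -- The transport of `φ` solves `(1 - T) c = f_i`, and `g_j c = b_j φ` identifies the two moments.
  set c : ℂ → ℂ := fun u => ∑ k, f k u * w k u with hc
  have hce : ∀ u, c u = f i u + ∑ k, f k u * cauchy μ (b k) φ u := by
    intro u
    simp [hc, hw, mul_add, Finset.sum_add_distrib]
  have hcm : MemLp c 2 μ := by
    rw [funext hce]
    exact (hf i).add (hmf (Lp.memLp φ))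
  have hgc : ∀ k, ∀ᵐ u ∂μ, g k u * lp μ c u = b k u * φ u := by
    intro k
    filter_upwards [coeFn_lp hcm, hφw] with u h1 h2
    rw [h1, h2]
    exact hgb _ k u
  have h1 : (1 - T) (lp μ c) = lp μ (f i) := by
    refine Lp.ext ?_
    filter_upwards [Lp.coeFn_sub (lp μ c) (T (lp μ c)), hT (lp μ c), coeFn_lp hcm,
      coeFn_lp (hf i)] with u h1 h2 h3 h4
    refine h1.trans ?_
    rw [Pi.sub_apply, h2, h3, h4, hce, sub_eq_iff_eq_add]
    congr 1
    exact Finset.sum_congr rfl fun k _ => by rw [cauchy_congr (hgc k)]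
  have h2 : Ring.inverse (1 - T) (lp μ (f i)) = lp μ c := by
    rw [← h1]
    exact DFunLike.congr_fun (Ring.inverse_mul_cancel _ hu) (lp μ c)
  rw [h2, moment, Matrix.of_apply, pairing_lp _ (h.memLp_right 0 j)]
  refine integral_congr_ae ?_
  filter_upwards [hgc j] with u hu
  rw [mul_comm (lp μ c u), hu, pow_zero, one_mul, mul_comm]

/-- The commutation relation of an integrable operator with the multiplication by the variable. -/
theorem Good.id_mul (h : Good μ ε a b) {φ : Lp ℂ 2 μ} {ψ : ℂ → ℂ} (hψ : MemLp ψ 2 μ)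
    (hψ' : MemLp (fun u => u * ψ u) 2 μ) (heq : φ - intOp μ a b φ = lp μ ψ) :
    MemLp (fun u => u * φ u) 2 μ ∧ (lp μ fun u => u * φ u) - intOp μ a b (lp μ fun u => u * φ u) =
      (lp μ fun u => u * ψ u) + ∑ k, pairing μ φ (lp μ (b k)) • lp μ (a k) := by
  have hφ := h.eq_of_sub_intOp hψ heq
  obtain ⟨B, hB⟩ := h.cauchy_bound (Lp.memLp φ)
  have hmk : ∀ k, MemLp (fun u => u * (a k u * cauchy μ (b k) φ u)) 2 μ := by
    intro k
    refine MemLp.of_le_mul (c := B) (h.memLp_left 1 k) (measurable_id.aestronglyMeasurable.mul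
      ((h.memLp_left' k).1.mul (aestronglyMeasurable_cauchy (h.memLp_right' k).1 (Lp.memLp φ).1)))
      (Eventually.of_forall fun u => ?_)
    by_cases hu : a k u = 0
    · simp [hu]
    · rw [pow_one, ← mul_assoc, norm_mul, mul_comm]
      gcongr
      exact (hB k u hu).2
  have hm : MemLp (fun u => u * φ u) 2 μ := by
    refine (memLp_congr_ae ?_).1 (hψ'.add (memLp_finsetSum Finset.univ fun k _ => hmk k))
    filter_upwards [hφ] with u hu
    rw [hu, Pi.add_apply, mul_add, Finset.mul_sum]
  refine ⟨hm, ?_⟩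
  have hm2 : MemLp (fun u => ∑ k, pairing μ φ (lp μ (b k)) * a k u) 2 μ :=
    memLp_finsetSum _ fun k _ => (h.memLp_left' k).const_mul _
  have h2 : (∑ k, pairing μ φ (lp μ (b k)) • lp μ (a k)) =
      lp μ fun u => ∑ k, pairing μ φ (lp μ (b k)) * a k u := by
    refine eq_lp ((Lp.coeFn_finsetSum _ _).trans ?_)
    filter_upwards [eventually_all.2 fun k => Lp.coeFn_smul (pairing μ φ (lp μ (b k))) (lp μ (a k)),
      eventually_all.2 fun k => coeFn_lp (h.memLp_left' k)] with u h1 h2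
    rw [Finset.sum_apply]
    refine Finset.sum_congr rfl fun k _ => ?_
    rw [h1, Pi.smul_apply, h2, smul_eq_mul]
  have h3 : (lp μ fun u => u * ψ u) + (lp μ fun u => ∑ k, pairing μ φ (lp μ (b k)) * a k u) =
      lp μ fun u => u * ψ u + ∑ k, pairing μ φ (lp μ (b k)) * a k u := by
    refine eq_lp ((Lp.coeFn_add _ _).trans ?_)
    filter_upwards [coeFn_lp hψ', coeFn_lp hm2] with u h1 h2
    rw [Pi.add_apply, h1, h2]
  rw [h2, h3]
  refine h.sub_intOp_eq hm (hψ'.add hm2) ?_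
  filter_upwards [hφ] with u hu
  rw [hu, mul_add, add_assoc, Finset.mul_sum, ← Finset.sum_add_distrib]
  congr 1
  refine Finset.sum_congr rfl fun k _ => ?_
  by_cases h0 : a k u = 0
  · simp [h0]
  suffices hs : u * cauchy μ (b k) φ u =
      pairing μ φ (lp μ (b k)) + cauchy μ (b k) (fun v => v * φ v) u by
    linear_combination a k u * hs
  have hbu : b k u = 0 := (mul_eq_zero.1 (h.separated.mul_eq_zero k u)).resolve_left h0
  have hi := (hB k u h0).1
  have hi2 : Integrable (fun v => φ v * b k v) μ := (Lp.memLp φ).integrable_mul (h.memLp_right' k)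
  -- This is `v / (u - v) = u / (u - v) - 1`. At `v = u` both quotients are `0` by convention, and
  -- the remaining term vanishes because `b k u = 0`.
  have he : (fun v => b k v * (v * φ v) / (u - v)) =
      fun v => u * (b k v * φ v / (u - v)) - φ v * b k v := by
    ext v
    by_cases huv : v = u
    · simp [huv, hbu]
    · have : u - v ≠ 0 := sub_ne_zero.2 (Ne.symm huv)
      field_simp
      ring
  rw [pairing_lp _ (h.memLp_right' k), cauchy, cauchy, he, integral_sub (hi.const_mul u) hi2,
    integral_const_mul]
  ring

end Resolvent

end CubicIIKS

end

noncomputable section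

namespace CubicIIKS

section LpLinear

variable {X : Type*} [MeasurableSpace X] {μ : Measure X}

theorem lp_add {f g : X → ℂ} (hf : MemLp f 2 μ) (hg : MemLp g 2 μ) :
    (lp μ fun u => f u + g u) = lp μ f + lp μ g := by
  refine (eq_lp ((Lp.coeFn_add _ _).trans ?_)).symm
  filter_upwards [coeFn_lp hf, coeFn_lp hg] with u h1 h2
  rw [Pi.add_apply, h1, h2]

theorem lp_const_mul (c : ℂ) {f : X → ℂ} (hf : MemLp f 2 μ) :
    (lp μ fun u => c * f u) = c • lp μ f := by
  refine (eq_lp ((Lp.coeFn_smul _ _).trans ?_)).symm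
  filter_upwards [coeFn_lp hf] with u h1
  rw [Pi.smul_apply, h1, smul_eq_mul]

theorem lp_sum {ι : Type*} [Fintype ι] {f : ι → X → ℂ} (hf : ∀ k, MemLp (f k) 2 μ) :
    (lp μ fun u => ∑ k, f k u) = ∑ k, lp μ (f k) := by
  refine (eq_lp ((Lp.coeFn_finsetSum _ _).trans ?_)).symm
  filter_upwards [eventually_all.2 fun k => coeFn_lp (hf k)] with u h1
  simp only [Finset.sum_apply, h1]

end LpLinear

theorem hasDerivAt_ringInverse {A : Type*} [NormedRing A] [NormedAlgebra ℂ A]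
    [HasSummableGeomSeries A] {f : ℂ → A} {f' : A} {s : ℂ} (hf : HasDerivAt f f' s)
    (hu : IsUnit (f s)) : HasDerivAt (fun s => Ring.inverse (f s))
      (-(Ring.inverse (f s) * f' * Ring.inverse (f s))) s := by
  have h2 := hasFDerivAt_ringInverse (𝕜 := ℂ) hu.unit
  rw [← Ring.inverse_unit, IsUnit.unit_spec] at h2
  simpa using! h2.comp_hasDerivAt s hf

/-! ### Moments under multiplication by the variable -/

section Moments

variable {ι : Type*} [Fintype ι] {μ : Measure ℂ} [SFinite μ] {ε : ℝ} {a b : ι → ℂ → ℂ}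

theorem moment_apply (n : ℕ) (i j : ι) : moment μ a b n i j =
    pairing μ (resolvent μ a b (lp μ (a i))) (lp μ fun u => u ^ n * b j u) := rfl

theorem moment_zero_apply (i j : ι) : moment μ a b 0 i j =
    pairing μ (resolvent μ a b (lp μ (a i))) (lp μ (b j)) := by
  simp [moment_apply]

omit [Fintype ι] [SFinite μ] in
theorem Good.pairing_id_mul (h : Good μ ε a b) {φ : Lp ℂ 2 μ} (hφ : MemLp (fun u => u * φ u) 2 μ)
    (n : ℕ) (j : ι) : pairing μ (lp μ fun u => u * φ u) (lp μ fun u => u ^ n * b j u) =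
      pairing μ φ (lp μ fun u => u ^ (n + 1) * b j u) := by
  rw [pairing_lp _ (h.memLp_right n j), pairing_lp _ (h.memLp_right (n + 1) j)]
  refine integral_congr_ae ?_
  filter_upwards [coeFn_lp hφ] with u hu
  rw [hu]; ring

/-- By `Good.id_mul`, multiplication by `u` commutes with `1 - intOp` up to the rank one terms `a_k
⊗ b_k`; inverting produces the matrix `moment 0`. -/
theorem Good.resolvent_id_mul (h : Good μ ε a b) (hu : IsUnit (1 - intOp μ a b)) (i : ι) :
    MemLp (fun u => u * resolvent μ a b (lp μ (a i)) u) 2 μ ∧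
    resolvent μ a b (lp μ fun u => u * a i u) =
      (lp μ fun u => u * resolvent μ a b (lp μ (a i)) u) -
        ∑ k, moment μ a b 0 i k • resolvent μ a b (lp μ (a k)) := by
  obtain ⟨h1, h2⟩ := h.id_mul (h.memLp_left' i) (by simpa using h.memLp_left 1 i)
    (sub_intOp_resolvent hu (lp μ (a i)))
  refine ⟨h1, ?_⟩
  rw [eq_resolvent hu h2, map_add, map_sum]
  simp only [map_smul, moment_zero_apply, add_sub_cancel_right]

theorem Good.pairing_resolvent_id_mul (h : Good μ ε a b) (hu : IsUnit (1 - intOp μ a b)) (n : ℕ)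
    (i j : ι) :
    pairing μ (resolvent μ a b (lp μ fun u => u * a i u)) (lp μ fun u => u ^ n * b j u) =
      (moment μ a b (n + 1) - moment μ a b 0 * moment μ a b n) i j := by
  obtain ⟨h1, h2⟩ := h.resolvent_id_mul hu i
  rw [h2, map_sub, map_sum, sub_apply, sum_apply, h.pairing_id_mul h1]
  simp [Matrix.mul_apply, moment_apply]

/-- The commutation relation is used twice: first on the resolvent of `a_i`, then on `u` times it,
whose pairings with the `b_k` are the first moments. -/
theorem Good.pairing_resolvent_sq_mul (h : Good μ ε a b) (hu : IsUnit (1 - intOp μ a b))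
    (i j : ι) :
    pairing μ (resolvent μ a b (lp μ fun u => u ^ 2 * a i u)) (lp μ (b j)) =
      (moment μ a b 2 - moment μ a b 0 * (moment μ a b 1 - moment μ a b 0 * moment μ a b 0) -
        moment μ a b 1 * moment μ a b 0) i j := by
  have hm1 : ∀ i, MemLp (fun u => u * a i u) 2 μ := fun i => by simpa using h.memLp_left 1 i
  have hm0 := fun i => h.memLp_left' i
  obtain ⟨h1, h2⟩ := h.id_mul (hm0 i) (hm1 i) (sub_intOp_resolvent hu (lp μ (a i)))
  set φ := lp μ fun u => u * resolvent μ a b (lp μ (a i)) u with hφ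
  have hs : ∀ c : ι → ℂ, (lp μ fun u => ∑ k, c k * a k u) = ∑ k, c k • lp μ (a k) := by
    intro c
    rw [lp_sum fun k => (hm0 k).const_mul (c k)]
    exact Finset.sum_congr rfl fun k _ => lp_const_mul _ (hm0 k)
  have hs1 : ∀ c : ι → ℂ, (lp μ fun u => ∑ k, c k * (u * a k u)) =
      ∑ k, c k • lp μ (fun u => u * a k u) := by
    intro c
    rw [lp_sum fun k => (hm1 k).const_mul (c k)]
    exact Finset.sum_congr rfl fun k _ => lp_const_mul _ (hm1 k)
  have hms : ∀ c : ι → ℂ, MemLp (fun u => ∑ k, c k * a k u) 2 μ := fun c =>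
    memLp_finsetSum _ fun k _ => (hm0 k).const_mul (c k)
  have hms1 : ∀ c : ι → ℂ, MemLp (fun u => ∑ k, c k * (u * a k u)) 2 μ := fun c =>
    memLp_finsetSum _ fun k _ => (hm1 k).const_mul (c k)
  have e : ∀ c : ι → ℂ, (fun u => u * (u * a i u + ∑ k, c k * a k u)) =
      fun u => u ^ 2 * a i u + ∑ k, c k * (u * a k u) := by
    intro c
    ext u
    rw [mul_add, Finset.mul_sum]
    congr 1
    · ring
    · exact Finset.sum_congr rfl fun k _ => by ring
  rw [← hs, ← lp_add (hm1 i) (hms _)] at h2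
  obtain ⟨h3, h4⟩ := h.id_mul (ψ := fun u => u * a i u + ∑ k, _ * a k u) ((hm1 i).add (hms _))
    (by rw [e]; exact (h.memLp_left 2 i).add (hms1 _)) h2
  rw [e, lp_add (h.memLp_left 2 i) (hms1 _), hs1] at h4
  have h5 := eq_resolvent hu h4
  have h6 : resolvent μ a b (lp μ fun u => u ^ 2 * a i u) = (lp μ fun u => u * φ u) -
      ∑ k, moment μ a b 0 i k • resolvent μ a b (lp μ fun u => u * a k u) -
      ∑ k, moment μ a b 1 i k • resolvent μ a b (lp μ (a k)) := by
    have h7 : ∀ k, pairing μ φ (lp μ (b k)) = moment μ a b 1 i k := by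
      intro k
      have := h.pairing_id_mul h1 0 k
      simpa [moment_apply] using this
    rw [h5, map_add, map_add, map_sum, map_sum]
    simp only [map_smul, moment_zero_apply, h7]
    abel
  have h8 := h.pairing_id_mul h3 0 j
  simp only [pow_zero, one_mul, zero_add] at h8
  have h9 := h.pairing_id_mul h1 1 j
  rw [← hφ] at h9
  have h10 : ∀ k, pairing μ (resolvent μ a b (lp μ fun u => u * a k u)) (lp μ (b j)) =
      (moment μ a b 1 - moment μ a b 0 * moment μ a b 0) k j := by
    intro k
    have := h.pairing_resolvent_id_mul hu 0 k j
    simpa using this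
  rw [h6]
  simp only [map_sub, map_sum, sub_apply, sum_apply, h8, h9, map_smul, smul_apply, h10,
    smul_eq_mul, ← moment_zero_apply]
  simp only [Matrix.sub_apply, Matrix.mul_apply, moment_apply]

/-! ### Deformations -/

/-- The functions `e^{pᵢ u} aᵢ(u)`. -/
def expShift (p : ι → ℂ) (a : ι → ℂ → ℂ) (i : ι) (u : ℂ) : ℂ := Complex.exp (p i * u) * a i u

omit [Fintype ι] in
theorem expShift_zero (a : ι → ℂ → ℂ) : expShift 0 a = a := by
  ext i u; simp [expShift]

omit [Fintype ι] in
theorem expShift_eq (p : ι → ℂ) (a : ι → ℂ → ℂ) (i : ι) :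
    expShift p a i = fun u => Complex.exp (p i * u) * a i u := rfl

omit [Fintype ι] in
theorem expShift_ne_zero {p : ι → ℂ} {i : ι} {u : ℂ} : expShift p a i u ≠ 0 ↔ a i u ≠ 0 := by
  simp [expShift]

omit [Fintype ι] [SFinite μ] in
theorem Good.expShift (h : Good μ ε a b) {δ : ℝ} (hδ : δ < ε) {p : ι → ℂ} (hp : ∀ i, ‖p i‖ ≤ δ) :
    Good μ (ε - δ) (expShift p a) (expShift (-p) b) where
  pos := by linarith
  left i := by
    have := (h.left i).exp_mul measurable_id (p i)
    refine this.of_le (B := 1) measurable_id (this.aestronglyMeasurable measurable_id) fun x => ?_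
    rw [one_mul]
    refine le_mul_of_one_le_left (norm_nonneg _) (Real.one_le_exp (mul_nonneg ?_ (norm_nonneg _)))
    linarith [hp i]
  right i := by
    have := (h.right i).exp_mul measurable_id (-p i)
    refine this.of_le (B := 1) measurable_id (this.aestronglyMeasurable measurable_id) fun x => ?_
    rw [one_mul]
    refine le_mul_of_one_le_left (norm_nonneg _) (Real.one_le_exp (mul_nonneg ?_ (norm_nonneg _)))
    rw [norm_neg]
    linarith [hp i]
  separated := h.separated.mono (fun _ _ => expShift_ne_zero.1) (fun _ _ => expShift_ne_zero.1)

omit [Fintype ι] in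
theorem kern_expShift (p : ι → ℂ) (k : ι) : kern (expShift p a) (expShift (-p) b) k =
    fun z => Complex.exp (p k * (z.1 - z.2)) * kern a b k z := by
  ext z
  simp only [kern, expShift, Pi.neg_apply]
  rw [mul_sub, Complex.exp_sub, neg_mul, Complex.exp_neg]
  ring

/-- Complex differentiability on a disc already gives smoothness of every order; this is why the
shifts are taken complex. -/
theorem ExpMemLp.contDiffAt {X : Type*} [MeasurableSpace X] {ν : Measure X} {w α : X → ℂ}
    (hw : Measurable w) (hα : ExpMemLp ν w ε α) (hε : 0 < ε) {n : WithTop ℕ∞} :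
    ContDiffAt ℂ n (fun s => lp ν fun x => Complex.exp (s * w x) * α x) 0 := by
  have : DifferentiableOn ℂ (fun s => lp ν fun x => Complex.exp (s * w x) * α x)
      (Metric.ball 0 ε) := fun s hs =>
    (hasDerivAt_lp_exp hw hα (by simpa using hs)).differentiableAt.differentiableWithinAt
  exact (this.contDiffOn Metric.isOpen_ball).contDiffAt (Metric.ball_mem_nhds _ hε)

theorem ExpMemLp.hasDerivAt {X : Type*} [MeasurableSpace X] {ν : Measure X} {w α : X → ℂ}
    (hw : Measurable w) (hα : ExpMemLp ν w ε α) (hε : 0 < ε) :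
    HasDerivAt (fun s => lp ν fun x => Complex.exp (s * w x) * α x) (lp ν fun x => w x * α x)
      0 := by
  simpa using hasDerivAt_lp_exp hw hα (s := 0) (by simpa using hε)

omit [Fintype ι] [SFinite μ] in
theorem Good.exp_right (h : Good μ ε a b) (n : ℕ) (i : ι) :
    ExpMemLp μ id (ε / 2) fun u => u ^ n * b i u :=
  (h.right i).pow_mul measurable_id (half_lt_self h.pos) n

/-- The moment is composed of `L²`-valued exponential families, the bounded maps `hsOp` and
`pairing`, and inversion, which is smooth at a unit. -/
theorem Good.contDiffAt_moment (h : Good μ ε a b) (hu : IsUnit (1 - intOp μ a b)) (n : ℕ)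
    (i j : ι) {N : WithTop ℕ∞} :
    ContDiffAt ℂ N (fun p => moment μ (CubicIIKS.expShift p a) (CubicIIKS.expShift (-p) b) n i j)
      0 := by
  have hpr : ∀ i, ContDiffAt ℂ N (fun p : ι → ℂ => p i) 0 := fun i => contDiffAt_apply ℂ ℂ i 0
  have hl : ContDiffAt ℂ N (fun p : ι → ℂ => lp μ (CubicIIKS.expShift p a i)) 0 :=
    ContDiffAt.comp (0 : ι → ℂ) (g := fun s => lp μ fun u => Complex.exp (s * id u) * a i u)
      ((h.left i).contDiffAt measurable_id h.pos) (hpr i)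
  have hr : ContDiffAt ℂ N (fun p : ι → ℂ =>
      lp μ fun u => u ^ n * CubicIIKS.expShift (-p) b j u) 0 := by
    have h1 : ContDiffAt ℂ N (fun p : ι → ℂ => -p j) 0 := (hpr j).neg
    have h2 := (h.exp_right n j).contDiffAt measurable_id (half_pos h.pos) (n := N)
    refine (ContDiffAt.comp (0 : ι → ℂ)
      (g := fun s => lp μ fun u => Complex.exp (s * id u) * (u ^ n * b j u))
      (by simpa using h2) h1).congr_of_eventuallyEq
      (Eventually.of_forall fun p => ?_)
    simp only [CubicIIKS.expShift, Pi.neg_apply, Function.comp_apply]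
    congr 1; ext u; simp only [id]; ring
  have hK : ContDiffAt ℂ N (fun p : ι → ℂ =>
      intOp μ (CubicIIKS.expShift p a) (CubicIIKS.expShift (-p) b)) 0 := by
    simp only [intOp, kern_expShift]
    refine ContDiffAt.sum fun k _ => (hsOp μ).contDiff.contDiffAt.comp (0 : ι → ℂ) ?_
    exact ((h.exp_kern k).contDiffAt (by fun_prop) (half_pos h.pos)).comp (0 : ι → ℂ) (hpr k)
  have hR : ContDiffAt ℂ N (fun p : ι → ℂ =>
      resolvent μ (CubicIIKS.expShift p a) (CubicIIKS.expShift (-p) b)) 0 := by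
    refine ContDiffAt.comp (0 : ι → ℂ) (g := Ring.inverse) ?_ (contDiffAt_const.sub hK)
    rw [neg_zero, expShift_zero, expShift_zero]
    exact contDiffAt_ringInverse ℂ hu.unit
  exact ((pairing μ).contDiff.contDiffAt.comp (0 : ι → ℂ) (hR.clm_apply hl)).clm_apply hr

-- The factor `u - v` cancels the denominator and leaves the rank one kernel `a_k(u) b_k(v)`; on the
-- diagonal both sides vanish since `a_k b_k = 0`.
omit [Fintype ι] in
theorem Good.hsOp_sub_mul_kern (h : Good μ ε a b) (k : ι) (φ : Lp ℂ 2 μ) :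
    hsOp μ (lp (μ.prod μ) fun z => (z.1 - z.2) * kern a b k z) φ =
      pairing μ φ (lp μ (b k)) • lp μ (a k) := by
  have hm : MemLp (fun z : ℂ × ℂ => (z.1 - z.2) * kern a b k z) 2 (μ.prod μ) := by
    simpa [ExpMemLp] using (h.exp_kern k).pow_mul (by fun_prop) (half_pos h.pos) 1
  refine Lp.ext ((hsOp_apply hm φ).trans ?_)
  filter_upwards [Lp.coeFn_smul (pairing μ φ (lp μ (b k))) (lp μ (a k)),
    coeFn_lp (h.memLp_left' k)] with u h1 h2
  rw [h1, Pi.smul_apply, h2, pairing_lp _ (h.memLp_right' k), smul_eq_mul, mul_comm,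
    ← integral_const_mul]
  congr 1
  ext v
  by_cases huv : u = v
  · have := h.separated.mul_eq_zero k v
    subst huv
    linear_combination (-φ u) * this
  · have : u - v ≠ 0 := sub_ne_zero.2 huv
    simp only [kern]
    field_simp

/-- The three terms come from the resolvent, whose derivative is `R D R` with `D` of rank one, from
`a_k`, which acquires a factor `u`, and from `b_k`, which acquires `-u`. -/
theorem Good.hasDerivAt_moment [DecidableEq ι] (h : Good μ ε a b) (hu : IsUnit (1 - intOp μ a b))
    (n : ℕ) (i j k : ι) :
    HasDerivAt (fun s : ℂ => moment μ (CubicIIKS.expShift (Pi.single k s) a)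
        (CubicIIKS.expShift (-Pi.single k s) b) n i j)
      ((moment μ a b 0 * Matrix.single k k 1 * moment μ a b n + Matrix.single k k 1 *
        (moment μ a b (n + 1) - moment μ a b 0 * moment μ a b n) -
          moment μ a b (n + 1) * Matrix.single k k 1 : Matrix ι ι ℂ) i j) 0 := by
  have hl : HasDerivAt (fun s : ℂ => lp μ (CubicIIKS.expShift (Pi.single k s) a i))
      (if i = k then lp μ fun u => u * a i u else 0) 0 := by
    split_ifs with hik
    · subst hik
      simpa [expShift_eq] using (h.left i).hasDerivAt measurable_id h.pos
    · simpa [expShift_eq, Pi.single_eq_of_ne hik] using hasDerivAt_const (0 : ℂ) (lp μ (a i))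
  have hr : HasDerivAt (fun s : ℂ => lp μ fun u => u ^ n *
      CubicIIKS.expShift (-Pi.single k s) b j u)
      (if j = k then -lp μ fun u => u ^ (n + 1) * b j u else 0) 0 := by
    split_ifs with hjk
    · subst hjk
      have h2 := (h.exp_right n j).hasDerivAt measurable_id (half_pos h.pos)
      have h3 := HasDerivAt.scomp (0 : ℂ)
        (g₁ := fun s => lp μ fun u => Complex.exp (s * id u) * (u ^ n * b j u))
        (by simpa using h2) (hasDerivAt_neg (0 : ℂ))
      refine (h3.congr_deriv ?_).congr_of_eventuallyEq (Eventually.of_forall fun s => ?_)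
      · rw [neg_one_smul]
        congr 2; ext u; ring
      · simp only [CubicIIKS.expShift, Pi.neg_apply, Function.comp_apply, Pi.single_eq_same, id]
        congr 1; ext u; ring
    · simpa [CubicIIKS.expShift, Pi.single_eq_of_ne hjk] using
        hasDerivAt_const (0 : ℂ) (lp μ fun u => u ^ n * b j u)
  set D : Lp ℂ 2 μ →L[ℂ] Lp ℂ 2 μ := hsOp μ (lp (μ.prod μ) fun z => (z.1 - z.2) * kern a b k z)
    with hD
  have hK : HasDerivAt (fun s : ℂ => intOp μ (CubicIIKS.expShift (Pi.single k s) a)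
      (CubicIIKS.expShift (-Pi.single k s) b)) D 0 := by
    simp only [intOp, kern_expShift]
    have h1 : ∀ l, HasDerivAt (fun s : ℂ => hsOp μ (lp (μ.prod μ) fun z =>
        Complex.exp ((Pi.single k s : ι → ℂ) l * (z.1 - z.2)) * kern a b l z))
        (if l = k then D else 0) 0 := by
      intro l
      split_ifs with hlk
      · subst hlk
        simp only [Pi.single_eq_same]
        exact (hsOp μ).hasFDerivAt.comp_hasDerivAt 0
          ((h.exp_kern l).hasDerivAt (by fun_prop) (half_pos h.pos))
      · simp only [Pi.single_eq_of_ne hlk]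
        exact hasDerivAt_const _ _
    have h2 := HasDerivAt.fun_sum fun l (_ : l ∈ Finset.univ) => h1 l
    simpa using h2
  set R := resolvent μ a b with hRdef
  have hR : HasDerivAt (fun s : ℂ => resolvent μ (CubicIIKS.expShift (Pi.single k s) a)
      (CubicIIKS.expShift (-Pi.single k s) b)) (R * D * R) 0 := by
    have h1 : HasDerivAt (fun s : ℂ => 1 - intOp μ (CubicIIKS.expShift (Pi.single k s) a)
      (CubicIIKS.expShift (-Pi.single k s) b)) (-D) 0 := hK.const_sub 1
    have h2 := hasDerivAt_ringInverse h1 (by simpa [expShift_zero] using hu)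
    refine h2.congr_deriv ?_
    simp only [Pi.single_zero, neg_zero, expShift_zero]
    rw [mul_neg, neg_mul, neg_neg]
    rfl
  have hY := ((pairing μ).hasFDerivAt.comp_hasDerivAt (0 : ℂ) (hR.clm_apply hl)).clm_apply hr
  refine hY.congr_deriv ?_
  have e1 : pairing μ ((R * D * R) (lp μ (a i))) (lp μ fun u => u ^ n * b j u) =
      moment μ a b 0 i k * moment μ a b n k j := by
    change pairing μ (R (D (R (lp μ (a i))))) _ = _
    rw [hD, h.hsOp_sub_mul_kern, map_smul, map_smul, smul_apply, smul_eq_mul, moment_zero_apply,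
      moment_apply]
  simp only [Function.comp_apply, Pi.single_zero, neg_zero, expShift_zero, map_add, add_apply, e1,
    ← hRdef]
  have e2 : pairing μ (R (if i = k then lp μ fun u => u * a i u else 0))
      (lp μ fun u => u ^ n * b j u) = if i = k then
        (moment μ a b (n + 1) - moment μ a b 0 * moment μ a b n) i j else 0 := by
    split_ifs
    · exact h.pairing_resolvent_id_mul hu n i j
    · simp
  have e3 : pairing μ (R (lp μ (a i))) (if j = k then -lp μ fun u => u ^ (n + 1) * b j u else 0) =
      if j = k then -moment μ a b (n + 1) i j else 0 := by
    split_ifs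
    · rw [map_neg, moment_apply]
    · simp
  rw [e2, e3]
  have e4 : (moment μ a b 0 * Matrix.single k k 1 * moment μ a b n : Matrix ι ι ℂ) i j =
      moment μ a b 0 i k * moment μ a b n k j := by
    rw [Matrix.mul_apply, Finset.sum_eq_single k]
    · simp
    · intro l _ hl; simp [hl]
    · simp
  rw [Matrix.sub_apply (_ + _), Matrix.add_apply, e4]
  have e5 : ∀ M : Matrix ι ι ℂ, (Matrix.single k k 1 * M : Matrix ι ι ℂ) i j =
      if i = k then M i j else 0 := by
    intro M
    split_ifs with hik
    · subst hik; simp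
    · simp [Matrix.mul_apply, Ne.symm hik]
  have e6 : ∀ M : Matrix ι ι ℂ, (M * Matrix.single k k 1 : Matrix ι ι ℂ) i j =
      if j = k then M i j else 0 := by
    intro M
    split_ifs with hjk
    · subst hjk; simp
    · simp [Matrix.mul_apply, Ne.symm hjk]
  rw [e5, e6]
  split_ifs <;> ring

end Moments

end CubicIIKS

end

noncomputable section

namespace CubicIIKS

/-! ### Exponentially decaying data of a strongly cubic integrable operator -/

variable {m : ℕ}

/-- The vector `(v₁, …, v_m, 0)`. -/
def hat (v : Fin m → ℝ) : Idx m → ℂ := Sum.elim (fun j => (v j : ℂ)) fun _ => 0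

/-- The exponents in the matrix `Δ`. -/
def phase (θ : Params m) (i : Idx m) (z : ℂ) : ℂ :=
  hat θ.2.2 i * z ^ 3 + hat θ.2.1 i * z ^ 2 + hat θ.1 i * z

theorem Delta_eq (θ : Params m) (z : ℂ) :
    Delta θ z = Matrix.diagonal fun i => Complex.exp (phase θ i z) := by
  rw [Delta]
  congr 1
  ext i
  rcases i with j | j <;> simp [phase, hat]

theorem vecF_apply (F : ℂ → Idx m → ℂ) (c : Params m → ℂ → ℂ) (θ : Params m) (u : ℂ) (i : Idx m) :
    vecF F c θ u i = c θ u * (Complex.exp (phase θ i u) * F u i) := by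
  simp [vecF, Delta_eq, Matrix.mulVec_diagonal]

theorem vecG_apply (G : ℂ → Idx m → ℂ) (c : Params m → ℂ → ℂ) (θ : Params m) (u : ℂ) (i : Idx m) :
    vecG G c θ u i = (c θ u)⁻¹ * (Complex.exp (-phase θ i u) * G u i) := by
  have : (Delta θ u)⁻¹ = Matrix.diagonal fun i => Complex.exp (-phase θ i u) := by
    refine Matrix.inv_eq_left_inv ?_
    rw [Delta_eq, Matrix.diagonal_mul_diagonal]
    simp [← Complex.exp_add]
  simp [vecG, this, Matrix.mulVec_diagonal]

theorem vecF_mul_vecG {F G : ℂ → Idx m → ℂ} {c : Params m → ℂ → ℂ} {θ : Params m} {u : ℂ}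
    (hc : c θ u ≠ 0) (i j : Idx m) : vecF F c θ u i * vecG G c θ u j =
      F u i * G u j * Complex.exp (phase θ i u - phase θ j u) := by
  rw [vecF_apply, vecG_apply, sub_eq_add_neg, Complex.exp_add]
  field_simp

/-- The parameters with `x_k` (if `q`) or `y_k` (otherwise) increased by `σ`. -/
def nudge (θ : Params m) (k : Fin m) (q : Bool) (σ : ℝ) : Params m :=
  if q then (θ.1 + Pi.single k σ, θ.2.1, θ.2.2) else (θ.1, θ.2.1 + Pi.single k σ, θ.2.2)

theorem dist_nudge (θ : Params m) (k : Fin m) (q : Bool) (σ : ℝ) : dist (nudge θ k q σ) θ ≤ |σ| := by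
  cases q <;> simp [nudge, Prod.dist_eq, Pi.norm_single (G := fun _ : Fin m => ℝ)]

theorem hat_add_single (v : Fin m → ℝ) (k : Fin m) (σ : ℝ) (i : Idx m) :
    hat (v + Pi.single k σ) i = hat v i + if i = Sum.inl k then (σ : ℂ) else 0 := by
  rcases i with j | j
  · by_cases h : j = k
    · subst h; simp [hat]
    · simp [hat, h]
  · simp [hat]

theorem phase_nudge (θ : Params m) (k : Fin m) (q : Bool) (σ : ℝ) (i : Idx m) (u : ℂ) :
    phase (nudge θ k q σ) i u =
      phase θ i u + if i = Sum.inl k then (σ : ℂ) * (if q then u else u ^ 2) else 0 := by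
  cases q <;> simp only [phase, nudge, Bool.false_eq_true, if_true, if_false, hat_add_single] <;>
    split_ifs <;> ring

/-- Where `|Re u|` is small compared with `|u|`, the point is near the imaginary direction and `Re
u²` is large and negative. Thus shifts of `x` and `y` together control every direction at infinity.
-/
theorem exp_norm_le (σ : ℝ) (hσ : 0 ≤ σ) (u : ℂ) : Real.exp (σ / 2 * ‖u‖) ≤ Real.exp σ *
    (Real.exp (σ * u.re) + Real.exp (-σ * u.re) +
      (Real.exp (σ * (u ^ 2).re) + Real.exp (-σ * (u ^ 2).re))) := by
  have hle : ∀ r, ‖u‖ / 2 ≤ 1 + |r| →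
      Real.exp (σ / 2 * ‖u‖) ≤ Real.exp σ * (Real.exp (σ * r) + Real.exp (-σ * r)) := by
    intro r hr
    have h1 : Real.exp (σ * |r|) ≤ Real.exp (σ * r) + Real.exp (-σ * r) := by
      rcases abs_cases r with ⟨h, -⟩ | ⟨h, -⟩ <;> rw [h]
      · linarith [Real.exp_pos (-σ * r)]
      · rw [mul_neg, ← neg_mul]; linarith [Real.exp_pos (σ * r)]
    refine le_trans ?_ (mul_le_mul_of_nonneg_left h1 (Real.exp_pos _).le)
    rw [← Real.exp_add]
    gcongr
    nlinarith
  have hn : ‖u‖ ^ 2 = u.re ^ 2 + u.im ^ 2 := by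
    rw [Complex.sq_norm, Complex.normSq_apply]; ring
  rw [mul_add]
  by_cases h : ‖u‖ / 2 ≤ 1 + |u.re|
  · refine (hle _ h).trans (le_add_of_nonneg_right ?_)
    positivity
  · refine (hle _ ?_).trans (le_add_of_nonneg_left ?_)
    · have h2 : (u ^ 2).re = u.re ^ 2 - u.im ^ 2 := by rw [sq, Complex.mul_re]; ring
      push Not at h
      have h3 := sq_abs u.re
      have h4 := abs_nonneg u.re
      have h5 := neg_abs_le (u ^ 2).re
      rw [h2] at h5 ⊢
      nlinarith [norm_nonneg u]
    · positivity

/-! ### Separation, decay and balancing of the data -/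

namespace CubicIntegrableOperator

variable {Ω : ContourUnion} {U : Set (Params m)} (H : CubicIntegrableOperator Ω U)

theorem F_mul_G {u : ℂ} (hu : u ∈ Ω.carrier) (i : Idx m) : H.F u i * H.G u i = 0 := by
  have := H.orthogonal u hu i
  rw [Matrix.single_mulVec, one_mul] at this
  exact (dotProduct_single (H.F u) (H.G u i) i).symm.trans this

variable {H}

theorem IsStrong.eq_of_mem (hH : H.IsStrong) {l : Fin Ω.n} {u v : ℂ}
    (hu : u ∈ (Ω.contour l).carrier) (hv : v ∈ (Ω.contour l).carrier) :
    H.F v = H.F u ∧ H.G v = H.G u :=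
  hH u (mem_iUnion.2 ⟨l, hu⟩) v ((Ω.contour l).isPreconnected_carrier.subset_connectedComponentIn hu
    (subset_iUnion (fun k => (Ω.contour k).carrier) l) hv)

/-- If `F_i` is nonzero somewhere on a contour, constancy and `F_i G_i = 0` force `G_i = 0` on all
of it, so the two points lie on different contours. -/
theorem IsStrong.separated (hH : H.IsStrong) :
    Separated (fun i => Ω.carrier.indicator fun u => H.F u i)
      (fun i => Ω.carrier.indicator fun u => H.G u i) := by
  intro η hη
  obtain ⟨κ, hκ, h⟩ := Ω.separated η hη
  refine ⟨κ, hκ, fun i u v hu hv => ?_⟩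
  rw [indicator_apply_ne_zero] at hu hv
  obtain ⟨k, hk⟩ := mem_iUnion.1 hu.1
  obtain ⟨l, hl⟩ := mem_iUnion.1 hv.1
  have hkl : k ≠ l := by
    rintro rfl
    refine mul_ne_zero hu.2 hv.2 ?_
    change H.F u i * H.G v i = 0
    rw [(hH.eq_of_mem hk hl).2]
    exact H.F_mul_G hu.1 i
  refine ⟨h k l hkl u hk v hl, ?_⟩
  rw [norm_sub_rev]
  exact h l k hkl.symm v hl u hk

/-- Exponentially decaying data of the operator, after a conjugation by a scalar function. -/
structure IsData (H : CubicIntegrableOperator Ω U) (θ : Params m) (ε : ℝ) (a b : Idx m → ℂ → ℂ) :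
    Prop where
  good : Good Ω.arcLength ε a b
  left_ne : ∀ i u, a i u ≠ 0 → u ∈ Ω.carrier ∧ H.F u i ≠ 0
  right_ne : ∀ i u, b i u ≠ 0 → u ∈ Ω.carrier ∧ H.G u i ≠ 0 ∧ Ω.tangent u ≠ 0
  mul_eq : ∀ u ∈ Ω.carrier, ∀ i j, a i u * b j u =
    H.F u i * H.G u j * Complex.exp (phase θ i u - phase θ j u) * Ω.tangent u

theorem memLp_vecF {θ : Params m} (hθ : θ ∈ U) (i : Idx m) :
    MemLp (fun u => vecF H.F H.c θ u i) 2 Ω.arcLength ∧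
      MemLp (fun u => vecF H.F H.c θ u i) ⊤ Ω.arcLength := by
  obtain ⟨h1, h2⟩ := H.memLp_f θ hθ
  exact ⟨h1.eval i, h2.eval i⟩

theorem memLp_vecG {θ : Params m} (hθ : θ ∈ U) (i : Idx m) :
    MemLp (fun u => vecG H.G H.c θ u i) 2 Ω.arcLength ∧
      MemLp (fun u => vecG H.G H.c θ u i) ⊤ Ω.arcLength := by
  obtain ⟨h1, h2⟩ := H.memLp_g θ hθ
  exact ⟨h1.eval i, h2.eval i⟩

/-- Moving the parameters shows that the products `fᵢ gⱼ` decay exponentially. -/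
theorem exists_exp_decay (H : CubicIntegrableOperator Ω U) (hU : IsOpen U) {θ : Params m}
    (hθ : θ ∈ U) : ∃ σ : ℝ, 0 < σ ∧ ∃ M : ℂ → ℝ, Integrable M Ω.arcLength ∧
      (∃ B, ∀ᵐ u ∂Ω.arcLength, M u ≤ B) ∧ ∀ u ∈ Ω.carrier, ∀ i j,
        Real.exp (σ * ‖u‖) * ‖H.F u i * H.G u j * Complex.exp (phase θ i u - phase θ j u)‖
          ≤ M u := by
  obtain ⟨ρ, hρ, hball⟩ := Metric.isOpen_iff.1 hU θ hθ
  set σ := ρ / 2 with hσ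
  have hσ0 : 0 < σ := half_pos hρ
  have hmem : ∀ k q s, |s| = σ → nudge θ k q s ∈ U := fun k q s hs =>
    hball ((dist_nudge θ k q s).trans_lt (by rw [hs, hσ]; exact half_lt_self hρ))
  -- The index records the coordinate, whether `x` (`true`) or `y` is moved, and the sign of the
  -- move.
  let S := Fin m × Bool × Bool
  let par : S → Params m := fun s => nudge θ s.1 s.2.1 (if s.2.2 then σ else -σ)
  have hpar : ∀ s, par s ∈ U := fun s => hmem _ _ _ (by
    rcases s.2.2 <;> simp [abs_of_pos hσ0])
  let P : S → Idx m → Idx m → ℂ → ℂ := fun s i j u =>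
    vecF H.F H.c (par s) u i * vecG H.G H.c (par s) u j
  have hPi : ∀ s i j, Integrable (P s i j) Ω.arcLength := fun s i j =>
    (memLp_vecF (hpar s) i).1.integrable_mul (memLp_vecG (hpar s) j).1
  have hPb : ∀ s i j, ∃ B, ∀ᵐ u ∂Ω.arcLength, ‖P s i j u‖ ≤ B := by
    intro s i j
    have h1 := ae_le_eLpNormEssSup (f := fun u => vecF H.F H.c (par s) u i) (μ := Ω.arcLength)
    have h2 := ae_le_eLpNormEssSup (f := fun u => vecG H.G H.c (par s) u j) (μ := Ω.arcLength)
    have h3 := (memLp_vecF (H := H) (hpar s) i).2.2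
    have h4 := (memLp_vecG (H := H) (hpar s) j).2.2
    rw [eLpNorm_exponent_top] at h3 h4
    refine ⟨(eLpNormEssSup (fun u => vecF H.F H.c (par s) u i) Ω.arcLength).toReal *
      (eLpNormEssSup (fun u => vecG H.G H.c (par s) u j) Ω.arcLength).toReal, ?_⟩
    filter_upwards [h1, h2] with u h1 h2
    rw [norm_mul]
    have h5 := ENNReal.toReal_mono h3.ne h1
    have h6 := ENNReal.toReal_mono h4.ne h2
    rw [toReal_enorm] at h5 h6
    gcongr
  choose B hB using hPb
  have hPn : ∀ u, ∀ i j, 0 ≤ ∑ s, ‖P s i j u‖ := fun u i j =>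
    Finset.sum_nonneg fun s _ => norm_nonneg _
  refine ⟨σ / 2, half_pos hσ0, fun u => Real.exp σ * ∑ i, ∑ j, ∑ s, ‖P s i j u‖, ?_,
    ⟨Real.exp σ * ∑ i, ∑ j, ∑ s, B s i j, ?_⟩, fun u hu i j => ?_⟩
  · exact (integrable_finsetSum _ fun i _ => integrable_finsetSum _ fun j _ =>
      integrable_finsetSum _ fun s _ => (hPi s i j).norm).const_mul _
  · filter_upwards [eventually_all.2 fun i => eventually_all.2 fun j => eventually_all.2 fun s =>
      hB s i j] with u hu
    gcongr with i _ j _ s _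
    exact hu i j s
  · set Q := H.F u i * H.G u j * Complex.exp (phase θ i u - phase θ j u) with hQ
    have hsum : ∑ s, ‖P s i j u‖ ≤ ∑ i, ∑ j, ∑ s, ‖P s i j u‖ := by
      refine le_trans ?_ (Finset.single_le_sum (f := fun i => ∑ j, ∑ s, ‖P s i j u‖)
        (fun i _ => Finset.sum_nonneg fun j _ => hPn u i j) (Finset.mem_univ i))
      exact Finset.single_le_sum (f := fun j => ∑ s, ‖P s i j u‖) (fun j _ => hPn u i j)
        (Finset.mem_univ j)
    refine le_trans ?_ (mul_le_mul_of_nonneg_left hsum (Real.exp_pos _).le)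
    by_cases hij : i = j
    · subst hij
      have : Q = 0 := by rw [hQ, H.F_mul_G hu, zero_mul]
      rw [this, norm_zero, mul_zero]
      exact mul_nonneg (Real.exp_pos _).le (hPn u i i)
    -- As `i ≠ j`, at least one of them is not the last index, and moving its parameters changes the
    -- phase difference. The sign `e` tells whether it is `i` or `j`.
    obtain ⟨k, e, he, hk⟩ : ∃ k : Fin m, ∃ e : ℝ, (e = 1 ∨ e = -1) ∧ ∀ q s,
        phase (nudge θ k q s) i u - phase (nudge θ k q s) j u = phase θ i u - phase θ j u +
          (e * s : ℝ) * (if q then u else u ^ 2) := by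
      rcases i with k | i
      · refine ⟨k, 1, Or.inl rfl, fun q s => ?_⟩
        rw [phase_nudge, phase_nudge, if_pos rfl, if_neg (Ne.symm hij)]
        push_cast; ring
      · rcases j with k | j
        · refine ⟨k, -1, Or.inr rfl, fun q s => ?_⟩
          rw [phase_nudge, phase_nudge, if_pos rfl, if_neg hij]
          push_cast; ring
        · exact absurd (congrArg Sum.inr (Subsingleton.elim i j)) hij
    have hP : ∀ q r, ‖P (k, q, r) i j u‖ = ‖Q‖ *
        Real.exp (e * (if r then σ else -σ) * (if q then u else u ^ 2).re) := by
      intro q r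
      have hc := H.c_ne_zero _ (hpar (k, q, r)) u hu
      change ‖vecF H.F H.c (par (k, q, r)) u i * vecG H.G H.c (par (k, q, r)) u j‖ = _
      rw [vecF_mul_vecG hc, hk, Complex.exp_add, ← mul_assoc, norm_mul, ← hQ,
        Complex.norm_exp, Complex.re_ofReal_mul]
    have hle : ∑ q, ∑ r, ‖P (k, q, r) i j u‖ ≤ ∑ s, ‖P s i j u‖ := by
      rw [Fintype.sum_prod_type]
      simp only [Fintype.sum_prod_type]
      exact Finset.single_le_sum (f := fun k => ∑ q, ∑ r, ‖P (k, q, r) i j u‖)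
        (fun k _ => Finset.sum_nonneg fun q _ => Finset.sum_nonneg fun r _ => norm_nonneg _)
        (Finset.mem_univ k)
    refine le_trans ?_ (mul_le_mul_of_nonneg_left hle (Real.exp_pos _).le)
    have hexp := mul_le_mul_of_nonneg_right (exp_norm_le σ hσ0.le u) (norm_nonneg Q)
    refine hexp.trans (le_of_eq ?_)
    simp only [Fintype.sum_bool, hP, if_true, Bool.false_eq_true, if_false]
    rcases he with rfl | rfl
    · simp only [one_mul]; ring
    · simp only [neg_mul, one_mul, neg_neg]; ring

/-- Only the products `f_i g_j` decay. After rescaling, `a` and `b` both have size at most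
`√(|f||g|)`, so each inherits half of the decay rate. The bound `B` on the products serves for the
boundary terms of the integration by parts. -/
theorem exists_isData (hH : H.IsStrong) (hU : IsOpen U) {θ : Params m} (hθ : θ ∈ U) :
    ∃ (ε : ℝ) (a b : Idx m → ℂ → ℂ), H.IsData θ ε a b ∧ ∃ B, ∀ᵐ u ∂Ω.arcLength, ∀ i j,
      Real.exp (ε * ‖u‖) * ‖H.F u i * H.G u j * Complex.exp (phase θ i u - phase θ j u)‖ ≤ B := by
  obtain ⟨σ, hσ, M, hMi, ⟨B, hB⟩, hM⟩ := H.exists_exp_decay hU hθ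
  set f := vecF H.F H.c θ with hf
  set g := vecG H.G H.c θ with hg
  have hfm : AEStronglyMeasurable f Ω.arcLength := (H.memLp_f θ hθ).1.1
  have hgm : AEStronglyMeasurable g Ω.arcLength := (H.memLp_g θ hθ).1.1
  have hprod : ∀ u ∈ Ω.carrier, Real.exp (σ * ‖u‖) * (‖f u‖ * ‖g u‖) ≤ M u := by
    intro u hu
    -- The norms are maxima of entries, so `‖f u‖ * ‖g u‖` is the modulus of a single product `f_i
    -- g_j`.
    obtain ⟨i, hi⟩ := Finite.exists_max fun i => ‖f u i‖
    obtain ⟨j, hj⟩ := Finite.exists_max fun j => ‖g u j‖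
    rw [← pi_norm_le_iff_of_nonneg (norm_nonneg _)] at hi hj
    refine le_trans ?_ (hM u hu i j)
    rw [← vecF_mul_vecG (H.c_ne_zero θ hθ u hu), norm_mul]
    gcongr
  -- Where `f` or `g` vanishes, both `ρ` and `ρ'` are `0` by the conventions for division; there the
  -- products `f_i g_j` vanish too, so they are still preserved.
  let ρ : ℂ → ℝ := fun u => √(‖g u‖ / ‖f u‖)
  let ρ' : ℂ → ℝ := fun u => √(‖f u‖ / ‖g u‖)
  have hρm : AEStronglyMeasurable (fun u => (ρ u : ℂ)) Ω.arcLength :=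
    (Complex.continuous_ofReal.comp Real.continuous_sqrt).comp_aestronglyMeasurable
      (hgm.norm.div₀ hfm.norm)
  have hρm' : AEStronglyMeasurable (fun u => (ρ' u : ℂ)) Ω.arcLength :=
    (Complex.continuous_ofReal.comp Real.continuous_sqrt).comp_aestronglyMeasurable
      (hfm.norm.div₀ hgm.norm)
  have hsq : ∀ x y : ℝ, 0 ≤ x → 0 ≤ y → (√(x / y) * y) ^ 2 ≤ x * y := by
    intro x y hx hy
    rw [mul_pow, Real.sq_sqrt (by positivity)]
    rcases hy.eq_or_lt with rfl | hy
    · simp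
    · exact le_of_eq (by field_simp)
  have hcar := Ω.ae_mem_carrier
  have hexp : ∀ α : ℂ → ℂ, AEStronglyMeasurable α Ω.arcLength →
      (∀ u ∈ Ω.carrier, ‖α u‖ ^ 2 ≤ ‖f u‖ * ‖g u‖) →
      ExpMemLp Ω.arcLength id (σ / 2) (Ω.carrier.indicator α) := by
    intro α hα hle
    have hm : AEStronglyMeasurable (fun u => (Real.exp (σ / 2 * ‖id u‖) : ℂ) * α u)
        Ω.arcLength := AEStronglyMeasurable.mul (Measurable.aestronglyMeasurable
        (by fun_prop)) hα
    have : MemLp (fun u => (Real.exp (σ / 2 * ‖id u‖) : ℂ) * α u) 2 Ω.arcLength := by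
      rw [memLp_two_iff_integrable_sq_norm hm]
      refine hMi.mono' (hm.norm.pow 2) ?_
      filter_upwards [hcar] with u hu
      rw [Real.norm_of_nonneg (by positivity), norm_mul, Complex.norm_real, Real.norm_eq_abs,
        Real.abs_exp, mul_pow, ← Real.exp_nat_mul, id]
      refine le_trans ?_ (hprod u hu)
      have : ((2 : ℕ) : ℝ) * (σ / 2 * ‖u‖) = σ * ‖u‖ := by push_cast; ring
      rw [this]
      gcongr
      exact hle u hu
    refine (memLp_congr_ae ?_).1 this
    filter_upwards [hcar] with u hu
    rw [indicator_of_mem hu]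
  have hρ : ∀ u i j, (ρ u : ℂ) * f u i * (ρ' u * g u j) = f u i * g u j := by
    intro u i j
    by_cases h1 : f u = 0
    · simp [h1]
    by_cases h2 : g u = 0
    · simp [h2]
    have : ρ u * ρ' u = 1 := by
      have h3 : ‖f u‖ ≠ 0 := norm_ne_zero_iff.2 h1
      have h4 : ‖g u‖ ≠ 0 := norm_ne_zero_iff.2 h2
      change √_ * √_ = 1
      rw [← Real.sqrt_mul (by positivity), Real.sqrt_eq_one]
      field_simp
    have h3 : (ρ u : ℂ) * ρ' u = 1 := by exact_mod_cast this
    linear_combination f u i * g u j * h3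
  refine ⟨σ / 2, fun i => Ω.carrier.indicator fun u => ρ u * f u i,
    fun j => Ω.carrier.indicator fun u => ρ' u * g u j * Ω.tangent u, ⟨⟨half_pos hσ, fun i => ?_,
      fun j => ?_, hH.separated.mono ?_ ?_⟩, ?_, ?_, ?_⟩, B, ?_⟩
  · refine hexp _ (hρm.mul (memLp_vecF hθ i).1.1) fun u _ => ?_
    rw [norm_mul, Complex.norm_real, Real.norm_of_nonneg (Real.sqrt_nonneg _), mul_comm ‖f u‖]
    refine le_trans ?_ (hsq _ _ (norm_nonneg _) (norm_nonneg _))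
    gcongr
    exact norm_le_pi_norm (f u) i
  · refine hexp _ ((hρm'.mul (memLp_vecG hθ j).1.1).mul
      Ω.measurable_tangent.aestronglyMeasurable) fun u _ => ?_
    rw [norm_mul, norm_mul, Complex.norm_real, Real.norm_of_nonneg (Real.sqrt_nonneg _)]
    refine le_trans ?_ (hsq _ _ (norm_nonneg _) (norm_nonneg _))
    refine pow_le_pow_left₀ (by positivity) ?_ 2
    refine (mul_le_of_le_one_right (by positivity) (Ω.norm_tangent_le u)).trans ?_
    gcongr
    exact norm_le_pi_norm (g u) j
  · intro i u hne
    rw [indicator_apply_ne_zero] at hne ⊢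
    refine ⟨hne.1, fun h0 => hne.2 ?_⟩
    simp [hf, vecF_apply, h0]
  · intro i u hne
    rw [indicator_apply_ne_zero] at hne ⊢
    refine ⟨hne.1, fun h0 => hne.2 ?_⟩
    simp [hg, vecG_apply, h0]
  · intro i u hne
    rw [indicator_apply_ne_zero] at hne
    refine ⟨hne.1, fun h0 => hne.2 ?_⟩
    simp [hf, vecF_apply, h0]
  · intro i u hne
    rw [indicator_apply_ne_zero] at hne
    refine ⟨hne.1, fun h0 => hne.2 ?_, fun h0 => hne.2 ?_⟩
    · simp [hg, vecG_apply, h0]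
    · simp [h0]
  · intro u hu i j
    rw [indicator_of_mem hu, indicator_of_mem hu, ← mul_assoc, hρ, hf, hg,
      vecF_mul_vecG (H.c_ne_zero θ hθ u hu)]
  · filter_upwards [hcar, hB] with u hu hBu i j
    refine le_trans ?_ ((hM u hu i j).trans hBu)
    gcongr
    linarith

/-- The operator of the theorem, rewritten against arc length with the tangent absorbed into `g`, is
conjugate to `intOp` in the sense of `Good.isUnit_and_moment_eq`. -/
theorem IsData.isUnit_and_Y₁_eq (hH : H.IsStrong) {θ : Params m} (hθ : θ ∈ U) {ε : ℝ}
    {a b : Idx m → ℂ → ℂ} (hd : H.IsData θ ε a b) (hu : IsUnit (1 - H.op θ)) :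
    IsUnit (1 - intOp Ω.arcLength a b) ∧ H.Y₁ θ = moment Ω.arcLength a b 0 := by
  set f : Idx m → ℂ → ℂ := fun i => Ω.carrier.indicator fun u => vecF H.F H.c θ u i with hf
  set g : Idx m → ℂ → ℂ := fun i => Ω.carrier.indicator fun u => vecG H.G H.c θ u i * Ω.tangent u
    with hg
  have hcar := Ω.ae_mem_carrier
  have hfe : ∀ i, f i =ᵐ[Ω.arcLength] fun u => vecF H.F H.c θ u i := fun i => by
    filter_upwards [hcar] with u hu; exact indicator_of_mem hu _
  have hge : ∀ i, g i =ᵐ[Ω.arcLength] fun u => vecG H.G H.c θ u i * Ω.tangent u := fun i => by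
    filter_upwards [hcar] with u hu; exact indicator_of_mem hu _
  have hfm : ∀ i, MemLp (f i) 2 Ω.arcLength := fun i =>
    (memLp_congr_ae (hfe i)).2 (memLp_vecF hθ i).1
  have hgm : ∀ i, MemLp (g i) 2 Ω.arcLength := fun i => by
    refine (memLp_congr_ae (hge i)).2 (MemLp.of_le (memLp_vecG (H := H) hθ i).1
      ((memLp_vecG hθ i).1.1.mul Ω.measurable_tangent.aestronglyMeasurable)
      (Eventually.of_forall fun u => ?_))
    rw [norm_mul]
    exact mul_le_of_le_one_right (norm_nonneg _) (Ω.norm_tangent_le u)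
  have hs : Separated f g := hH.separated.mono
    (fun i u hne => by
      rw [hf, indicator_apply_ne_zero] at hne
      rw [indicator_apply_ne_zero]
      refine ⟨hne.1, fun h0 => hne.2 ?_⟩
      simp [vecF_apply, h0])
    (fun i u hne => by
      rw [hg, indicator_apply_ne_zero] at hne
      rw [indicator_apply_ne_zero]
      refine ⟨hne.1, fun h0 => hne.2 ?_⟩
      simp [vecG_apply, h0])
  have hT : ∀ φ, H.op θ φ =ᵐ[Ω.arcLength] fun u => ∑ k, f k u * cauchy Ω.arcLength (g k) φ u := by
    intro φ
    obtain ⟨h1, h2⟩ := H.isIntegralOperator θ hθ φ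
    obtain ⟨B, hB⟩ := hs.exists_bound hgm (Lp.memLp φ) one_pos
    filter_upwards [h1, h2, hcar] with u h1 h2 hu
    rw [h2, Ω.contourIntegral_eq_integral (Ω.integrable_mul_tangent h1)]
    have hi : ∀ k, Integrable (fun v => f k u * (g k v * φ v / (u - v))) Ω.arcLength := by
      intro k
      by_cases h0 : f k u = 0
      · simp [h0]
      · exact (hB k u h0).1.const_mul _
    simp only [cauchy, ← integral_const_mul]
    rw [← integral_finsetSum _ fun k _ => hi k]
    refine integral_congr_ae ?_
    filter_upwards [hcar] with v hv
    -- The prescribed value `0` on the diagonal coincides with the convention for division by zero.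
    have hK : iiksKernel (vecF H.F H.c θ) (vecG H.G H.c θ) u v =
        (∑ k, vecF H.F H.c θ u k * vecG H.G H.c θ v k) / (u - v) := by
      rw [iiksKernel]
      split_ifs with huv
      · simp [huv]
      · rfl
    rw [hK, Finset.sum_div, Finset.sum_mul, Finset.sum_mul]
    refine Finset.sum_congr rfl fun k _ => ?_
    rw [hf, hg]
    simp only [indicator_of_mem hu, indicator_of_mem hv]
    ring
  obtain ⟨h1, h2⟩ := hd.good.isUnit_and_moment_eq hfm hgm hs
    (fun k u hne => by
      obtain ⟨h1, h2⟩ := hd.left_ne k u hne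
      rw [hf, indicator_apply_ne_zero]
      refine ⟨h1, ?_⟩
      rw [Function.mem_support, vecF_apply]
      exact mul_ne_zero (H.c_ne_zero θ hθ u h1) (mul_ne_zero (Complex.exp_ne_zero _) h2))
    (fun k u hne => by
      obtain ⟨h1, h2, h3⟩ := hd.right_ne k u hne
      rw [hg, indicator_apply_ne_zero]
      refine ⟨h1, mul_ne_zero ?_ h3⟩
      rw [vecG_apply]
      exact mul_ne_zero (inv_ne_zero (H.c_ne_zero θ hθ u h1))
        (mul_ne_zero (Complex.exp_ne_zero _) h2))
    (fun j k u => by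
      by_cases hu : u ∈ Ω.carrier
      · simp only [hf, hg, indicator_of_mem hu]
        rw [hd.mul_eq u hu, ← mul_assoc, vecF_mul_vecG (H.c_ne_zero θ hθ u hu)]
      · have h3 : a j u = 0 := by
          by_contra hne
          exact hu (hd.left_ne j u hne).1
        simp only [hf, indicator_of_notMem hu, h3, zero_mul]) hT hu
  refine ⟨h1, ?_⟩
  ext i j
  rw [h2, Y₁, Matrix.of_apply]
  have e1 : Ω.toL2 (fun u => vecF H.F H.c θ u i) = lp Ω.arcLength (f i) := lp_congr (hfe i).symm
  rw [e1, Ω.contourIntegral_eq_integral]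
  · refine integral_congr_ae ?_
    filter_upwards [hge j] with u hu
    rw [hu, mul_assoc]
  · exact Ω.integrable_mul_tangent ((Lp.memLp _).integrable_mul (memLp_vecG hθ j).1)

/-- `IsData` sees the parameters only through the products `a_i b_j`, in which `c` cancels. So
exponential multiples of the data at `θ` serve at nearby `x`, with no regularity of `c` in the
parameters. -/
theorem IsData.expShift {θ : Params m} {ε : ℝ} {a b : Idx m → ℂ → ℂ} (hd : H.IsData θ ε a b)
    {δ : ℝ} (hδ : δ < ε) {x : Fin m → ℝ} (hx : dist x θ.1 ≤ δ) :
    H.IsData (x, θ.2.1, θ.2.2) (ε - δ) (expShift (hat (x - θ.1)) a)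
      (CubicIIKS.expShift (-hat (x - θ.1)) b) where
  good := hd.good.expShift hδ fun i => by
    rcases i with j | j
    · have h1 := norm_le_pi_norm (x - θ.1) j
      rw [← dist_eq_norm] at h1
      change ‖(((x - θ.1) j : ℝ) : ℂ)‖ ≤ δ
      rw [Complex.norm_real]
      exact h1.trans hx
    · simpa [hat] using dist_nonneg.trans hx
  left_ne i u hne := hd.left_ne i u (expShift_ne_zero.1 hne)
  right_ne i u hne := hd.right_ne i u (expShift_ne_zero.1 hne)
  mul_eq u hu i j := by
    have h1 := hd.mul_eq u hu i j
    have h2 : ∀ i, hat x i = hat θ.1 i + hat (x - θ.1) i := by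
      intro i
      rcases i with j | j <;> simp [hat]
    have h3 : phase (x, θ.2.1, θ.2.2) i u - phase (x, θ.2.1, θ.2.2) j u =
        phase θ i u - phase θ j u + (hat (x - θ.1) i * u + -hat (x - θ.1) j * u) := by
      simp only [phase, h2]; ring
    rw [h3, Complex.exp_add, Complex.exp_add]
    simp only [CubicIIKS.expShift, Pi.neg_apply]
    linear_combination Complex.exp (hat (x - θ.1) i * u) * Complex.exp (-hat (x - θ.1) j * u) * h1

end CubicIntegrableOperator

end CubicIIKS

end

noncomputable section

namespace CubicIIKS

/-! ### Integration by parts along the contours -/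

/-- A Cauchy integral is differentiable away from the support. -/
theorem hasDerivAt_cauchy {μ : Measure ℂ} {b φ : ℂ → ℂ} {u : ℂ} {r : ℝ} (hr : 0 < r)
    (hb : ∀ v, b v ≠ 0 → r ≤ ‖u - v‖) (hi : Integrable (fun v => b v * φ v) μ) :
    HasDerivAt (cauchy μ b φ) (-∫ v, b v * φ v / (u - v) ^ 2 ∂μ) u := by
  have hfar : ∀ z ∈ Metric.ball u (r / 2), ∀ v, b v ≠ 0 → r / 2 ≤ ‖z - v‖ := by
    intro z hz v hv
    rw [mem_ball_iff_norm, norm_sub_rev] at hz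
    have h1 := norm_sub_le_norm_sub_add_norm_sub u z v
    linarith [hb v hv]
  have hm : ∀ z, ∀ p : ℕ, AEStronglyMeasurable (fun v => b v * φ v / (z - v) ^ p) μ := fun z p =>
    hi.1.div₀ (Measurable.aestronglyMeasurable (by fun_prop))
  have hle : ∀ p : ℕ, ∀ z ∈ Metric.ball u (r / 2), ∀ v,
      ‖b v * φ v / (z - v) ^ p‖ ≤ ((r / 2) ^ p)⁻¹ * ‖b v * φ v‖ := by
    intro p z hz v
    by_cases hv : b v = 0
    · simp [hv]
    · rw [norm_div, norm_pow, div_eq_inv_mul]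
      gcongr
      exact hfar z hz v hv
  have hu : u ∈ Metric.ball u (r / 2) := Metric.mem_ball_self (half_pos hr)
  have key := (hasDerivAt_integral_of_dominated_loc_of_deriv_le (μ := μ)
    (F := fun z v => b v * φ v / (z - v)) (F' := fun z v => -(b v * φ v / (z - v) ^ 2)) (x₀ := u)
    (s := Metric.ball u (r / 2)) (bound := fun v => ((r / 2) ^ 2)⁻¹ * ‖b v * φ v‖)
    (Metric.ball_mem_nhds u (half_pos hr)) (Eventually.of_forall fun z => by simpa using hm z 1)
    (by
      refine (hi.norm.const_mul ((r / 2) ^ 1)⁻¹).mono' (by simpa using hm u 1)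
        (Eventually.of_forall fun v => ?_)
      simpa using hle 1 u hu v) (hm u 2).neg (Eventually.of_forall fun v z hz => by
      rw [norm_neg]; exact hle 2 z hz v) (hi.norm.const_mul _)
    (Eventually.of_forall fun v z hz => ?_)).2
  · rw [integral_neg] at key
    exact key
  · by_cases hv : b v = 0
    · simpa [hv] using hasDerivAt_const z (0 : ℂ)
    · have hne : z - v ≠ 0 := norm_pos_iff.1 ((half_pos hr).trans_le (hfar z hz v hv))
      have h1 := (((hasDerivAt_id z).sub_const v).fun_inv hne).const_mul (b v * φ v)
      simp only [id] at h1
      refine (h1.congr_deriv (by ring)).congr_of_eventuallyEq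
        (Eventually.of_forall fun z => div_eq_mul_inv _ _)

variable {m : ℕ}

/-- The derivatives of the exponents in the matrix `Δ`. -/
def dphase (θ : Params m) (i : Idx m) (z : ℂ) : ℂ :=
  3 * hat θ.2.2 i * z ^ 2 + 2 * hat θ.2.1 i * z + hat θ.1 i

theorem hasDerivAt_phase (θ : Params m) (i : Idx m) (z : ℂ) :
    HasDerivAt (phase θ i) (dphase θ i z) z := by
  have h1 := ((hasDerivAt_pow 3 z).const_mul (hat θ.2.2 i)).add
    ((hasDerivAt_pow 2 z).const_mul (hat θ.2.1 i))
  have h2 := h1.add ((hasDerivAt_id z).const_mul (hat θ.1 i))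
  refine (h2.congr_deriv ?_)
  simp only [dphase]
  push_cast
  ring

theorem continuous_phase (θ : Params m) (i : Idx m) : Continuous (phase θ i) := by
  unfold phase; fun_prop

namespace CubicIntegrableOperator

variable {Ω : ContourUnion} {U : Set (Params m)} {H : CubicIntegrableOperator Ω U}
  {θ : Params m} {ε B : ℝ} {a b : Idx m → ℂ → ℂ}

/-- Integrals of derivatives along `Ω` vanish. -/
theorem IsData.integral_deriv_eq_zero (hH : H.IsStrong) (hd : H.IsData θ ε a b)
    (hB : ∀ᵐ u ∂Ω.arcLength, ∀ i j, Real.exp (ε * ‖u‖) *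
      ‖H.F u i * H.G u j * Complex.exp (phase θ i u - phase θ j u)‖ ≤ B) (j : Idx m)
    {V V' : Idx m → ℂ → ℂ} {M : ℝ}
    (hV : ∀ k, ∀ u ∈ Ω.carrier, H.F u k ≠ 0 → H.G u j ≠ 0 →
      HasDerivAt (V k) (V' k u) u ∧ ‖V k u‖ ≤ M)
    (hint : Integrable (fun u => ∑ k, a k u * b j u *
      ((dphase θ k u - dphase θ j u) * V k u + V' k u)) Ω.arcLength) :
    ∫ u, ∑ k, a k u * b j u * ((dphase θ k u - dphase θ j u) * V k u + V' k u) ∂Ω.arcLength =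
      0 := by
  -- The functions `a_k`, `b_j` need not be differentiable. On each contour, however, `a_k b_j` is a
  -- constant times an exponential and the tangent, and this alone is differentiated.
  set Ψ : (Idx m → ℂ) → (Idx m → ℂ) → ℂ → ℂ := fun F G u => ∑ k, F k * G j *
    Complex.exp (phase θ k u - phase θ j u) * ((dphase θ k u - dphase θ j u) * V k u + V' k u)
    with hΨ
  have he : (fun u => ∑ k, a k u * b j u * ((dphase θ k u - dphase θ j u) * V k u + V' k u))
      =ᵐ[Ω.arcLength] fun u => Ψ (H.F u) (H.G u) u * Ω.tangent u := by
    filter_upwards [Ω.ae_mem_carrier] with u hu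
    rw [hΨ, Finset.sum_mul]
    refine Finset.sum_congr rfl fun k _ => ?_
    rw [hd.mul_eq u hu]
    ring
  have hint' := hint.congr he
  rw [integral_congr_ae he, ← Ω.contourIntegral_eq_integral hint']
  refine Finset.sum_eq_zero fun l _ => ?_
  set C := Ω.contour l with hC
  have h0 := C.mem_carrier 0
  have hcar : ∀ u ∈ C.carrier, u ∈ Ω.carrier := fun u hu => mem_iUnion.2 ⟨l, hu⟩
  set F₀ := H.F (C.γ 0) with hF₀
  set G₀ := H.G (C.γ 0) with hG₀
  have hconst : ∀ u ∈ C.carrier, H.F u = F₀ ∧ H.G u = G₀ := fun u hu => hH.eq_of_mem h0 hu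
  have hΨe : ∀ s, Ψ (H.F (C.γ s)) (H.G (C.γ s)) (C.γ s) = Ψ F₀ G₀ (C.γ s) := fun s => by
    rw [(hconst _ (C.mem_carrier s)).1, (hconst _ (C.mem_carrier s)).2]
  have hint'' := Ω.integrableOn_contour hint' l
  simp only [← hC, hΨe] at hint'' ⊢
  by_cases hG : G₀ j = 0
  · simp [hΨ, hG]
  refine C.integral_deriv_eq_zero (Φ := fun u => ∑ k, F₀ k * G₀ j *
    Complex.exp (phase θ k u - phase θ j u) * V k u) (fun u hu => ?_) hint'' fun hdom => ?_
  · refine HasDerivAt.fun_sum fun k _ => ?_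
    by_cases hF : F₀ k = 0
    · simpa [hF] using hasDerivAt_const u (0 : ℂ)
    · have h1 := (hV k u (hcar u hu) (by rwa [(hconst u hu).1]) (by rwa [(hconst u hu).2])).1
      have h2 := (((hasDerivAt_phase θ k u).fun_sub (hasDerivAt_phase θ j u)).cexp.const_mul
        (F₀ k * G₀ j)).fun_mul h1
      exact h2.congr_deriv (by ring)
  · have hprop : Tendsto C.γ (cocompact ℝ) (cocompact ℂ) := by
      rcases C.closed_or_infinite with ⟨h, -⟩ | ⟨-, h⟩
      · rw [hdom] at h
        have : (2 : ℝ) ∈ Ico (0 : ℝ) 1 := h ▸ mem_univ _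
        norm_num at this
      · exact h
    have hdecay : ∀ k s, Real.exp (ε * ‖C.γ s‖) *
        ‖F₀ k * G₀ j * Complex.exp (phase θ k (C.γ s) - phase θ j (C.γ s))‖ ≤ B := by
      intro k s
      -- The decay is known almost everywhere, whereas the boundary terms need it at every point.
      refine C.le_of_ae_le hdom (N := fun u => Real.exp (ε * ‖u‖) *
        ‖F₀ k * G₀ j * Complex.exp (phase θ k u - phase θ j u)‖) ?_ ?_ s
      · have h1 := continuous_phase θ k
        have h2 := continuous_phase θ j
        fun_prop
      · filter_upwards [Ω.ae_iff_contour.1 hB l, C.ae_mem_carrier] with u hu hc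
        have := hu k j
        rwa [(hconst u hc).1, (hconst u hc).2] at this
    rw [← Finset.sum_const_zero (s := (Finset.univ : Finset (Idx m)))]
    refine tendsto_finsetSum _ fun k _ => ?_
    by_cases hF : F₀ k = 0
    · simp [hF]
    have hM : ∀ s, ‖V k (C.γ s)‖ ≤ M := fun s => by
      have hu := C.mem_carrier s
      exact (hV k _ (hcar _ hu) (by rwa [(hconst _ hu).1]) (by rwa [(hconst _ hu).2])).2
    have hlim : Tendsto (fun s => Real.exp (-(ε * ‖C.γ s‖)) * (B * M)) (cocompact ℝ)
        (𝓝 (0 * (B * M))) := by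
      refine Tendsto.mul_const _ (Real.tendsto_exp_neg_atTop_nhds_zero.comp ?_)
      exact (tendsto_norm_cocompact_atTop.comp hprop).const_mul_atTop hd.good.pos
    rw [zero_mul] at hlim
    refine squeeze_zero_norm (fun s => ?_) hlim
    rw [norm_mul, Real.exp_neg, ← mul_assoc]
    refine mul_le_mul ?_ (hM s) (norm_nonneg _) ?_
    · rw [← div_eq_inv_mul, le_div_iff₀ (Real.exp_pos _), mul_comm]
      exact hdecay k s
    · exact mul_nonneg (by positivity) ((mul_nonneg (Real.exp_pos _).le
        (norm_nonneg _)).trans (hdecay k s))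

end CubicIntegrableOperator

end CubicIIKS

end

noncomputable section

namespace CubicIIKS

/-! ### The resolvent along the contours and the moment relation -/

variable {m : ℕ}

theorem memLp_dphase_mul {μ : Measure ℂ} {f : ℂ → ℂ} (h0 : MemLp f 2 μ)
    (h1 : MemLp (fun u => u * f u) 2 μ) (h2 : MemLp (fun u => u ^ 2 * f u) 2 μ) (θ : Params m)
    (i : Idx m) : MemLp (fun u => dphase θ i u * f u) 2 μ := by
  refine (((h2.const_mul (3 * hat θ.2.2 i)).add (h1.const_mul (2 * hat θ.2.1 i))).add
    (h0.const_mul (hat θ.1 i))).ae_eq (Eventually.of_forall fun u => ?_)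
  simp only [Pi.add_apply, dphase]
  ring

theorem lp_dphase_mul {μ : Measure ℂ} {f : ℂ → ℂ} (h0 : MemLp f 2 μ)
    (h1 : MemLp (fun u => u * f u) 2 μ) (h2 : MemLp (fun u => u ^ 2 * f u) 2 μ) (θ : Params m)
    (i : Idx m) : (lp μ fun u => dphase θ i u * f u) =
      (3 * hat θ.2.2 i) • (lp μ fun u => u ^ 2 * f u) +
        (2 * hat θ.2.1 i) • (lp μ fun u => u * f u) + hat θ.1 i • lp μ f := by
  rw [← lp_const_mul _ h0, ← lp_const_mul _ h1, ← lp_const_mul _ h2,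
    ← lp_add (h2.const_mul _) (h1.const_mul _),
    ← lp_add (f := fun u => _ * (u ^ 2 * f u) + _ * (u * f u))
      ((h2.const_mul _).add (h1.const_mul _)) (h0.const_mul _)]
  congr 1
  ext u
  simp only [dphase]
  ring

/-- The divided difference of the quadratic `dphase` is `3t(w + v) + 2y`, so the singular kernel
disappears and only moments remain. Vanishing of `f` at `w` handles the diagonal. -/
theorem dphase_mul_cauchy_sub {μ : Measure ℂ} {f φ : ℂ → ℂ} {w : ℂ} (hw : f w = 0)
    (θ : Params m) (i : Idx m) (hφ : Integrable (fun v => f v * φ v / (w - v)) μ)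
    (hφ' : Integrable (fun v => f v * (dphase θ i v * φ v) / (w - v)) μ)
    (h0 : Integrable (fun v => φ v * f v) μ) (h1 : Integrable (fun v => φ v * (v * f v)) μ) :
    dphase θ i w * cauchy μ f φ w - cauchy μ f (fun v => dphase θ i v * φ v) w =
      (3 * hat θ.2.2 i * w + 2 * hat θ.2.1 i) * ∫ v, φ v * f v ∂μ +
        3 * hat θ.2.2 i * ∫ v, φ v * (v * f v) ∂μ := by
  rw [cauchy, cauchy, ← integral_const_mul, ← integral_sub (hφ.const_mul _) hφ',
    ← integral_const_mul, ← integral_const_mul, ← integral_add (h0.const_mul _) (h1.const_mul _)]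
  congr 1
  ext v
  by_cases hv : w = v
  · subst hv
    simp [hw]
  · have : w - v ≠ 0 := sub_ne_zero.2 hv
    simp only [dphase]
    field_simp
    ring

namespace CubicIntegrableOperator

variable {Ω : ContourUnion} {U : Set (Params m)} {H : CubicIntegrableOperator Ω U}
  {θ : Params m} {ε B : ℝ} {a b : Idx m → ℂ → ℂ}

/-- The equation for the derivative of `(I - H)⁻¹ f` along the contours. -/
theorem IsData.exists_deriv (hH : H.IsStrong) (hd : H.IsData θ ε a b)
    (hB : ∀ᵐ u ∂Ω.arcLength, ∀ i j, Real.exp (ε * ‖u‖) *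
      ‖H.F u i * H.G u j * Complex.exp (phase θ i u - phase θ j u)‖ ≤ B)
    (hu : IsUnit (1 - intOp Ω.arcLength a b)) (i : Idx m) :
    ∃ D : Lp ℂ 2 Ω.arcLength,
      (D - intOp Ω.arcLength a b D = (lp Ω.arcLength fun u => dphase θ i u * a i u) +
        ∑ k, ((3 * hat θ.2.2 k * moment Ω.arcLength a b 0 i k) • (lp Ω.arcLength fun u => u * a k u)
          + (3 * hat θ.2.2 k * moment Ω.arcLength a b 1 i k +
            2 * hat θ.2.1 k * moment Ω.arcLength a b 0 i k) • lp Ω.arcLength (a k))) ∧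
      ∀ j, pairing Ω.arcLength D (lp Ω.arcLength (b j)) =
        3 * hat θ.2.2 j * moment Ω.arcLength a b 2 i j +
          2 * hat θ.2.1 j * moment Ω.arcLength a b 1 i j +
            hat θ.1 j * moment Ω.arcLength a b 0 i j := by
  have hg := hd.good
  have ha0 := fun k => hg.memLp_left' k
  have ha1 : ∀ k, MemLp (fun u => u * a k u) 2 Ω.arcLength := fun k => by
    simpa using hg.memLp_left 1 k
  have ha2 := fun k => hg.memLp_left 2 k
  have hb0 := fun k => hg.memLp_right' k
  have hb1 : ∀ k, MemLp (fun u => u * b k u) 2 Ω.arcLength := fun k => by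
    simpa using hg.memLp_right 1 k
  have hb2 := fun k => hg.memLp_right 2 k
  set φ := resolvent Ω.arcLength a b (lp Ω.arcLength (a i)) with hφ
  have hφ2 := Lp.memLp φ
  have hm0 : ∀ j, moment Ω.arcLength a b 0 i j = ∫ u, φ u * b j u ∂Ω.arcLength := fun j => by
    rw [moment_zero_apply, pairing_lp _ (hb0 j)]
  have hm1 : ∀ j, moment Ω.arcLength a b 1 i j = ∫ u, φ u * (u * b j u) ∂Ω.arcLength := fun j => by
    rw [moment_apply, pairing_lp _ (hg.memLp_right 1 j)]; simp only [pow_one, hφ]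
  have hm2 : ∀ j, moment Ω.arcLength a b 2 i j = ∫ u, φ u * (u ^ 2 * b j u) ∂Ω.arcLength :=
      fun j => by
    rw [moment_apply, pairing_lp _ (hb2 j)]
  -- the functions `W` and their derivatives
  have hs : Separated (fun i => Ω.carrier.indicator fun u => H.F u i) b :=
    hH.separated.mono (fun _ _ h => h) fun k u hne => by
      obtain ⟨h1, h2, -⟩ := hd.right_ne k u hne
      rw [indicator_apply_ne_zero]
      exact ⟨h1, h2⟩
  have hsF : ∀ {k u}, u ∈ Ω.carrier → H.F u k ≠ 0 →
      Ω.carrier.indicator (fun u => H.F u k) u ≠ 0 := fun h1 h2 => by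
    rw [indicator_apply_ne_zero]; exact ⟨h1, h2⟩
  set W : Idx m → ℂ → ℂ := fun k u => (if k = i then 1 else 0) +
      cauchy Ω.arcLength (b k) φ u with hW
  set W' : Idx m → ℂ → ℂ := fun k u => -∫ v, b k v * φ v / (u - v) ^ 2 ∂Ω.arcLength with hW'
  have hbφ : ∀ k, Integrable (fun v => b k v * φ v) Ω.arcLength := fun k =>
      (hb0 k).integrable_mul hφ2
  obtain ⟨B1, hB1⟩ := hs.exists_bound_of_exp hg.pos hg.right hφ2 1
  obtain ⟨B2, hB2⟩ := hs.exists_bound_of_exp hg.pos hg.right hφ2 2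
  simp only [pow_one] at hB1
  have hWd : ∀ k, ∀ u ∈ Ω.carrier, H.F u k ≠ 0 → HasDerivAt (W k) (W' k u) u := by
    intro k u hu hF
    obtain ⟨κ, hκ, hsep⟩ := hs 1 one_pos
    refine (hasDerivAt_cauchy (r := κ * Real.exp (-1 * ‖u‖)) (by positivity)
      (fun v hv => (hsep k u v (hsF hu hF) hv).1) (hbφ k)).const_add _
  have hWb : ∀ k, ∀ u ∈ Ω.carrier, H.F u k ≠ 0 → ‖W k u‖ ≤ 1 + B1 := by
    intro k u hu hF
    refine (norm_add_le _ _).trans (add_le_add ?_ (hB1 k u (hsF hu hF)).2)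
    split_ifs <;> simp
  have hWb' : ∀ k, ∀ u ∈ Ω.carrier, H.F u k ≠ 0 → ‖W' k u‖ ≤ B2 := by
    intro k u hu hF
    rw [hW', norm_neg]
    exact (hB2 k u (hsF hu hF)).2
  have hWm : ∀ k, AEStronglyMeasurable (W k) Ω.arcLength := fun k =>
    aestronglyMeasurable_const.add (aestronglyMeasurable_cauchy (hb0 k).1 hφ2.1)
  have hWm' : ∀ k, AEStronglyMeasurable (W' k) Ω.arcLength := fun k => by
    have h1 : AEStronglyMeasurable (fun z : ℂ × ℂ => (z.1 - z.2) ^ 2)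
        (Ω.arcLength.prod Ω.arcLength) :=
      Measurable.aestronglyMeasurable (by fun_prop)
    exact (((hb0 k).1.comp_snd.mul hφ2.1.comp_snd).div₀ h1).integral_prod_right'.neg
  have hbdd : ∀ {k : Idx m} {f w : ℂ → ℂ} {M : ℝ}, MemLp (fun u => f u * a k u) 2 Ω.arcLength →
      AEStronglyMeasurable w Ω.arcLength → (∀ u ∈ Ω.carrier, H.F u k ≠ 0 → ‖w u‖ ≤ M) →
      MemLp (fun u => f u * a k u * w u) 2 Ω.arcLength := by
    intro k f w M hf hw hM
    refine MemLp.of_le_mul (c := M) hf (hf.1.mul hw) (Eventually.of_forall fun u => ?_)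
    by_cases h0 : a k u = 0
    · simp [h0]
    · obtain ⟨h1, h2⟩ := hd.left_ne k u h0
      rw [norm_mul, mul_comm]
      gcongr
      exact hM u h1 h2
  have hone : ∀ k, MemLp (fun u => 1 * a k u) 2 Ω.arcLength := fun k => by simpa using ha0 k
  set h : ℂ → ℂ := fun u => ∑ k, a k u * W k u with hh
  -- The formal derivative of `h = ∑ a_k W_k`, with `dphase_k a_k` in place of the derivative of
  -- `a_k`. The scalar factor in `a_k` is left undifferentiated, as it cancels in products with
  -- `b_j`.
  set D : ℂ → ℂ := fun u => ∑ k, a k u * (dphase θ k u * W k u + W' k u) with hD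
  have hhm : MemLp h 2 Ω.arcLength := memLp_finsetSum _ fun k _ => by
    simpa using hbdd (hone k) (hWm k) (hWb k)
  have hDm : MemLp D 2 Ω.arcLength := memLp_finsetSum _ fun k _ => by
    refine ((hbdd (memLp_dphase_mul (ha0 k) (ha1 k) (ha2 k) θ k) (hWm k) (hWb k)).add
      (hbdd (hone k) (hWm' k) (hWb' k))).ae_eq (Eventually.of_forall fun u => ?_)
    simp only [Pi.add_apply]
    ring
  have hφh : φ =ᵐ[Ω.arcLength] h := by
    filter_upwards [hg.eq_of_sub_intOp (ha0 i) (sub_intOp_resolvent hu (lp Ω.arcLength (a i)))] with u hu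
    rw [hφ, hu]
    simp [hh, hW, mul_add, Finset.sum_add_distrib, hφ]
  have hpb : ∀ j, MemLp (fun u => dphase θ j u * b j u) 2 Ω.arcLength := fun j =>
    memLp_dphase_mul (hb0 j) (hb1 j) (hb2 j) θ j
  have hI1 : ∀ j, Integrable (fun u => b j u * D u - dphase θ j u * b j u * h u) Ω.arcLength :=
      fun j =>
    ((hb0 j).integrable_mul hDm).sub ((hpb j).integrable_mul hhm)
  -- integration by parts
  have hsum1 : ∀ j u, ∑ k, a k u * b j u * ((dphase θ k u - dphase θ j u) * W k u + W' k u) =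
      b j u * D u - dphase θ j u * b j u * h u := by
    intro j u
    rw [hD, hh, Finset.mul_sum, Finset.mul_sum, ← Finset.sum_sub_distrib]
    exact Finset.sum_congr rfl fun k _ => by ring
  have hparts1 : ∀ j, ∫ u, b j u * D u ∂Ω.arcLength =
      ∫ u, dphase θ j u * b j u * φ u ∂Ω.arcLength := by
    intro j
    have h1 := hd.integral_deriv_eq_zero hH hB j (V := W) (V' := W') (M := 1 + B1)
      (fun k u hu hF _ => ⟨hWd k u hu hF, hWb k u hu hF⟩)
      (by simp only [hsum1]; exact hI1 j)
    simp only [hsum1] at h1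
    have h2 : Integrable (fun u => b j u * D u) Ω.arcLength := (hb0 j).integrable_mul hDm
    have h3 : Integrable (fun u => dphase θ j u * b j u * h u) Ω.arcLength :=
      (hpb j).integrable_mul hhm
    rw [integral_sub h2 h3, sub_eq_zero] at h1
    rw [h1]
    refine integral_congr_ae ?_
    filter_upwards [hφh] with u hu
    rw [hu]
  -- Integration by parts with `W_k(v) / (w - v)`: differentiating the Cauchy kernel produces the
  -- double pole of `W'`.
  have hparts2 : ∀ j, ∀ w ∈ Ω.carrier, H.F w j ≠ 0 →
      W' j w = cauchy Ω.arcLength (b j) D w -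
        cauchy Ω.arcLength (b j) (fun v => dphase θ j v * φ v) w := by
    intro j w hw hF
    obtain ⟨κ, hκ, hsep⟩ := hH.separated 1 one_pos
    set r := κ * Real.exp (-1 * ‖w‖) with hr
    have hr0 : 0 < r := by positivity
    have hfar : ∀ v ∈ Ω.carrier, H.G v j ≠ 0 → r ≤ ‖w - v‖ := fun v hv hG =>
      (hsep j w v (hsF hw hF) (by rw [indicator_apply_ne_zero]; exact ⟨hv, hG⟩)).1
    have hle : ∀ p : ℕ, ∀ v ∈ Ω.carrier, H.G v j ≠ 0 → ‖((w - v) ^ p)⁻¹‖ ≤ (r ^ p)⁻¹ := by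
      intro p v hv hG
      rw [norm_inv, norm_pow]
      gcongr
      exact hfar v hv hG
    have hinv : ∀ {f : ℂ → ℂ} (p : ℕ), Integrable f Ω.arcLength → (∀ v, b j v = 0 → f v = 0) →
        Integrable (fun v => f v / (w - v) ^ p) Ω.arcLength := by
      intro f p hf h0
      refine (hf.norm.const_mul (r ^ p)⁻¹).mono' (hf.1.div₀ (Measurable.aestronglyMeasurable
        (by fun_prop))) (Eventually.of_forall fun v => ?_)
      by_cases hv : b j v = 0
      · simp [h0 v hv]
      · obtain ⟨h1, h2, -⟩ := hd.right_ne j v hv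
        rw [div_eq_mul_inv, norm_mul, mul_comm]
        gcongr
        exact hle p v h1 h2
    have hJ1 := hinv 1 ((hb0 j).integrable_mul hDm) (fun v hv => by simp [hv])
    have hJ2 := hinv 1 ((hpb j).integrable_mul hhm) (fun v hv => by simp [hv])
    have hJ3 := hinv 2 ((hb0 j).integrable_mul hhm) (fun v hv => by simp [hv])
    simp only [pow_one, Pi.mul_apply] at hJ1 hJ2 hJ3
    have hsum2 : ∀ v, ∑ k, a k v * b j v * ((dphase θ k v - dphase θ j v) * (W k v * (w - v)⁻¹) +
        (W' k v * (w - v)⁻¹ + W k v * ((w - v) ^ 2)⁻¹)) =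
        b j v * D v / (w - v) - dphase θ j v * b j v * h v / (w - v) +
          b j v * h v / (w - v) ^ 2 := by
      intro v
      rw [← sub_div, ← hsum1, hh, Finset.mul_sum, Finset.sum_div, Finset.sum_div,
        ← Finset.sum_add_distrib]
      exact Finset.sum_congr rfl fun k _ => by ring
    have h1 := hd.integral_deriv_eq_zero hH hB j (V := fun k v => W k v * (w - v)⁻¹)
      (V' := fun k v => W' k v * (w - v)⁻¹ + W k v * ((w - v) ^ 2)⁻¹) (M := (1 + B1) * r⁻¹)
      (fun k v hv hFv hGv => by
        have hne : w - v ≠ 0 := norm_pos_iff.1 (hr0.trans_le (hfar v hv hGv))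
        constructor
        · have h2 := ((hasDerivAt_id v).const_sub w).fun_inv hne
          simp only [id, neg_neg] at h2
          refine ((hWd k v hv hFv).fun_mul h2).congr_deriv ?_
          rw [one_div]
        · rw [norm_mul]
          have h3 := hle 1 v hv hGv
          simp only [pow_one] at h3
          exact mul_le_mul (hWb k v hv hFv) h3 (norm_nonneg _)
            ((norm_nonneg _).trans (hWb k v hv hFv)))
      (by simp only [hsum2]; exact (hJ1.sub hJ2).add hJ3)
    simp only [hsum2] at h1
    have h2 := integral_add (hJ1.sub hJ2) hJ3
    have h3 := integral_sub hJ1 hJ2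
    simp only [Pi.sub_apply] at h2
    rw [h2, h3] at h1
    have h4 : W' j w = -∫ v, b j v * h v / (w - v) ^ 2 ∂Ω.arcLength := by
      rw [hW']
      simp only
      congr 1
      refine integral_congr_ae ?_
      filter_upwards [hφh] with v hv
      rw [hv]
    have h5 : cauchy Ω.arcLength (b j) (fun v => dphase θ j v * φ v) w =
        ∫ v, dphase θ j v * b j v * h v / (w - v) ∂Ω.arcLength := by
      refine integral_congr_ae ?_
      filter_upwards [hφh] with v hv
      rw [hv]
      ring
    rw [h4, h5, cauchy]
    linear_combination -h1
  -- the integral equation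
  set ψ : ℂ → ℂ := fun w => ∑ k, (3 * hat θ.2.2 k * moment Ω.arcLength a b 0 i k * (w * a k w) +
    (3 * hat θ.2.2 k * moment Ω.arcLength a b 1 i k +
        2 * hat θ.2.1 k * moment Ω.arcLength a b 0 i k) * a k w) with hψ
  have hψk : ∀ k, MemLp (fun w => 3 * hat θ.2.2 k * moment Ω.arcLength a b 0 i k * (w * a k w) +
      (3 * hat θ.2.2 k * moment Ω.arcLength a b 1 i k +
          2 * hat θ.2.1 k * moment Ω.arcLength a b 0 i k) * a k w) 2 Ω.arcLength :=
    fun k => ((ha1 k).const_mul _).add ((ha0 k).const_mul _)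
  have hψm : MemLp ψ 2 Ω.arcLength := memLp_finsetSum _ fun k _ => hψk k
  have hpa := memLp_dphase_mul (ha0 i) (ha1 i) (ha2 i) θ i
  refine ⟨lp Ω.arcLength D, ?_, fun j => ?_⟩
  · have h1 : (lp Ω.arcLength ψ) = ∑ k,
      ((3 * hat θ.2.2 k * moment Ω.arcLength a b 0 i k) • (lp Ω.arcLength fun u => u * a k u)
          + (3 * hat θ.2.2 k * moment Ω.arcLength a b 1 i k +
            2 * hat θ.2.1 k * moment Ω.arcLength a b 0 i k) • lp Ω.arcLength (a k)) := by
      rw [hψ, lp_sum hψk]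
      refine Finset.sum_congr rfl fun k _ => ?_
      rw [lp_add ((ha1 k).const_mul _) ((ha0 k).const_mul _), lp_const_mul _ (ha1 k),
        lp_const_mul _ (ha0 k)]
    rw [← h1, ← lp_add hpa hψm]
    refine hg.sub_intOp_eq hDm (hpa.add hψm) (Eventually.of_forall fun w => ?_)
    have h2 : dphase θ i w * a i w = ∑ k, a k w * (dphase θ k w * if k = i then 1 else 0) := by
      simp [mul_comm]
    rw [hD, h2, hψ, ← Finset.sum_add_distrib, ← Finset.sum_add_distrib]
    refine Finset.sum_congr rfl fun k _ => ?_
    by_cases h0 : a k w = 0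
    · simp [h0]
    obtain ⟨hw, hF⟩ := hd.left_ne k w h0
    have hbw : b k w = 0 := (mul_eq_zero.1 (hg.separated.mul_eq_zero k w)).resolve_left h0
    have hi := (hB1 k w (hsF hw hF)).1
    have hi' : Integrable (fun v => b k v * (dphase θ k v * φ v) / (w - v)) Ω.arcLength := by
      obtain ⟨κ, hκ, hsep⟩ := hs 1 one_pos
      have hI := (hpb k).integrable_mul hφ2
      refine (hI.norm.const_mul (κ * Real.exp (-1 * ‖w‖))⁻¹).mono'
        (((hb0 k).1.mul (((by unfold dphase; fun_prop : Measurable (dphase θ k)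
          )).aestronglyMeasurable.mul hφ2.1)).div₀ (Measurable.aestronglyMeasurable (by fun_prop)))
        (Eventually.of_forall fun v => ?_)
      by_cases hv : b k v = 0
      · simp [hv]
      · rw [norm_div, div_eq_inv_mul, Pi.mul_apply, mul_comm (dphase θ k v) (b k v), mul_assoc]
        gcongr
        exact (hsep k w v (hsF hw hF) hv).1
    -- By `hparts2`, `W'_k` cancels the Cauchy integral of `D` up to that of `dphase_k φ`; what
    -- remains is exactly this difference.
    have key := dphase_mul_cauchy_sub hbw θ k hi hi' (hφ2.integrable_mul (hb0 k))
      (hφ2.integrable_mul (hb1 k))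
    rw [← hm0, ← hm1] at key
    simp only [hparts2 k w hw hF, hW]
    linear_combination a k w * key
  · rw [pairing_lp _ (hb0 j)]
    have h1 : ∫ u, lp Ω.arcLength D u * b j u ∂Ω.arcLength = ∫ u, b j u * D u ∂Ω.arcLength := by
      refine integral_congr_ae ?_
      filter_upwards [coeFn_lp hDm] with u hu
      rw [hu, mul_comm]
    have h2 : Integrable (fun u => φ u * b j u) Ω.arcLength := hφ2.integrable_mul (hb0 j)
    have h3 : Integrable (fun u => φ u * (u * b j u)) Ω.arcLength := hφ2.integrable_mul (hb1 j)
    have h4 : Integrable (fun u => φ u * (u ^ 2 * b j u)) Ω.arcLength := hφ2.integrable_mul (hb2 j)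
    have h5 : Integrable (fun u => 3 * hat θ.2.2 j * (φ u * (u ^ 2 * b j u)) +
        2 * hat θ.2.1 j * (φ u * (u * b j u))) Ω.arcLength := (h4.const_mul _).add (h3.const_mul _)
    rw [h1, hparts1, hm0, hm1, hm2, ← integral_const_mul, ← integral_const_mul,
      ← integral_const_mul, ← integral_add (h4.const_mul _) (h3.const_mul _),
      ← integral_add h5 (h2.const_mul _)]
    congr 1
    ext u
    simp only [dphase]
    ring

/-- The algebraic relation between the moments that follows from integration by parts. -/
theorem IsData.moment_relation (hH : H.IsStrong) (hd : H.IsData θ ε a b)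
    (hB : ∀ᵐ u ∂Ω.arcLength, ∀ i j, Real.exp (ε * ‖u‖) *
      ‖H.F u i * H.G u j * Complex.exp (phase θ i u - phase θ j u)‖ ≤ B)
    (hu : IsUnit (1 - intOp Ω.arcLength a b)) {Y₀ Y₁ Y₂ T Y X : Matrix (Idx m) (Idx m) ℂ}
    (h0 : Y₀ = moment Ω.arcLength a b 0) (h1 : Y₁ = moment Ω.arcLength a b 1)
    (h2 : Y₂ = moment Ω.arcLength a b 2) (hT : T = hatDiag θ.2.2) (hY : Y = hatDiag θ.2.1)
    (hX : X = hatDiag θ.1) :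
    (3 : ℂ) • (T * (Y₂ - Y₀ * (Y₁ - Y₀ * Y₀) - Y₁ * Y₀)) + (2 : ℂ) • (Y * (Y₁ - Y₀ * Y₀)) + X * Y₀ +
      (3 : ℂ) • (Y₀ * T * (Y₁ - Y₀ * Y₀)) + (3 : ℂ) • (Y₁ * T * Y₀) + (2 : ℂ) • (Y₀ * Y * Y₀) =
    (3 : ℂ) • (Y₂ * T) + (2 : ℂ) • (Y₁ * Y) + Y₀ * X := by
  have hhat : ∀ v : Fin m → ℝ, hatDiag v = Matrix.diagonal (hat v) := fun _ => rfl
  ext i j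
  obtain ⟨D, hD1, hD2⟩ := hd.exists_deriv hH hB hu i
  have hg := hd.good
  have ha1 : ∀ k, MemLp (fun u => u * a k u) 2 Ω.arcLength := fun k => by
    simpa using hg.memLp_left 1 k
  have e1 : ∀ k, pairing Ω.arcLength (resolvent Ω.arcLength a b (lp Ω.arcLength fun u => u * a k u))
      (lp Ω.arcLength (b j)) = (Y₁ - Y₀ * Y₀) k j := fun k => by
    have := hg.pairing_resolvent_id_mul hu 0 k j
    rw [h0, h1]
    simpa using this
  have e2 := hg.pairing_resolvent_sq_mul hu i j
  rw [← h0, ← h1, ← h2] at e2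
  have e3 := hD2 j
  -- The pairing of `D` with `b_j` is known directly by `hD2`, and again by solving its equation
  -- with the resolvent; equating the two gives the relation.
  rw [eq_resolvent hu hD1, lp_dphase_mul (hg.memLp_left' i) (ha1 i) (hg.memLp_left 2 i)] at e3
  simp only [map_add, map_sum, map_smul, add_apply, sum_apply, smul_apply, e1, e2, smul_eq_mul,
    ← moment_zero_apply, ← h0, ← h1, ← h2] at e3
  have e4 : ∀ (M N : Matrix (Idx m) (Idx m) ℂ) (v : Idx m → ℂ),
      (M * Matrix.diagonal v * N : Matrix (Idx m) (Idx m) ℂ) i j = ∑ k, M i k * v k * N k j := by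
    intro M N v
    rw [Matrix.mul_apply]
    exact Finset.sum_congr rfl fun k _ => by rw [Matrix.mul_diagonal]
  have e5 : ∀ (M : Matrix (Idx m) (Idx m) ℂ) (v : Idx m → ℂ),
      (Matrix.diagonal v * M : Matrix (Idx m) (Idx m) ℂ) i j = v i * M i j := fun M v =>
    Matrix.diagonal_mul _ _ _ _
  have e6 : ∀ (M : Matrix (Idx m) (Idx m) ℂ) (v : Idx m → ℂ),
      (M * Matrix.diagonal v : Matrix (Idx m) (Idx m) ℂ) i j = M i j * v j := fun M v =>
    Matrix.mul_diagonal _ _ _ _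
  have e7 : ∑ k, (3 * hat θ.2.2 k * Y₀ i k * (Y₁ - Y₀ * Y₀) k j +
      (3 * hat θ.2.2 k * Y₁ i k + 2 * hat θ.2.1 k * Y₀ i k) * Y₀ k j) =
      3 * (∑ k, Y₀ i k * hat θ.2.2 k * (Y₁ - Y₀ * Y₀) k j) +
        3 * (∑ k, Y₁ i k * hat θ.2.2 k * Y₀ k j) + 2 * ∑ k, Y₀ i k * hat θ.2.1 k * Y₀ k j := by
    rw [Finset.mul_sum, Finset.mul_sum, Finset.mul_sum, ← Finset.sum_add_distrib,
      ← Finset.sum_add_distrib]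
    exact Finset.sum_congr rfl fun k _ => by ring
  rw [e7] at e3
  rw [hT, hY, hX, hhat, hhat, hhat]
  simp only [Matrix.add_apply, Matrix.smul_apply, smul_eq_mul, e4, e5, e6]
  linear_combination e3

end CubicIntegrableOperator

end CubicIIKS

end

noncomputable section

namespace CubicIIKS

/-! ### The matrix identity and the derivatives in `x` -/

variable {m : ℕ}

/-- The commutator of `T` with the relation `hR`, corrected by the commutation of `T` with `Y` and
`X`, removes `Y₂` and turns the other terms into nested commutators. -/
theorem lax_identity {R : Type*} [Ring R] {Y₀ Y₁ Y₂ T Y X D₀ D₁ : R} (hTY : T * Y = Y * T)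
    (hTX : T * X = X * T) (hD₀ : D₀ = Y₀ * T * Y₀ + T * (Y₁ - Y₀ * Y₀) - Y₁ * T)
    (hD₁ : D₁ = Y₀ * T * Y₁ + T * (Y₂ - Y₀ * Y₁) - Y₂ * T)
    (hR : 3 * (T * (Y₂ - Y₀ * (Y₁ - Y₀ * Y₀) - Y₁ * Y₀)) + 2 * (Y * (Y₁ - Y₀ * Y₀)) + X * Y₀ +
      3 * (Y₀ * T * (Y₁ - Y₀ * Y₀)) + 3 * (Y₁ * T * Y₀) + 2 * (Y₀ * Y * Y₀) =
        3 * (Y₂ * T) + 2 * (Y₁ * Y) + Y₀ * X) :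
    3 * (D₀ * T * Y₀ + Y₀ * T * D₀ + T * (D₁ - (D₀ * Y₀ + Y₀ * D₀)) - D₁ * T) =
      2 * ⁅D₀, Y⁆ + ⁅⁅Y₀, T⁆, 3 * D₀ - 2 * ⁅Y₀, Y⁆ - X⁆ := by
  subst hD₀ hD₁
  simp only [Ring.lie_def]
  linear_combination (norm := skip) T * hR - hR * T - 2 * hTY * (Y₁ - Y₀ * Y₀)
    + 2 * Y₁ * hTY - hTX * Y₀ + Y₀ * hTX - 2 * Y₀ * hTY * Y₀
  noncomm_ring

theorem hasDerivAt_matrix_mul {ι : Type*} [Fintype ι] {A B : ℝ → Matrix ι ι ℂ}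
    {A' B' : Matrix ι ι ℂ} {s : ℝ} (hA : ∀ i j, HasDerivAt (fun r => A r i j) (A' i j) s)
    (hB : ∀ i j, HasDerivAt (fun r => B r i j) (B' i j) s) (i j : ι) :
    HasDerivAt (fun r => (A r * B r : Matrix ι ι ℂ) i j)
      ((A' * B s + A s * B' : Matrix ι ι ℂ) i j) s := by
  simp only [Matrix.mul_apply, Matrix.add_apply, ← Finset.sum_add_distrib]
  exact HasDerivAt.fun_sum fun k _ => (hA i k).fun_mul (hB k j)

theorem hat_update_sub (x : Fin m → ℝ) (k : Fin m) (s : ℝ) :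
    hat (Function.update x k s - x) = Pi.single (Sum.inl k) ((s - x k : ℝ) : ℂ) := by
  ext i
  rcases i with j | j
  · by_cases h : j = k
    · subst h; simp [hat]
    · simp [hat, h]
  · simp [hat]

theorem contDiff_hat {N : WithTop ℕ∞} (x₀ : Fin m → ℝ) : ContDiff ℝ N fun x => hat (x - x₀) := by
  refine contDiff_pi.2 fun i => ?_
  rcases i with j | j
  · have h : ContDiff ℝ N fun x : Fin m → ℝ => x j - x₀ j := by fun_prop
    exact Complex.ofRealCLM.contDiff.comp h
  · exact contDiff_const

theorem sum_smul_single (t : Fin m → ℝ) :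
    ∑ k, (t k : ℂ) • Matrix.single (Sum.inl k : Idx m) (Sum.inl k) (1 : ℂ) = hatDiag t := by
  rw [hatDiag, ← Matrix.sum_single_eq_diagonal]
  simp

theorem Good.hasDerivAt_moment_update {μ : Measure ℂ} [SFinite μ] {ε : ℝ} {a b : Idx m → ℂ → ℂ}
    (h : Good μ ε a b) (hu : IsUnit (1 - intOp μ a b)) (n : ℕ) (k : Fin m) (x : Fin m → ℝ)
    (i j : Idx m) :
    HasDerivAt (fun s : ℝ => moment μ (CubicIIKS.expShift (hat (Function.update x k s - x)) a)
        (CubicIIKS.expShift (-hat (Function.update x k s - x)) b) n i j)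
      ((moment μ a b 0 * Matrix.single (Sum.inl k) (Sum.inl k) 1 * moment μ a b n +
        Matrix.single (Sum.inl k) (Sum.inl k) 1 *
        (moment μ a b (n + 1) - moment μ a b 0 * moment μ a b n) -
          moment μ a b (n + 1) * Matrix.single (Sum.inl k) (Sum.inl k) 1 :
            Matrix (Idx m) (Idx m) ℂ) i j) (x k) := by
  have h1 := h.hasDerivAt_moment hu n i j (Sum.inl k)
  have h2 : HasDerivAt (fun s : ℝ => ((s - x k : ℝ) : ℂ)) 1 (x k) := by
    simpa using ((hasDerivAt_id (x k)).sub_const (x k)).ofReal_comp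
  have h3 := HasDerivAt.comp (x k) (h₂ := fun s : ℂ =>
      moment μ (CubicIIKS.expShift (Pi.single (Sum.inl k) s) a)
    (CubicIIKS.expShift (-Pi.single (Sum.inl k) s) b) n i j) (by simpa using h1) h2
  simp only [hat_update_sub]
  simpa using! h3

namespace CubicIntegrableOperator

variable {Ω : ContourUnion} {U : Set (Params m)} {H : CubicIntegrableOperator Ω U}
  {θ : Params m} {ε : ℝ} {a b : Idx m → ℂ → ℂ}

/-- At the cost of half the decay rate, one pair `a`, `b` describes the operator on a neighbourhood
of `x`, so derivatives of `Y₁` become derivatives of moments of shifted data. -/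
theorem IsData.eventually (hd : H.IsData θ ε a b) (hU : IsOpen U) (hθ : θ ∈ U) :
    ∀ᶠ x in 𝓝 θ.1, (x, θ.2.1, θ.2.2) ∈ U ∧ H.IsData (x, θ.2.1, θ.2.2) (ε - ε / 2)
      (CubicIIKS.expShift (hat (x - θ.1)) a) (CubicIIKS.expShift (-hat (x - θ.1)) b) := by
  have hε := hd.good.pos
  have hc : Continuous fun x : Fin m → ℝ => (x, θ.2.1, θ.2.2) := by fun_prop
  filter_upwards [Metric.closedBall_mem_nhds θ.1 (half_pos hε),
    (hc.tendsto θ.1).eventually (hU.mem_nhds hθ)] with x hx hxU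
  exact ⟨hxU, hd.expShift (half_lt_self hε) hx⟩

theorem tendsto_update (x : Fin m → ℝ) (k : Fin m) :
    Tendsto (fun s : ℝ => Function.update x k s) (𝓝 (x k)) (𝓝 x) := by
  have : Continuous fun s : ℝ => Function.update x k s := by fun_prop
  simpa using this.tendsto (x k)

theorem IsData.contDiffAt_Y₁ (hH : H.IsStrong) (hU : IsOpen U)
    (hinv : ∀ θ ∈ U, IsUnit (1 - H.op θ)) (hd : H.IsData θ ε a b) (hθ : θ ∈ U) {N : WithTop ℕ∞}
    (i j : Idx m) : ContDiffAt ℝ N (fun x => H.Y₁ (x, θ.2.1, θ.2.2) i j) θ.1 := by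
  have h1 := (hd.good.contDiffAt_moment (hd.isUnit_and_Y₁_eq hH hθ (hinv θ hθ)).1 0 i j
    (N := N)).restrict_scalars ℝ
  have h2 := (contDiff_hat (N := N) θ.1).contDiffAt (x := θ.1)
  have h0 : hat (θ.1 - θ.1) = 0 := by ext i; rcases i with k | k <;> simp [hat]
  rw [← h0] at h1
  refine (h1.comp θ.1 h2).congr_of_eventuallyEq ?_
  filter_upwards [hd.eventually hU hθ] with x hx
  rw [(hx.2.isUnit_and_Y₁_eq hH hx.1 (hinv _ hx.1)).2]
  rfl

theorem IsData.hasDerivAt_Y₁ (hH : H.IsStrong) (hU : IsOpen U)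
    (hinv : ∀ θ ∈ U, IsUnit (1 - H.op θ)) (hd : H.IsData θ ε a b) (hθ : θ ∈ U) (k : Fin m)
    (i j : Idx m) :
    HasDerivAt (fun s : ℝ => H.Y₁ (Function.update θ.1 k s, θ.2.1, θ.2.2) i j)
      ((moment Ω.arcLength a b 0 * Matrix.single (Sum.inl k) (Sum.inl k) 1 *
        moment Ω.arcLength a b 0 + Matrix.single (Sum.inl k) (Sum.inl k) 1 *
        (moment Ω.arcLength a b 1 - moment Ω.arcLength a b 0 * moment Ω.arcLength a b 0) -
          moment Ω.arcLength a b 1 * Matrix.single (Sum.inl k) (Sum.inl k) 1 :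
            Matrix (Idx m) (Idx m) ℂ) i j) (θ.1 k) := by
  have hu := (hd.isUnit_and_Y₁_eq hH hθ (hinv θ hθ)).1
  refine (hd.good.hasDerivAt_moment_update hu 0 k θ.1 i j).congr_of_eventuallyEq ?_
  filter_upwards [(tendsto_update θ.1 k).eventually (hd.eventually hU hθ)] with s hs
  rw [(hs.2.isUnit_and_Y₁_eq hH hs.1 (hinv _ hs.1)).2]

theorem IsData.del_Y₁ (hH : H.IsStrong) (hU : IsOpen U)
    (hinv : ∀ θ ∈ U, IsUnit (1 - H.op θ)) (hd : H.IsData θ ε a b) (hθ : θ ∈ U) :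
    del H.Y₁ θ = moment Ω.arcLength a b 0 * hatDiag θ.2.2 * moment Ω.arcLength a b 0 +
      hatDiag θ.2.2 * (moment Ω.arcLength a b 1 -
        moment Ω.arcLength a b 0 * moment Ω.arcLength a b 0) -
      moment Ω.arcLength a b 1 * hatDiag θ.2.2 := by
  have h1 : ∀ k, partialX k H.Y₁ θ = moment Ω.arcLength a b 0 *
      Matrix.single (Sum.inl k) (Sum.inl k) 1 * moment Ω.arcLength a b 0 +
      Matrix.single (Sum.inl k) (Sum.inl k) 1 * (moment Ω.arcLength a b 1 -
        moment Ω.arcLength a b 0 * moment Ω.arcLength a b 0) -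
      moment Ω.arcLength a b 1 * Matrix.single (Sum.inl k) (Sum.inl k) 1 := fun k => by
    ext i j
    exact (hd.hasDerivAt_Y₁ hH hU hinv hθ k i j).deriv
  simp only [del, h1, ← sum_smul_single, Finset.mul_sum, Finset.sum_mul, smul_add, smul_sub,
    Finset.sum_add_distrib, Finset.sum_sub_distrib, Matrix.smul_mul, Matrix.mul_smul]

theorem IsData.del_del_Y₁ (hH : H.IsStrong) (hU : IsOpen U)
    (hinv : ∀ θ ∈ U, IsUnit (1 - H.op θ)) (hd : H.IsData θ ε a b) (hθ : θ ∈ U)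
    {Y₀ Y₁ Y₂ T D₀ D₁ : Matrix (Idx m) (Idx m) ℂ} (h0 : Y₀ = moment Ω.arcLength a b 0)
    (h1 : Y₁ = moment Ω.arcLength a b 1) (h2 : Y₂ = moment Ω.arcLength a b 2)
    (hT : T = hatDiag θ.2.2) (hD₀ : D₀ = Y₀ * T * Y₀ + T * (Y₁ - Y₀ * Y₀) - Y₁ * T)
    (hD₁ : D₁ = Y₀ * T * Y₁ + T * (Y₂ - Y₀ * Y₁) - Y₂ * T) :
    del (del H.Y₁) θ =
      D₀ * T * Y₀ + Y₀ * T * D₀ + T * (D₁ - (D₀ * Y₀ + Y₀ * D₀)) - D₁ * T := by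
  have hu := (hd.isUnit_and_Y₁_eq hH hθ (hinv θ hθ)).1
  set E : Fin m → Matrix (Idx m) (Idx m) ℂ := fun k =>
    Matrix.single (Sum.inl k) (Sum.inl k) 1 with hE
  set P₀ : Fin m → Matrix (Idx m) (Idx m) ℂ := fun k =>
    Y₀ * E k * Y₀ + E k * (Y₁ - Y₀ * Y₀) - Y₁ * E k with hP₀
  set P₁ : Fin m → Matrix (Idx m) (Idx m) ℂ := fun k =>
    Y₀ * E k * Y₁ + E k * (Y₂ - Y₀ * Y₁) - Y₂ * E k with hP₁
  have hsum : T = ∑ k, (θ.2.2 k : ℂ) • E k := by rw [hT, ← sum_smul_single]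
  have e0 : D₀ = ∑ k, (θ.2.2 k : ℂ) • P₀ k := by
    simp only [hD₀, hP₀, hsum, Finset.mul_sum, Finset.sum_mul, smul_add, smul_sub,
      Finset.sum_add_distrib, Finset.sum_sub_distrib, Matrix.smul_mul, Matrix.mul_smul]
  have e1 : D₁ = ∑ k, (θ.2.2 k : ℂ) • P₁ k := by
    simp only [hD₁, hP₁, hsum, Finset.mul_sum, Finset.sum_mul, smul_add, smul_sub,
      Finset.sum_add_distrib, Finset.sum_sub_distrib, Matrix.smul_mul, Matrix.mul_smul]
  have hp : ∀ k, partialX k (del H.Y₁) θ = P₀ k * T * Y₀ + Y₀ * T * P₀ k +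
      T * (P₁ k - (P₀ k * Y₀ + Y₀ * P₀ k)) - P₁ k * T := by
    intro k
    ext i j
    refine HasDerivAt.deriv ?_
    -- Near `θ`, `del H.Y₁` is given by the moments of orders `0` and `1` of the shifted data, so no
    -- moment beyond the second enters its derivative.
    set M : ℕ → ℝ → Matrix (Idx m) (Idx m) ℂ := fun n s => moment Ω.arcLength
      (CubicIIKS.expShift (hat (Function.update θ.1 k s - θ.1)) a)
      (CubicIIKS.expShift (-hat (Function.update θ.1 k s - θ.1)) b) n with hM
    have hM0 : ∀ n, M n (θ.1 k) = moment Ω.arcLength a b n := fun n => by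
      simp [hM, hat_update_sub, expShift_zero]
    have d0 : ∀ i j, HasDerivAt (fun s => M 0 s i j) (P₀ k i j) (θ.1 k) := fun i j => by
      have := hd.good.hasDerivAt_moment_update hu 0 k θ.1 i j
      rw [zero_add, ← h0, ← h1] at this
      exact this
    have d1 : ∀ i j, HasDerivAt (fun s => M 1 s i j) (P₁ k i j) (θ.1 k) := fun i j => by
      have := hd.good.hasDerivAt_moment_update hu 1 k θ.1 i j
      rw [one_add_one_eq_two, ← h0, ← h1, ← h2] at this
      exact this
    have dT : ∀ i j, HasDerivAt (fun _ : ℝ => T i j) ((0 : Matrix (Idx m) (Idx m) ℂ) i j)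
      (θ.1 k) := fun i j => hasDerivAt_const _ _
    have d00 := hasDerivAt_matrix_mul d0 d0
    have dZ : ∀ i j, HasDerivAt (fun s => (M 1 s - M 0 s * M 0 s : Matrix (Idx m) (Idx m) ℂ) i j)
        ((P₁ k - (P₀ k * M 0 (θ.1 k) + M 0 (θ.1 k) * P₀ k) : Matrix (Idx m) (Idx m) ℂ) i j)
        (θ.1 k) := fun i j => (d1 i j).fun_sub (d00 i j)
    have d3 := ((hasDerivAt_matrix_mul (hasDerivAt_matrix_mul d0 dT) d0 i j).fun_add
      (hasDerivAt_matrix_mul dT dZ i j)).fun_sub (hasDerivAt_matrix_mul d1 dT i j)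
    simp only [hM0, ← h0, ← h1, mul_zero, add_zero, zero_mul, zero_add] at d3
    refine d3.congr_of_eventuallyEq ?_
    filter_upwards [(tendsto_update θ.1 k).eventually (hd.eventually hU hθ)] with s hs
    rw [hs.2.del_Y₁ hH hU hinv hs.1, hT]
    rfl
  simp only [del, hp]
  rw [e0, e1]
  simp only [Finset.mul_sum, Finset.sum_mul, smul_add, smul_sub, mul_sub, mul_add,
      Finset.sum_add_distrib, Finset.sum_sub_distrib, Matrix.smul_mul, Matrix.mul_smul]

end CubicIntegrableOperator

end CubicIIKS

end

open CubicIIKS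
theorem mainTheorem5 (m : ℕ) (hm : 1 ≤ m) (Ω : ContourUnion) (U : Set (Params m))
    (hU : IsOpen U) (H : CubicIntegrableOperator Ω U) (hH : H.IsStrong)
    (hinv : ∀ θ ∈ U, IsUnit (1 - H.op θ)) :
    (∀ (y t : Fin m → ℝ) (i j : Idx m),
      ContDiffOn ℝ 2 (fun x => H.Y₁ (x, y, t) i j) {x | (x, y, t) ∈ U}) ∧
    (∀ x y t : Fin m → ℝ, (x, y, t) ∈ U →
      (3 : ℂ) • del (del H.Y₁) (x, y, t) =
        (2 : ℂ) • ⁅del H.Y₁ (x, y, t), hatDiag y⁆ +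
          ⁅⁅H.Y₁ (x, y, t), hatDiag t⁆,
            (3 : ℂ) • del H.Y₁ (x, y, t) - (2 : ℂ) • ⁅H.Y₁ (x, y, t), hatDiag y⁆ - hatDiag x⁆) ∧
    (∀ x y t : Fin m → ℝ, (x, y, t) ∈ U →
      del (fun θ => (H.Y₁ θ).toBlocks₂₂) (x, y, t) =
        (H.Y₁ (x, y, t)).toBlocks₂₁ * Matrix.diagonal (fun k => (t k : ℂ)) *
          (H.Y₁ (x, y, t)).toBlocks₁₂) := by
  refine ⟨fun y t i j x hx => ?_, fun x y t hθ => ?_, fun x y t hθ => ?_⟩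
  · obtain ⟨ε, a, b, hd, -⟩ := H.exists_isData hH hU hx
    exact (hd.contDiffAt_Y₁ hH hU hinv hx i j).contDiffWithinAt
  · obtain ⟨ε, a, b, hd, B, hB⟩ := H.exists_isData hH hU hθ
    obtain ⟨hu, hY⟩ := hd.isUnit_and_Y₁_eq hH hθ (hinv _ hθ)
    have hR := hd.moment_relation hH hB hu rfl rfl rfl rfl rfl rfl
    have h1 := hd.del_Y₁ hH hU hinv hθ
    rw [hd.del_del_Y₁ hH hU hinv hθ rfl rfl rfl rfl h1 rfl, hY]
    have hs : ∀ M : Matrix (Idx m) (Idx m) ℂ, (3 : ℂ) • M = 3 * M ∧ (2 : ℂ) • M = 2 * M := by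
      intro M
      simp only [ofNat_smul_eq_nsmul, nsmul_eq_mul]
      exact ⟨rfl, rfl⟩
    simp only [(hs _).1, (hs _).2] at hR ⊢
    have hcomm : ∀ v w : Fin m → ℝ, hatDiag v * hatDiag w = hatDiag w * hatDiag v := fun v w => by
      simp only [hatDiag, Matrix.diagonal_mul_diagonal, mul_comm]
    exact lax_identity (hcomm t y) (hcomm t x) h1 rfl hR
  · obtain ⟨ε, a, b, hd, -⟩ := H.exists_isData hH hU hθ
    have h1 := hd.del_Y₁ hH hU hinv hθ
    rw [← (hd.isUnit_and_Y₁_eq hH hθ (hinv _ hθ)).2] at h1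
    have h2 : del (fun θ => (H.Y₁ θ).toBlocks₂₂) (x, y, t) = (del H.Y₁ (x, y, t)).toBlocks₂₂ := by
      ext i j
      simp [del, partialX, Matrix.toBlocks₂₂, Matrix.sum_apply]
    rw [h2, h1]
    -- The last diagonal entry of `hatDiag t` is `0`, which removes every term with `T̂` at an outer
    -- end.
    ext i j
    simp [Matrix.toBlocks₂₂, Matrix.toBlocks₂₁, Matrix.toBlocks₁₂, hatDiag, Matrix.mul_apply,
      Matrix.diagonal_apply]
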